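/- **Theorem.** For $x>0$ let $$I_\alpha(x)=\sum_{n=0}^{\infty}\frac{x^{\alpha+2n}}{n!\,\Gamma(\alpha+n+1)},\qquad K_0(x)=-\frac{\partial I_\alpha(x)}{\partial\alpha}\Big|_{\alpha=0}$$ (these are the classical modified Bessel functions evaluated at $2x$). For every positive integer $x$ put $$S(x)=\frac1{4x}\sum_{k=0}^{2x}\frac{(2k)!^3}{k!^4\,(16x)^{2k}},\qquad \Delta(x)=I_0(x)K_0(x)-S(x).$$ Then for every positive integer $x$ $$\Delta(x)=-e^{-4x}\left(\frac{5}{24\sqrt{2\pi}\,x^{3/2}}+\varepsilon(x)\right)\quad\text{with}\quad|\varepsilon(x)|<\frac{0.863}{x^2},$$ and, as $x\to+\infty$ through the integers, $$\Delta(x)\sim-\frac{5\,e^{-4x}}{24\sqrt{2\pi}\,x^{3/2}}.$$ Moreover, for every positive integer $x$, the error of the approximation $\dfrac{K_0(x)}{I_0(x)}\simeq\dfrac{S(x)}{I_0(x)^2}$ is $$\frac{K_0(x)}{I_0(x)}-\frac{S(x)}{I_0(x)^2}=\frac{\Delta(x)}{I_0(x)^2},$$ and, as $x\to+\infty$ through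 the integers, $$\frac{\Delta(x)}{I_0(x)^2}\sim-\frac{5\sqrt{2\pi}}{12\,x^{1/2}}\,e^{-8x}.$$ -/

import Mathlib

open Filter Asymptotics

namespace BrentMcMillan

/-- The Bessel function `I_α(x) = ∑ x^(α+2n) / (n! Γ(α+n+1))`; this is the classical modified
Bessel function of the first kind evaluated at `2x`. -/
noncomputable def besselI (α x : ℝ) : ℝ :=
  ∑' n : ℕ, x ^ (α + 2 * (n : ℝ)) / ((n.factorial : ℝ) * Real.Gamma (α + (n : ℝ) + 1))

/-- The Bessel function `K₀(x) = -∂I_α(x)/∂α` at `α = 0`; this is the classical modified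
Bessel function of the second kind evaluated at `2x`. -/
noncomputable def besselK0 (x : ℝ) : ℝ :=
  -deriv (fun α : ℝ => besselI α x) 0

/-- The truncated expansion
`(1 / 4x) ∑_{k=0}^{2x} (2k)!³ / (k!⁴ (16x)^{2k})`, for an integer `x`. -/
noncomputable def truncatedSum (x : ℕ) : ℝ :=
  1 / (4 * (x : ℝ)) * ∑ k ∈ Finset.range (2 * x + 1),
    ((2 * k).factorial : ℝ) ^ 3 / ((k.factorial : ℝ) ^ 4 * (16 * (x : ℝ)) ^ (2 * k))

/-- The truncation error `Δ(x)`. -/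
noncomputable def truncationError (x : ℕ) : ℝ :=
  besselI 0 x * besselK0 x - truncatedSum x

end BrentMcMillan

namespace BrentMcMillan

open Set Topology MeasureTheory

/-! Write k(z) = ∫₀^∞ exp(-z cosh t) dt, which is `coshInt 0 z`; then K₀(x) = k(2x)
(`besselK0_eq_coshInt`). The product I₀K₀ is a principal value: (π²/2) I₀(x)K₀(x) = PV ∫₀^∞
k(2xt)²/(1 - t²) dt. Subtracting the geometric sum ∑ t^{2k} from 1/(1 - t²) removes the moments ∫₀^∞
t^{2k} k(2xt)² dt, and these are exactly π²/2 times the terms of S(x). Stopping at k = 2x leaves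
Δ(x) = (2/π²) PV ∫₀^∞ t^{4x+2} k(2xt)²/(1 - t²) dt (`integral_errorIntegrand`).

Because k(2xt)² is close to (π/4xt) exp(-4xt), the numerator is governed by (t e^{-t})^{4x}, whose
maximum t = 1 is the pole itself. The substitutions t = e^{-y} and t = e^y fold the principal value
into an absolutely convergent integral over y > 0. With N = 4x its integrand is, up to a constant,
close to e^{-Ny²/2}(2 - Ny²/3), whose integral is (2 - 1/3)√(π/2)/√N. This is the source of the 5 in
the constant. All the errors together are at most 30/N (`abs_truncationError_sub_le`).

The principal value identity rests on two facts. First, I₀K₀ is the average of k(4x sin θ) over a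
quarter period (`integral_coshInt_sin`): integrate the series of K₀ term by term and compare with
the Cauchy product I₀K₀, using ∑ C(N,i)² H_i = C(2N,N)(2H_N - H_{2N}). Second, k(z)² = 2∫ k(2z cosh
q) dq (`ofReal_coshInt_zero_sq`), while the principal value transform of k is a Laplace integral
over [0, 1] (`lintegral_coshInt_sub`). Interchanges of nonnegative integrals are made in `ENNReal`,
where Tonelli needs no integrability.

For the last equivalent, I₀ = (S + Δ)/K₀ with 4xS → 1, 4xΔ → 0 and a known equivalent of K₀, which
gives I₀ ~ e^{2x}/(2√(πx)). -/

/-! ### The series of I_α and its derivative in the order -/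

/-- The rising product `(α + 1) ⋯ (α + n)`. -/
noncomputable def risingProd (n : ℕ) (α : ℝ) : ℝ := ∏ j ∈ Finset.range n, (α + (j + 1))

lemma risingProd_pos (n : ℕ) {α : ℝ} (hα : -1 < α) : 0 < risingProd n α :=
  Finset.prod_pos fun j _ => by have : (0 : ℝ) ≤ j := j.cast_nonneg; linarith

lemma risingProd_zero_right (n : ℕ) : risingProd n 0 = n.factorial := by
  simp [risingProd, ← Finset.prod_range_add_one_eq_factorial]

lemma Gamma_add_nat (n : ℕ) {α : ℝ} (hα : -1 < α) :
    Real.Gamma (α + n + 1) = Real.Gamma (α + 1) * risingProd n α := by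
  induction n with
  | zero => simp [risingProd]
  | succ n ih =>
    have h : α + (n : ℝ) + 1 ≠ 0 := by have : (0 : ℝ) ≤ n := n.cast_nonneg; linarith
    rw [risingProd, Finset.prod_range_succ, ← mul_assoc, ← risingProd, ← ih]
    push_cast
    rw [← add_assoc, Real.Gamma_add_one h]
    ring

lemma hasDerivAt_inv_risingProd (n : ℕ) {α : ℝ} (hα : -1 < α) :
    HasDerivAt (fun a => (risingProd n a)⁻¹)
      (-(risingProd n α)⁻¹ * ∑ j ∈ Finset.range n, (α + (j + 1))⁻¹) α := by
  induction n with
  | zero => simpa [risingProd] using hasDerivAt_const α (1 : ℝ)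
  | succ n ih =>
    have h : α + ((n : ℝ) + 1) ≠ 0 := by have : (0 : ℝ) ≤ n := n.cast_nonneg; linarith
    have h2 := ih.mul (((hasDerivAt_id α).add_const ((n : ℝ) + 1)).inv h)
    have e : (fun a => (risingProd (n + 1) a)⁻¹) =
        (fun a => (risingProd n a)⁻¹) * (fun a => (id a + ((n : ℝ) + 1))⁻¹) := by
      ext a; simp [risingProd, Finset.prod_range_succ, mul_comm]
    have e2 : (risingProd (n + 1) α)⁻¹ = (risingProd n α)⁻¹ * (α + ((n : ℝ) + 1))⁻¹ := by
      simp [risingProd, Finset.prod_range_succ, mul_comm]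
    rw [e]
    convert! h2 using 1
    rw [e2, Finset.sum_range_succ]
    simp only [id, Pi.inv_apply]
    field_simp
    ring

lemma risingProd_ge (n : ℕ) {α : ℝ} (hα : -(1 / 2) < α) :
    (n.factorial : ℝ) / 2 ^ n ≤ risingProd n α := by
  rw [← Finset.prod_range_add_one_eq_factorial, risingProd]
  push_cast
  rw [show (2 : ℝ) ^ n = ∏ _j ∈ Finset.range n, 2 by simp, ← Finset.prod_div_distrib]
  refine Finset.prod_le_prod (fun j _ => by positivity) fun j _ => ?_
  have : (0 : ℝ) ≤ j := j.cast_nonneg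
  linarith

lemma summable_pow_div_factorial_sq_mul (y : ℝ) :
    Summable fun n : ℕ => (n : ℝ) * (y ^ n / (n.factorial : ℝ) ^ 2) := by
  have h := (Real.summable_pow_div_factorial |y|)
  refine Summable.of_norm_bounded h fun n => ?_
  rw [norm_mul, norm_div, norm_pow, Real.norm_eq_abs, Real.norm_eq_abs, Real.norm_eq_abs, abs_pow,
    Nat.abs_cast, Nat.abs_cast]
  have h1 : (n : ℝ) ≤ n.factorial := by exact_mod_cast Nat.self_le_factorial n
  have h2 : (0 : ℝ) < n.factorial := by exact_mod_cast n.factorial_pos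
  rw [← mul_div_assoc, div_le_div_iff₀ (by positivity) h2]
  have : 0 ≤ |y| ^ n := by positivity
  nlinarith [mul_le_mul_of_nonneg_left h1 (mul_nonneg this h2.le)]

lemma summable_pow_div_factorial_sq (y : ℝ) :
    Summable fun n : ℕ => y ^ n / (n.factorial : ℝ) ^ 2 := by
  refine Summable.of_norm_bounded (Real.summable_pow_div_factorial |y|) fun n => ?_
  rw [norm_div, norm_pow, Real.norm_eq_abs, norm_pow, Real.norm_eq_abs, Nat.abs_cast]
  have h1 : (1 : ℝ) ≤ n.factorial := by exact_mod_cast n.factorial_pos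
  gcongr
  nlinarith

/-- The series `∑ yⁿ / n!²`. -/
noncomputable def besselSeries (y : ℝ) : ℝ := ∑' n : ℕ, y ^ n / (n.factorial : ℝ) ^ 2

/-- The series `∑ Hₙ yⁿ / n!²`. -/
noncomputable def harmonicSeries (y : ℝ) : ℝ :=
  ∑' n : ℕ, (harmonic n : ℝ) * (y ^ n / (n.factorial : ℝ) ^ 2)

lemma harmonic_nonneg (n : ℕ) : (0 : ℝ) ≤ harmonic n := by
  rcases Nat.eq_zero_or_pos n with rfl | h
  · simp
  · exact_mod_cast (harmonic_pos h.ne').le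

lemma harmonic_le (n : ℕ) : (harmonic n : ℝ) ≤ n := by
  induction n with
  | zero => simp
  | succ n ih =>
    rw [harmonic_succ]
    push_cast
    have : ((n : ℝ) + 1)⁻¹ ≤ 1 := inv_le_one_of_one_le₀ (by have : (0:ℝ) ≤ n := n.cast_nonneg; linarith)
    linarith

lemma summable_harmonic (y : ℝ) :
    Summable fun n : ℕ => (harmonic n : ℝ) * (y ^ n / (n.factorial : ℝ) ^ 2) := by
  refine Summable.of_norm_bounded (summable_pow_div_factorial_sq_mul |y|) fun n => ?_
  rw [norm_mul, norm_div, norm_pow, norm_pow, Real.norm_eq_abs, Real.norm_eq_abs, Real.norm_eq_abs,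
    Nat.abs_cast, abs_of_nonneg (harmonic_nonneg n)]
  exact mul_le_mul_of_nonneg_right (harmonic_le n) (by positivity)

lemma besselI_zero (x : ℝ) : besselI 0 x = besselSeries (x ^ 2) := by
  refine tsum_congr fun n => ?_
  rw [zero_add, zero_add, Real.Gamma_nat_eq_factorial, sq (n.factorial : ℝ), ← pow_mul]
  congr 1
  exact_mod_cast Real.rpow_natCast x (2 * n)

lemma besselI_eq {α x : ℝ} (hx : 0 < x) (hα : -1 < α) :
    besselI α x = x ^ α * (Real.Gamma (α + 1))⁻¹ *
      ∑' n : ℕ, (x ^ 2) ^ n / n.factorial * (risingProd n α)⁻¹ := by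
  rw [besselI, ← tsum_mul_left]
  refine tsum_congr fun n => ?_
  rw [Gamma_add_nat n hα, Real.rpow_add hx, ← pow_mul,
    show x ^ (2 * (n : ℝ)) = x ^ (2 * n) by exact_mod_cast Real.rpow_natCast x (2 * n)]
  have := (risingProd_pos n hα).ne'
  have := (Real.Gamma_pos_of_pos (by linarith : 0 < α + 1)).ne'
  field_simp

/-- Termwise differentiation. For |α| < 1/2 each factor α + j + 1 is at least (j + 1)/2 and at least
1/2, so the differentiated terms are dominated by 2n(2|y|)ⁿ/n!². -/
lemma hasDerivAt_tsum_risingProd (y : ℝ) :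
    HasDerivAt (fun α => ∑' n : ℕ, y ^ n / n.factorial * (risingProd n α)⁻¹)
      (-harmonicSeries y) 0 := by
  have hu : Summable fun n : ℕ => 2 * ((n : ℝ) * ((2 * |y|) ^ n / (n.factorial : ℝ) ^ 2)) :=
    (summable_pow_div_factorial_sq_mul _).mul_left 2
  have h := hasDerivAt_tsum_of_isPreconnected (𝕜 := ℝ) (F := ℝ) hu (t := Ioo (-(1 / 2)) (1 / 2))
    (g := fun n α => y ^ n / n.factorial * (risingProd n α)⁻¹)
    (g' := fun n α => y ^ n / n.factorial *
      (-(risingProd n α)⁻¹ * ∑ j ∈ Finset.range n, (α + (j + 1))⁻¹))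
    (y₀ := 0) (y := 0) isOpen_Ioo isPreconnected_Ioo ?_ ?_ (by norm_num) ?_ (by norm_num)
  · refine h.congr_deriv ?_
    rw [harmonicSeries, ← tsum_neg]
    refine tsum_congr fun n => ?_
    rw [risingProd_zero_right, harmonic]
    push_cast
    simp only [zero_add]
    field_simp
  · intro n α hα
    exact (hasDerivAt_inv_risingProd n (by linarith [hα.1])).const_mul _
  · intro n α hα
    have h0 : 0 < risingProd n α := risingProd_pos n (by linarith [hα.1])
    have hs : ∑ j ∈ Finset.range n, (α + ((j : ℝ) + 1))⁻¹ ≤ 2 * n := by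
      have : ∀ j ∈ Finset.range n, (α + ((j : ℝ) + 1))⁻¹ ≤ 2 := fun j _ => by
        have : (0 : ℝ) ≤ j := j.cast_nonneg
        rw [inv_le_comm₀ (by linarith [hα.1]) (by norm_num)]
        linarith [hα.1]
      calc _ ≤ ∑ j ∈ Finset.range n, (2 : ℝ) := Finset.sum_le_sum this
        _ = 2 * n := by simp [mul_comm]
    have hs0 : 0 ≤ ∑ j ∈ Finset.range n, (α + ((j : ℝ) + 1))⁻¹ :=
      Finset.sum_nonneg fun j _ => inv_nonneg.2 (by
        have : (0 : ℝ) ≤ j := j.cast_nonneg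
        linarith [hα.1])
    have hr : (risingProd n α)⁻¹ ≤ 2 ^ n / n.factorial := by
      rw [← inv_div]
      exact inv_anti₀ (by positivity) (risingProd_ge n hα.1)
    rw [norm_mul, norm_mul, norm_neg, norm_div, norm_pow]
    simp only [Real.norm_eq_abs, Nat.abs_cast]
    rw [abs_of_pos (inv_pos.2 h0), abs_of_nonneg hs0]
    calc _ ≤ |y| ^ n / n.factorial * (2 ^ n / n.factorial * (2 * n)) := by gcongr
      _ = _ := by rw [mul_pow]; field_simp
  · have := summable_pow_div_factorial_sq y
    refine this.congr fun n => ?_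
    rw [risingProd_zero_right]
    field_simp

/-- Product rule at α = 0 in the factorisation `besselI_eq`: x^α contributes log x, 1/Γ(α + 1)
contributes γ, and the series contributes minus the harmonic series. A genuine `HasDerivAt` is
established, so the `deriv` in the definition is not the default value 0. -/
lemma besselK0_eq {x : ℝ} (hx : 0 < x) :
    besselK0 x = besselSeries (x ^ 2) * (-Real.eulerMascheroniConstant - Real.log x) +
      harmonicSeries (x ^ 2) := by
  have h1 : HasDerivAt (fun α : ℝ => x ^ α) (Real.log x) 0 := by
    simpa using (hasDerivAt_id (0 : ℝ)).const_rpow hx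
  have h2 : HasDerivAt (fun α : ℝ => (Real.Gamma (α + 1))⁻¹) Real.eulerMascheroniConstant 0 := by
    have hG : HasDerivAt Real.Gamma (-Real.eulerMascheroniConstant) (0 + 1) := by
      rw [Real.eulerMascheroniConstant_eq_neg_deriv, neg_neg, zero_add]
      exact (Real.differentiableAt_Gamma fun m => by
        have : (0 : ℝ) ≤ m := m.cast_nonneg
        linarith).hasDerivAt
    simpa using (hG.comp_add_const 0 1).fun_inv (by simp)
  have h3 := (h1.mul h2).mul (hasDerivAt_tsum_risingProd (x ^ 2))
  have h4 : HasDerivAt (fun α : ℝ => besselI α x) _ 0 := h3.congr_of_eventuallyEq (by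
    filter_upwards [Ioi_mem_nhds (show (-1 : ℝ) < 0 by norm_num)] with α hα
    exact besselI_eq hx hα)
  have h5 : ∑' n : ℕ, (x ^ 2) ^ n / n.factorial * (risingProd n 0)⁻¹ = besselSeries (x ^ 2) :=
    tsum_congr fun n => by rw [risingProd_zero_right]; field_simp
  rw [besselK0, h4.deriv, h5]
  simp
  ring

/-! ### A Vandermonde convolution weighted by harmonic numbers -/

lemma ring_choose_mul_risingProd (i a : ℕ) (X : ℝ) :
    Ring.choose (X + (i + a : ℕ)) a * a.factorial * risingProd i X = risingProd (i + a) X := by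
  rw [Ring.choose_eq_smul, smul_eq_mul, mul_comm _ (a.factorial : ℝ),
    mul_inv_cancel_left₀ (by positivity), ← Polynomial.aeval_eq_smeval,
    Polynomial.aeval_def, ← Polynomial.eval_map, descPochhammer_map,
    descPochhammer_eval_eq_prod_range, risingProd, risingProd, Finset.prod_range_add, mul_comm]
  congr 1
  rw [← Finset.prod_range_reflect]
  refine Finset.prod_congr rfl fun j hj => ?_
  have hj' : j + 1 ≤ a := Finset.mem_range.1 hj
  have : ((a - 1 - j : ℕ) : ℝ) = a - 1 - j := by
    rw [Nat.sub_sub, Nat.cast_sub (by omega)]; push_cast; ring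
  rw [this]; push_cast; ring

/-- Chu–Vandermonde for N + (X + N) choose N. For i + a = N, the factor (X + N choose a) equals
`risingProd N X` divided by a! `risingProd i X`, so X enters the sum only through reciprocals of
rising products, ready to be differentiated. -/
lemma sum_inv_risingProd (N : ℕ) {X : ℝ} (hX : -1 < X) :
    ∑ p ∈ Finset.HasAntidiagonal.antidiagonal N,
      (N.choose p.1 : ℝ) * (p.2.factorial : ℝ)⁻¹ * (risingProd p.1 X)⁻¹ =
    risingProd (N + N) X * (risingProd N X)⁻¹ * (risingProd N X)⁻¹ * (N.factorial : ℝ)⁻¹ := by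
  have hp := fun n => (risingProd_pos n hX).ne'
  have hf : ∀ n : ℕ, (n.factorial : ℝ) ≠ 0 := fun n => by positivity
  have hv := Ring.add_choose_eq N (Commute.all (N : ℝ) (X + N))
  have h1 : Ring.choose (X + (N + N : ℕ)) N = risingProd (N + N) X * (risingProd N X)⁻¹ *
      (N.factorial : ℝ)⁻¹ := by
    rw [← ring_choose_mul_risingProd]; field_simp [hp N, hf N]
  have h2 : (N : ℝ) + (X + N) = X + (N + N : ℕ) := by push_cast; ring
  rw [h2, h1] at hv
  have h3 : ∀ p ∈ Finset.HasAntidiagonal.antidiagonal N, Ring.choose (N : ℝ) p.1 * Ring.choose (X + N) p.2 =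
      risingProd N X * ((N.choose p.1 : ℝ) * (p.2.factorial : ℝ)⁻¹ * (risingProd p.1 X)⁻¹) := by
    intro p hpm
    rw [Finset.HasAntidiagonal.mem_antidiagonal] at hpm
    have := ring_choose_mul_risingProd p.1 p.2 X
    rw [hpm] at this
    rw [Ring.choose_natCast, ← this]
    field_simp [hp p.1, hf p.2]
  rw [Finset.sum_congr rfl h3, ← Finset.mul_sum] at hv
  have := hp N
  field_simp at hv ⊢
  linarith

/-- Differentiate `sum_inv_risingProd` at X = 0. A rising product has derivative n! Hₙ there and its
reciprocal has derivative -Hₙ/n!; on the right, the numerator gives H_{2N} and the two reciprocals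
give -2H_N. -/
lemma sum_choose_mul_harmonic (N : ℕ) :
    ∑ p ∈ Finset.HasAntidiagonal.antidiagonal N, (N.choose p.1 : ℝ) ^ 2 * harmonic p.1 =
      (N + N).choose N * (2 * harmonic N - harmonic (2 * N)) := by
  have hd : ∀ n : ℕ, HasDerivAt (fun a => (risingProd n a)⁻¹)
      (-(n.factorial : ℝ)⁻¹ * harmonic n) 0 := fun n => by
    refine (hasDerivAt_inv_risingProd n (by norm_num)).congr_deriv ?_
    rw [risingProd_zero_right, harmonic]; push_cast; simp
  have hd' : ∀ n : ℕ, HasDerivAt (fun a => risingProd n a) ((n.factorial : ℝ) * harmonic n) 0 := by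
    intro n
    have := (hd n).fun_inv (by rw [risingProd_zero_right]; positivity)
    simp only [inv_inv] at this
    refine this.congr_deriv ?_
    rw [risingProd_zero_right]; field_simp
  have hL := HasDerivAt.fun_sum (u := Finset.HasAntidiagonal.antidiagonal N) fun p _ =>
    (hd p.1).const_mul ((N.choose p.1 : ℝ) * (p.2.factorial : ℝ)⁻¹)
  have hR := ((((hd' (N + N)).mul (hd N)).mul (hd N)).mul_const (N.factorial : ℝ)⁻¹)
  have he : (fun X => ∑ p ∈ Finset.HasAntidiagonal.antidiagonal N,
      (N.choose p.1 : ℝ) * (p.2.factorial : ℝ)⁻¹ * (risingProd p.1 X)⁻¹) =ᶠ[𝓝 0]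
      fun X => risingProd (N + N) X * (risingProd N X)⁻¹ * (risingProd N X)⁻¹ *
        (N.factorial : ℝ)⁻¹ := by
    filter_upwards [Ioi_mem_nhds (show (-1 : ℝ) < 0 by norm_num)] with X hX
    exact sum_inv_risingProd N hX
  have hu := hL.unique (hR.congr_of_eventuallyEq he)
  have hf : (N.factorial : ℝ) ≠ 0 := by positivity
  have h1 : ∀ p ∈ Finset.HasAntidiagonal.antidiagonal N, (N.choose p.1 : ℝ) ^ 2 * harmonic p.1 =
      -(N.factorial : ℝ) * ((N.choose p.1 : ℝ) * (p.2.factorial : ℝ)⁻¹ *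
        (-(p.1.factorial : ℝ)⁻¹ * harmonic p.1)) := by
    rintro ⟨i, j⟩ hp
    have hp' : i + j = N := Finset.HasAntidiagonal.mem_antidiagonal.1 hp
    subst hp'
    have : ((i + j).choose i : ℝ) = (i + j).factorial * (j.factorial : ℝ)⁻¹ *
        (i.factorial : ℝ)⁻¹ := by
      rw [Nat.cast_add_choose]; field_simp
    simp only
    rw [sq]
    nth_rewrite 2 [this]
    ring
  rw [Finset.sum_congr rfl h1, ← Finset.mul_sum, hu]
  have h2 : ((N + N).choose N : ℝ) = (N + N).factorial * (N.factorial : ℝ)⁻¹ *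
      (N.factorial : ℝ)⁻¹ := by
    rw [Nat.cast_add_choose]; field_simp
  simp only [risingProd_zero_right, Pi.mul_apply]
  rw [h2, two_mul N]
  field_simp
  ring

/-! ### Moments of sin and of log sin -/

/-- `∫₀^{π/2} sin^{2N}`. -/
noncomputable def sinMoment (N : ℕ) : ℝ := ∫ θ in (0 : ℝ)..Real.pi / 2, Real.sin θ ^ (2 * N)

/-- `∫₀^{π/2} sin^{2N} log sin`. -/
noncomputable def logSinMoment (N : ℕ) : ℝ :=
  ∫ θ in (0 : ℝ)..Real.pi / 2, Real.sin θ ^ (2 * N) * Real.log (Real.sin θ)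

lemma intervalIntegrable_sin_pow_mul_log_sin (n : ℕ) (a b : ℝ) :
    IntervalIntegrable (fun θ => Real.sin θ ^ n * Real.log (Real.sin θ)) volume a b :=
  (intervalIntegrable_log_sin (a := a) (b := b)).continuousOn_mul
    (Real.continuous_sin.pow n).continuousOn

lemma sinMoment_succ (N : ℕ) : sinMoment (N + 1) = (2 * N + 1) / (2 * N + 2) * sinMoment N := by
  have hder : ∀ θ : ℝ, HasDerivAt (fun θ => -Real.cos θ * Real.sin θ ^ (2 * N + 1))
      ((2 * N + 2) * Real.sin θ ^ (2 * (N + 1)) - (2 * N + 1) * Real.sin θ ^ (2 * N)) θ := by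
    intro θ
    refine ((Real.hasDerivAt_cos θ).neg.mul ((Real.hasDerivAt_sin θ).pow (2 * N + 1))).congr_deriv ?_
    have : Real.cos θ * Real.cos θ = 1 - Real.sin θ ^ 2 := by
      nlinarith [Real.sin_sq_add_cos_sq θ]
    simp only [neg_neg, Pi.pow_apply, Pi.neg_apply]
    push_cast
    linear_combination (-(2 * N + 1) * Real.sin θ ^ (2 * N)) * this
  have h := intervalIntegral.integral_eq_sub_of_hasDerivAt (a := 0) (b := Real.pi / 2)
    (fun θ _ => hder θ) (by apply Continuous.intervalIntegrable; fun_prop)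
  rw [intervalIntegral.integral_sub (by apply Continuous.intervalIntegrable; fun_prop)
    (by apply Continuous.intervalIntegrable; fun_prop),
    intervalIntegral.integral_const_mul, intervalIntegral.integral_const_mul] at h
  simp only [Real.cos_pi_div_two, Real.sin_zero] at h
  rw [← sinMoment, ← sinMoment] at h
  field_simp
  simp at h
  linarith

lemma sinMoment_eq (N : ℕ) :
    sinMoment N = Real.pi / 2 * ((N + N).choose N / 4 ^ N) := by
  induction N with
  | zero => simp [sinMoment]
  | succ N ih =>
    rw [sinMoment_succ, ih]
    have := Nat.succ_mul_centralBinom_succ N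
    rw [Nat.centralBinom, Nat.centralBinom, two_mul (N + 1), two_mul N] at this
    have h : ((N : ℝ) + 1) * ((N + 1 + (N + 1)).choose (N + 1) : ℝ) =
      2 * (2 * N + 1) * (N + N).choose N := by rw [two_mul (N : ℝ)]; exact_mod_cast this
    rw [pow_succ]
    field_simp
    linear_combination (-2) * h

/-- Integrate the derivative of -cos θ sin^{2N+1} θ log sin θ, whose boundary values vanish. -/
lemma logSinMoment_succ (N : ℕ) :
    (2 * N + 2) * logSinMoment (N + 1) =
      (2 * N + 1) * logSinMoment N + sinMoment N - sinMoment (N + 1) := by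
  -- One factor sin θ is grouped with log sin θ, because u log u is continuous at 0.
  have hc : Continuous fun θ : ℝ => -Real.cos θ * Real.sin θ ^ (2 * N) *
      (Real.sin θ * Real.log (Real.sin θ)) := by
    have := Real.continuous_mul_log.comp Real.continuous_sin
    exact (by fun_prop : Continuous fun θ : ℝ => -Real.cos θ * Real.sin θ ^ (2 * N)).mul this
  have hder : ∀ θ ∈ Ioo 0 (Real.pi / 2), HasDerivAt (fun θ : ℝ => -Real.cos θ *
      Real.sin θ ^ (2 * N) * (Real.sin θ * Real.log (Real.sin θ)))
      ((2 * N + 2) * (Real.sin θ ^ (2 * (N + 1)) * Real.log (Real.sin θ)) -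
        (2 * N + 1) * (Real.sin θ ^ (2 * N) * Real.log (Real.sin θ)) -
        Real.sin θ ^ (2 * N) + Real.sin θ ^ (2 * (N + 1))) θ := by
    intro θ hθ
    have hs : 0 < Real.sin θ := Real.sin_pos_of_pos_of_lt_pi hθ.1 (by linarith [hθ.2, Real.pi_pos])
    have h1 := (Real.hasDerivAt_cos θ).neg.mul ((Real.hasDerivAt_sin θ).pow (2 * N + 1))
    have h2 := (Real.hasDerivAt_log hs.ne').comp θ (Real.hasDerivAt_sin θ)
    have h3 := h1.mul h2
    have he : (fun θ : ℝ => -Real.cos θ * Real.sin θ ^ (2 * N) *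
        (Real.sin θ * Real.log (Real.sin θ))) =
        -Real.cos * Real.sin ^ (2 * N + 1) * (Real.log ∘ Real.sin) := by
      ext θ; simp; ring
    rw [he]
    refine h3.congr_deriv ?_
    have : Real.cos θ * Real.cos θ = 1 - Real.sin θ ^ 2 := by
      nlinarith [Real.sin_sq_add_cos_sq θ]
    simp only [neg_neg, Pi.pow_apply, Pi.neg_apply, Pi.mul_apply, Function.comp]
    push_cast
    have e : -Real.cos θ * Real.sin θ ^ (2 * N + 1) * ((Real.sin θ)⁻¹ * Real.cos θ) =
      -(Real.cos θ * Real.cos θ) * Real.sin θ ^ (2 * N) := by field_simp; ring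
    rw [e]
    linear_combination (-(2 * N + 1) * Real.sin θ ^ (2 * N) * Real.log (Real.sin θ) -
      Real.sin θ ^ (2 * N)) * this
  have i1 := intervalIntegrable_sin_pow_mul_log_sin (2 * (N + 1)) 0 (Real.pi / 2)
  have i2 := intervalIntegrable_sin_pow_mul_log_sin (2 * N) 0 (Real.pi / 2)
  have i3 : ∀ n : ℕ, IntervalIntegrable (fun θ => Real.sin θ ^ n) volume 0 (Real.pi / 2) :=
    fun n => by apply Continuous.intervalIntegrable; fun_prop
  have h := intervalIntegral.integral_eq_sub_of_hasDerivAt_of_le (by positivity)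
    hc.continuousOn hder
    ((((i1.const_mul _).sub (i2.const_mul _)).sub (i3 _)).add (i3 _))
  rw [intervalIntegral.integral_add (((i1.const_mul _).sub (i2.const_mul _)).sub (i3 _)) (i3 _),
    intervalIntegral.integral_sub ((i1.const_mul _).sub (i2.const_mul _)) (i3 _),
    intervalIntegral.integral_sub (i1.const_mul _) (i2.const_mul _),
    intervalIntegral.integral_const_mul, intervalIntegral.integral_const_mul] at h
  rw [← sinMoment, ← sinMoment, ← logSinMoment, ← logSinMoment] at h
  simp at h
  linarith

lemma logSinMoment_eq (N : ℕ) :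
    logSinMoment N = sinMoment N * (harmonic (2 * N) - harmonic N - Real.log 2) := by
  induction N with
  | zero =>
    simp [logSinMoment, sinMoment, integral_log_sin_zero_pi_div_two]; ring
  | succ N ih =>
    have h := logSinMoment_succ N
    have h1 : logSinMoment (N + 1) = ((2 * N + 1) * logSinMoment N + sinMoment N -
      sinMoment (N + 1)) / (2 * N + 2) := by field_simp; linarith
    rw [h1, ih, sinMoment_succ, show 2 * (N + 1) = 2 * N + 1 + 1 by ring, harmonic_succ,
      harmonic_succ, harmonic_succ]
    push_cast
    field_simp
    ring

/-! ### The integrals of cosh^m t exp(-z cosh t) -/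

/-- The integrals `∫₀^∞ cosh^m t · exp (-z cosh t) dt`. -/
noncomputable def coshInt (m : ℕ) (z : ℝ) : ℝ :=
  ∫ t in Ioi (0 : ℝ), Real.cosh t ^ m * Real.exp (-z * Real.cosh t)

lemma le_cosh (t : ℝ) : t ≤ Real.cosh t := by
  rcases le_total 0 t with h | h
  · exact (Real.self_le_sinh_iff.2 h).trans (Real.sinh_lt_cosh t).le
  · exact h.trans (Real.cosh_pos t).le

/-- Half of the exponential absorbs cosh^m t, by c^m/m! ≤ e^c; the other half is dominated through t
≤ cosh t. -/
lemma integrableOn_coshInt (m : ℕ) {z : ℝ} (hz : 0 < z) :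
    IntegrableOn (fun t => Real.cosh t ^ m * Real.exp (-z * Real.cosh t)) (Ioi 0) := by
  have h := (exp_neg_integrableOn_Ioi 0 (half_pos hz)).const_mul ((m.factorial : ℝ) * (2 / z) ^ m)
  refine Integrable.mono' h (by apply Continuous.aestronglyMeasurable; fun_prop) ?_
  refine Filter.Eventually.of_forall fun t => ?_
  have hc : 0 < Real.cosh t := Real.cosh_pos t
  rw [Real.norm_of_nonneg (by positivity)]
  have h1 := Real.pow_div_factorial_le_exp (x := z / 2 * Real.cosh t) (by positivity) m
  have h2 : Real.cosh t ^ m ≤ m.factorial * (2 / z) ^ m * Real.exp (z / 2 * Real.cosh t) := by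
    rw [div_le_iff₀ (by positivity), mul_pow] at h1
    calc Real.cosh t ^ m = (2 / z) ^ m * ((z / 2) ^ m * Real.cosh t ^ m) := by
          rw [← mul_assoc, ← mul_pow]; field_simp; simp
      _ ≤ (2 / z) ^ m * (Real.exp (z / 2 * Real.cosh t) * m.factorial) := by gcongr
      _ = _ := by ring
  calc Real.cosh t ^ m * Real.exp (-z * Real.cosh t)
      ≤ m.factorial * (2 / z) ^ m * Real.exp (z / 2 * Real.cosh t) * Real.exp (-z * Real.cosh t) := by
        gcongr
    _ = m.factorial * (2 / z) ^ m * Real.exp (-(z / 2) * Real.cosh t) := by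
        rw [mul_assoc, ← Real.exp_add]; ring_nf
    _ ≤ _ := by
        gcongr ?_ * Real.exp ?_
        nlinarith [le_cosh t]

lemma hasDerivAt_coshInt (m : ℕ) {z : ℝ} (hz : 0 < z) :
    HasDerivAt (coshInt m) (-coshInt (m + 1) z) z := by
  have h := (hasDerivAt_integral_of_dominated_loc_of_deriv_le (μ := volume.restrict (Ioi (0 : ℝ)))
    (F := fun z t => Real.cosh t ^ m * Real.exp (-z * Real.cosh t))
    (F' := fun z t => -(Real.cosh t ^ (m + 1) * Real.exp (-z * Real.cosh t)))
    (bound := fun t => Real.cosh t ^ (m + 1) * Real.exp (-(z / 2) * Real.cosh t))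
    (Ioi_mem_nhds (half_lt_self hz)) ?_ (integrableOn_coshInt m hz) ?_ ?_
    (integrableOn_coshInt (m + 1) (half_pos hz)) ?_).2
  · rwa [integral_neg] at h
  · exact Filter.Eventually.of_forall fun z => by
      apply Continuous.aestronglyMeasurable; fun_prop
  · apply Continuous.aestronglyMeasurable; fun_prop
  · refine Filter.Eventually.of_forall fun t w hw => ?_
    have hc : 0 < Real.cosh t := Real.cosh_pos t
    rw [norm_neg, Real.norm_of_nonneg (by positivity)]
    have : z / 2 < w := hw
    gcongr
  · refine Filter.Eventually.of_forall fun t w _ => ?_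
    have h1 := ((((hasDerivAt_id w).neg.mul_const (Real.cosh t)).exp).const_mul (Real.cosh t ^ m))
    refine h1.congr_deriv ?_
    simp; ring

lemma tendsto_sinh_mul_exp {z : ℝ} (hz : 0 < z) :
    Tendsto (fun t => Real.sinh t * Real.exp (-z * Real.cosh t)) atTop (𝓝 0) := by
  have h0 : Tendsto Real.cosh atTop atTop := tendsto_atTop_mono le_cosh tendsto_id
  have h1 : Tendsto (fun u : ℝ => u * Real.exp (-z * u)) atTop (𝓝 0) := by
    simpa using tendsto_rpow_mul_exp_neg_mul_atTop_nhds_zero 1 z hz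
  refine tendsto_of_tendsto_of_tendsto_of_le_of_le' tendsto_const_nhds (h1.comp h0) ?_ ?_
  · filter_upwards [eventually_ge_atTop 0] with t ht
    have := Real.sinh_nonneg_iff.2 ht
    positivity
  · filter_upwards with t
    have := (Real.sinh_lt_cosh t).le
    simp only [Function.comp]
    gcongr

/-- The derivative of sinh t exp(-z cosh t) has integral 0 over the half-line. Since the derivatives
of `coshInt 0` are -`coshInt 1` and `coshInt 2`, this is the modified Bessel equation of order 0. -/
lemma coshInt_recurrence {z : ℝ} (hz : 0 < z) :
    coshInt 1 z = z * (coshInt 2 z - coshInt 0 z) := by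
  have i0 := integrableOn_coshInt 0 hz
  have i1 := integrableOn_coshInt 1 hz
  have i2 := integrableOn_coshInt 2 hz
  have i3 : IntegrableOn (fun t => z * (Real.cosh t ^ 2 * Real.exp (-z * Real.cosh t) -
        Real.cosh t ^ 0 * Real.exp (-z * Real.cosh t))) (Ioi 0) := (i2.sub i0).const_mul z
  have h := integral_Ioi_of_hasDerivAt_of_tendsto' (a := 0)
    (f := fun t => Real.sinh t * Real.exp (-z * Real.cosh t))
    (f' := fun t => Real.cosh t ^ 1 * Real.exp (-z * Real.cosh t) -
      z * (Real.cosh t ^ 2 * Real.exp (-z * Real.cosh t) -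
        Real.cosh t ^ 0 * Real.exp (-z * Real.cosh t))) (fun t _ => ?_)
    (i1.sub i3) (tendsto_sinh_mul_exp hz)
  · rw [integral_sub i1 i3, integral_const_mul, integral_sub i2 i0] at h
    simp only [Real.sinh_zero, zero_mul, sub_self] at h
    unfold coshInt
    linarith
  · refine ((Real.hasDerivAt_sinh t).mul
      (((Real.hasDerivAt_cosh t).const_mul (-z)).exp)).congr_deriv ?_
    have := Real.cosh_sq t
    linear_combination (z * Real.exp (-z * Real.cosh t)) * this

/-- With sinh t in place of cosh t the integral would be exactly e^{-z}/z, and cosh t - sinh t =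
e^{-t}. It yields z `coshInt 1 z` → 1 as z → 0. -/
lemma abs_mul_coshInt_one_sub_le {z : ℝ} (hz : 0 < z) :
    |z * coshInt 1 z - Real.exp (-z)| ≤ z := by
  have i1 := (integrableOn_coshInt 1 hz).const_mul z
  have i2 : IntegrableOn (fun t => z * (Real.sinh t * Real.exp (-z * Real.cosh t))) (Ioi 0) := by
    refine Integrable.mono' i1 (by apply Continuous.aestronglyMeasurable; fun_prop) ?_
    refine Filter.Eventually.of_forall fun t => ?_
    rw [norm_mul, norm_mul, Real.norm_of_nonneg hz.le, Real.norm_of_nonneg (Real.exp_pos _).le,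
      Real.norm_eq_abs, pow_one]
    gcongr
    rw [Real.abs_sinh, ← Real.cosh_abs]
    exact (Real.sinh_lt_cosh _).le
  have h0 : Tendsto Real.cosh atTop atTop := tendsto_atTop_mono le_cosh tendsto_id
  have h := integral_Ioi_of_hasDerivAt_of_tendsto' (a := 0) (m := 0)
    (f := fun t => -Real.exp (-z * Real.cosh t))
    (f' := fun t => z * (Real.sinh t * Real.exp (-z * Real.cosh t))) (fun t _ => ?_) i2 ?_
  · have e : z * coshInt 1 z - Real.exp (-z) =
        ∫ t in Ioi (0 : ℝ), z * ((Real.cosh t - Real.sinh t) * Real.exp (-z * Real.cosh t)) := by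
      have h2 : Real.exp (-z) = ∫ t in Ioi (0 : ℝ), z * (Real.sinh t * Real.exp (-z * Real.cosh t)) := by
        rw [h]; simp
      rw [h2, coshInt, ← integral_const_mul, ← integral_sub i1 i2]
      congr 1; ext t; ring
    have i3 : IntegrableOn (fun t => z * Real.exp (-1 * t)) (Ioi 0) :=
      (exp_neg_integrableOn_Ioi 0 one_pos).const_mul z
    have h3 : ∫ t in Ioi (0 : ℝ), z * Real.exp (-1 * t) = z := by
      rw [integral_const_mul]; simp only [neg_one_mul, integral_exp_neg_Ioi_zero, mul_one]
    rw [e, ← Real.norm_eq_abs]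
    refine (norm_integral_le_of_norm_le i3 ?_).trans h3.le
    refine Filter.Eventually.of_forall fun t => ?_
    rw [Real.cosh_sub_sinh, Real.norm_of_nonneg (by positivity), neg_one_mul]
    have : Real.exp (-z * Real.cosh t) ≤ 1 := Real.exp_le_one_iff.2 (by
      have := mul_pos hz (Real.cosh_pos t); linarith)
    have h4 := Real.exp_pos (-t)
    nlinarith [mul_le_mul_of_nonneg_left this (mul_pos hz h4).le]
  · refine ((((Real.hasDerivAt_cosh t).const_mul (-z)).exp).neg).congr_deriv ?_
    ring
  · rw [← neg_zero]
    refine (Real.tendsto_exp_atBot.comp ?_).neg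
    exact h0.const_mul_atTop_of_neg (by linarith)

/-! ### Logarithmic behaviour at the origin -/

lemma integral_log_mul_exp :
    ∫ u in Ioi (0 : ℝ), Real.log u * Real.exp (-u) = -Real.eulerMascheroniConstant := by
  have h1 : HasDerivAt Complex.GammaIntegral _ 1 := Complex.hasDerivAt_GammaIntegral (by simp)
  have h2 : HasDerivAt Complex.GammaIntegral (-Real.eulerMascheroniConstant : ℂ) 1 := by
    refine Complex.hasDerivAt_Gamma_one.congr_of_eventuallyEq ?_
    have : IsOpen {s : ℂ | 0 < s.re} := Complex.continuous_re.isOpen_preimage _ isOpen_Ioi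
    filter_upwards [this.mem_nhds (show (0 : ℝ) < (1 : ℂ).re by simp)] with a ha
    exact (Complex.Gamma_eq_integral ha).symm
  have h3 := h1.unique h2
  simp only [sub_self, Complex.cpow_zero, one_mul] at h3
  have h4 : ((∫ u in Ioi (0 : ℝ), Real.log u * Real.exp (-u) : ℝ) : ℂ) =
      ((-Real.eulerMascheroniConstant : ℝ) : ℂ) := by
    rw [← integral_complex_ofReal]
    push_cast
    exact_mod_cast h3
  exact_mod_cast h4

/-- The Bochner integral of a non-integrable function is 0, whereas this one has the value -γ ≠ 0.
-/
lemma integrableOn_log_mul_exp : IntegrableOn (fun u => Real.log u * Real.exp (-u)) (Ioi 0) := by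
  by_contra h
  have h1 := integral_log_mul_exp
  rw [integral_undef h] at h1
  linarith [Real.one_half_lt_eulerMascheroniConstant]

lemma integrableOn_exp_neg_mul_exp {w : ℝ} (hw : 0 < w) :
    IntegrableOn (fun t => Real.exp (-(w * Real.exp t))) (Ioi 0) := by
  refine Integrable.mono' (exp_neg_integrableOn_Ioi 0 hw)
    (by apply Continuous.aestronglyMeasurable; fun_prop) (Filter.Eventually.of_forall fun t => ?_)
  rw [Real.norm_of_nonneg (Real.exp_pos _).le, Real.exp_le_exp]
  nlinarith [Real.add_one_le_exp t]

/-- The exponential integral in the variable `t = log (u / w)`. -/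
lemma integral_exp_neg_mul_exp {w : ℝ} (hw : 0 < w) :
    ∫ t in Ioi (0 : ℝ), Real.exp (-(w * Real.exp t)) =
      -(Real.log w * Real.exp (-w)) + ∫ u in Ioi w, Real.log u * Real.exp (-u) := by
  have hsub : IntegrableOn (fun u => Real.log u * Real.exp (-u)) (Ioi w) :=
    integrableOn_log_mul_exp.mono_set (Ioi_subset_Ioi hw.le)
  have hd : ∀ t : ℝ, HasDerivAt (fun t => w * Real.exp t) (w * Real.exp t) t := fun t =>
    (Real.hasDerivAt_exp t).const_mul w
  have hlog : ∀ t : ℝ, Real.log (w * Real.exp t) = Real.log w + t := fun t => by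
    rw [Real.log_mul hw.ne' (Real.exp_pos t).ne', Real.log_exp]
  have him : (fun t => w * Real.exp t) '' Ioi 0 = Ioi w := by
    ext u
    constructor
    · rintro ⟨t, ht, rfl⟩
      have : 1 < Real.exp t := Real.one_lt_exp_iff.2 ht
      simp only [mem_Ioi]; nlinarith
    · intro hu
      have hu : w < u := hu
      refine ⟨Real.log (u / w), Real.log_pos ((one_lt_div hw).2 hu), ?_⟩
      simp only
      rw [Real.exp_log (div_pos (hw.trans hu) hw)]; field_simp
  have hinj : InjOn (fun t => w * Real.exp t) (Ioi 0) := fun a _ b _ h =>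
    Real.exp_injective (mul_left_cancel₀ hw.ne' h)
  have hcv := integral_image_eq_integral_abs_deriv_smul measurableSet_Ioi
    (fun t _ => (hd t).hasDerivWithinAt) hinj (fun u => Real.log u * Real.exp (-u))
  have hci := (integrableOn_image_iff_integrableOn_abs_deriv_smul measurableSet_Ioi
    (fun t _ => (hd t).hasDerivWithinAt) hinj (fun u => Real.log u * Real.exp (-u))).1
    (by rwa [him])
  rw [him] at hcv
  have habs : ∀ t, |w * Real.exp t| • (Real.log (w * Real.exp t) * Real.exp (-(w * Real.exp t))) =
      w * Real.exp t * ((Real.log w + t) * Real.exp (-(w * Real.exp t))) := fun t => by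
    rw [abs_of_pos (by positivity), hlog, smul_eq_mul]
  simp only [habs] at hcv hci
  have i1 := integrableOn_exp_neg_mul_exp hw
  -- Integration by parts: the primitive is log u · e^{-u} at u = w e^t, and the second part of its
  -- derivative is the integrand produced by the change of variable.
  have h := integral_Ioi_of_hasDerivAt_of_tendsto' (a := 0) (m := 0)
    (f := fun t => (Real.log w + t) * Real.exp (-(w * Real.exp t)))
    (f' := fun t => Real.exp (-(w * Real.exp t)) -
      w * Real.exp t * ((Real.log w + t) * Real.exp (-(w * Real.exp t)))) (fun t _ => ?_)
    (i1.sub hci) ?_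
  · rw [integral_sub i1 hci, ← hcv] at h
    simp only [Real.exp_zero, mul_one, add_zero] at h
    linarith
  · refine (((hasDerivAt_id t).const_add (Real.log w)).mul ((hd t).neg.exp)).congr_deriv ?_
    simp; ring
  · have h1 : Tendsto (fun u : ℝ => u * Real.exp (-u)) atTop (𝓝 0) := by
      simpa using Real.tendsto_pow_mul_exp_neg_atTop_nhds_zero 1
    have h2 : Tendsto (fun t : ℝ => w * Real.exp t) atTop atTop :=
      Real.tendsto_exp_atTop.const_mul_atTop hw
    have h3 : Tendsto (fun u : ℝ => Real.log u * Real.exp (-u)) atTop (𝓝 0) := by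
      refine tendsto_of_tendsto_of_tendsto_of_le_of_le' tendsto_const_nhds h1 ?_ ?_
      · filter_upwards [eventually_ge_atTop 1] with u hu
        exact mul_nonneg (Real.log_nonneg hu) (Real.exp_pos _).le
      · filter_upwards [eventually_ge_atTop 0] with u hu
        exact mul_le_mul_of_nonneg_right (Real.log_le_self hu) (Real.exp_pos _).le
    refine (h3.comp h2).congr fun t => ?_
    simp only [Function.comp, hlog]

/-- Replacing cosh t by e^t/2 in the exponent costs at most (z/2)e^{-t} pointwise, hence z/2 in
total. What remains is the exponential integral at w = z/2, equal to -log w · e^{-w} plus a tail of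
∫ log u e^{-u} du = -γ. -/
lemma tendsto_coshInt_zero_add_log :
    Tendsto (fun z => coshInt 0 z + Real.log (z / 2)) (𝓝[>] 0)
      (𝓝 (-Real.eulerMascheroniConstant)) := by
  have key : ∀ z > 0, |coshInt 0 z - ∫ t in Ioi (0 : ℝ), Real.exp (-(z / 2 * Real.exp t))| ≤
      z / 2 := by
    intro z hz
    have i1 := integrableOn_coshInt 0 hz
    have i2 := integrableOn_exp_neg_mul_exp (half_pos hz)
    have i3 : IntegrableOn (fun t => z / 2 * Real.exp (-t)) (Ioi 0) := by
      simpa [IntegrableOn] using (exp_neg_integrableOn_Ioi 0 one_pos).const_mul (z / 2)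
    have h3 : ∫ t in Ioi (0 : ℝ), z / 2 * Real.exp (-t) = z / 2 := by
      rw [integral_const_mul, integral_exp_neg_Ioi_zero, mul_one]
    rw [coshInt, ← integral_sub i1 i2, ← Real.norm_eq_abs]
    refine (norm_integral_le_of_norm_le i3 ?_).trans h3.le
    refine Filter.Eventually.of_forall fun t => ?_
    have e : Real.exp (-z * Real.cosh t) =
        Real.exp (-(z / 2 * Real.exp t)) * Real.exp (-(z / 2 * Real.exp (-t))) := by
      rw [← Real.exp_add, Real.cosh_eq]; ring_nf
    have p1 := Real.exp_pos (-(z / 2 * Real.exp t))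
    have p2 : Real.exp (-(z / 2 * Real.exp t)) ≤ 1 := Real.exp_le_one_iff.2 (by
      have := Real.exp_pos t
      have := mul_pos hz this
      linarith)
    have p3 : Real.exp (-(z / 2 * Real.exp (-t))) ≤ 1 := Real.exp_le_one_iff.2 (by
      have := Real.exp_pos (-t)
      have := mul_pos hz this
      linarith)
    have p4 := Real.add_one_le_exp (-(z / 2 * Real.exp (-t)))
    rw [pow_zero, one_mul, e, Real.norm_eq_abs, abs_le]
    constructor <;> nlinarith
  have lim1 : Tendsto (fun z : ℝ => coshInt 0 z -
      ∫ t in Ioi (0 : ℝ), Real.exp (-(z / 2 * Real.exp t))) (𝓝[>] 0) (𝓝 0) := by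
    rw [tendsto_zero_iff_abs_tendsto_zero]
    have : Tendsto (fun z : ℝ => z / 2) (𝓝[>] 0) (𝓝 0) :=
      ((continuous_id.div_const 2).tendsto' 0 0 (by simp)).mono_left nhdsWithin_le_nhds
    refine tendsto_of_tendsto_of_tendsto_of_le_of_le' tendsto_const_nhds this ?_ ?_
    · exact Filter.Eventually.of_forall fun z => abs_nonneg _
    · filter_upwards [self_mem_nhdsWithin] with z hz using key z hz
  have hhalf : Tendsto (fun z : ℝ => z / 2) (𝓝[>] 0) (𝓝[>] 0) := by
    refine tendsto_nhdsWithin_iff.2 ⟨((continuous_id.div_const 2).tendsto' 0 0 (by simp)).mono_left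
      nhdsWithin_le_nhds, ?_⟩
    filter_upwards [self_mem_nhdsWithin] with z hz
    exact half_pos (show (0 : ℝ) < z from hz)
  have lim2 : Tendsto (fun w : ℝ => ∫ u in Ioi w, Real.log u * Real.exp (-u)) (𝓝[>] 0)
      (𝓝 (-Real.eulerMascheroniConstant)) := by
    have hint := integrableOn_log_mul_exp
    have hc : ContinuousWithinAt (fun w => ∫ u in (0 : ℝ)..w, Real.log u * Real.exp (-u))
        (Icc 0 1) 0 := by
      rw [← uIcc_of_le (zero_le_one' ℝ)]
      refine intervalIntegral.continuousOn_primitive_interval ?_ 0 (by simp)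
      rw [uIcc_of_le (zero_le_one' ℝ), integrableOn_Icc_iff_integrableOn_Ioc]
      exact hint.mono_set Ioc_subset_Ioi_self
    have hc' : Tendsto (fun w => ∫ u in (0 : ℝ)..w, Real.log u * Real.exp (-u)) (𝓝[>] 0) (𝓝 0) := by
      have := hc.tendsto
      rw [intervalIntegral.integral_same] at this
      refine this.mono_left ?_
      rw [← nhdsWithin_Ioc_eq_nhdsGT (show (0 : ℝ) < 1 by norm_num)]
      exact nhdsWithin_mono _ Ioc_subset_Icc_self
    have := (tendsto_const_nhds (x := -Real.eulerMascheroniConstant)).sub hc'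
    rw [sub_zero] at this
    refine this.congr' ?_
    filter_upwards [self_mem_nhdsWithin] with w hw
    rw [← intervalIntegral.integral_Ioi_sub_Ioi hint (le_of_lt hw), integral_log_mul_exp]
    ring
  have lim3 : Tendsto (fun w : ℝ => Real.log w * (1 - Real.exp (-w))) (𝓝[>] 0) (𝓝 0) := by
    rw [tendsto_zero_iff_abs_tendsto_zero]
    have h1 : Tendsto (fun w : ℝ => |w * Real.log w|) (𝓝[>] 0) (𝓝 0) :=
      ((Real.continuous_mul_log.abs).tendsto' 0 0 (by simp)).mono_left nhdsWithin_le_nhds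
    refine tendsto_of_tendsto_of_tendsto_of_le_of_le' tendsto_const_nhds h1 ?_ ?_
    · exact Filter.Eventually.of_forall fun z => abs_nonneg _
    · filter_upwards [self_mem_nhdsWithin] with w hw
      have hw : 0 < w := hw
      have h2 := Real.add_one_le_exp (-w)
      have h3 : Real.exp (-w) ≤ 1 := Real.exp_le_one_iff.2 (by linarith)
      simp only [Function.comp]
      rw [abs_mul, abs_mul, mul_comm]
      refine mul_le_mul_of_nonneg_right ?_ (abs_nonneg _)
      rw [abs_of_nonneg (by linarith), abs_of_pos hw]; linarith
  have := (lim1.add (lim2.comp hhalf)).add (lim3.comp hhalf)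
  rw [zero_add, add_zero] at this
  refine this.congr' ?_
  filter_upwards [self_mem_nhdsWithin] with z hz
  simp only [Function.comp]
  rw [integral_exp_neg_mul_exp (half_pos hz)]
  ring

/-! ### The power series in y = x² and the Bessel equation -/

/-- The bound 2/n! is loose enough to serve every series below, the largest coefficient being n
Hₙ/n!², since n Hₙ ≤ n² ≤ 2 n!. -/
lemma hasDerivAt_tsum_pow {c : ℕ → ℝ} (hc : ∀ n, |c n| ≤ 2 / n.factorial) (y : ℝ) :
    HasDerivAt (fun y => ∑' n, c n * y ^ n) (∑' n, c n * (n * y ^ (n - 1))) y := by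
  set r := |y| + 1 with hr
  have hu : Summable fun n : ℕ => 2 / (n.factorial : ℝ) * (n * r ^ (n - 1)) := by
    rw [← summable_nat_add_iff 1]
    refine ((Real.summable_pow_div_factorial r).mul_left 2).congr fun n => ?_
    rw [Nat.factorial_succ]
    push_cast
    field_simp
  have h0 : Summable fun n : ℕ => c n * y ^ n := by
    refine Summable.of_norm_bounded ((Real.summable_pow_div_factorial |y|).mul_left 2) fun n => ?_
    rw [norm_mul, norm_pow, Real.norm_eq_abs, Real.norm_eq_abs]
    calc |c n| * |y| ^ n ≤ 2 / n.factorial * |y| ^ n := by gcongr; exact hc n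
      _ = _ := by ring
  refine hasDerivAt_tsum_of_isPreconnected hu (Metric.isOpen_ball (x := (0 : ℝ)) (ε := r))
    (convex_ball _ _).isPreconnected
    (fun n z _ => (hasDerivAt_pow n z).const_mul (c n)) (fun n z hz => ?_) (y₀ := y) ?_ h0 ?_
  · rw [norm_mul, norm_mul, norm_pow, Real.norm_eq_abs, Real.norm_natCast, Real.norm_eq_abs]
    have : |z| ≤ r := by simpa using (mem_ball_zero_iff.1 hz).le
    gcongr
    exact hc n
  all_goals simp [hr]

/-- The series `∑ n yⁿ / n!²`. -/
noncomputable def besselSeriesEuler (y : ℝ) : ℝ := ∑' n : ℕ, n / (n.factorial : ℝ) ^ 2 * y ^ n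

/-- The series `∑ n Hₙ yⁿ / n!²`. -/
noncomputable def harmonicSeriesEuler (y : ℝ) : ℝ :=
  ∑' n : ℕ, n * harmonic n / (n.factorial : ℝ) ^ 2 * y ^ n

lemma sq_le_two_mul_factorial (n : ℕ) : (n : ℝ) * n ≤ 2 * n.factorial := by
  have h : n * n ≤ 2 * n.factorial := by
    induction n with
    | zero => simp
    | succ n ih =>
      rw [Nat.factorial_succ]
      rcases Nat.lt_or_ge n 2 with h | h
      · interval_cases n <;> decide
      · have := Nat.self_le_factorial n
        have h3 : 3 ≤ 2 * n.factorial := by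
          have := Nat.factorial_le h
          simp at this
          omega
        nlinarith
  exact_mod_cast h

lemma abs_div_factorial_sq_le {a : ℝ} {n : ℕ} (ha : 0 ≤ a) (h : a ≤ 2 * n.factorial) :
    |a / (n.factorial : ℝ) ^ 2| ≤ 2 / n.factorial := by
  have h1 : (0 : ℝ) < n.factorial := by positivity
  rw [abs_of_nonneg (by positivity), div_le_div_iff₀ (by positivity) h1]
  nlinarith

lemma one_le_two_mul_factorial (n : ℕ) : (1 : ℝ) ≤ 2 * n.factorial := by
  have : (1 : ℝ) ≤ n.factorial := by exact_mod_cast n.factorial_pos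
  linarith

lemma nat_le_two_mul_factorial (n : ℕ) : (n : ℝ) ≤ 2 * n.factorial := by
  have : (n : ℝ) ≤ n.factorial := by exact_mod_cast Nat.self_le_factorial n
  have : (0 : ℝ) ≤ n := n.cast_nonneg
  linarith

lemma tsum_mul_natCast_mul_pow (c : ℕ → ℝ) {y : ℝ} (hy : y ≠ 0) :
    ∑' n, c n * (n * y ^ (n - 1)) = (∑' n : ℕ, n * c n * y ^ n) / y := by
  rw [← tsum_div_const]
  refine tsum_congr fun n => ?_
  rcases n with _ | n
  · simp
  · rw [Nat.add_sub_cancel, pow_succ]; field_simp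

lemma hasDerivAt_besselSeries {y : ℝ} (hy : y ≠ 0) :
    HasDerivAt besselSeries (besselSeriesEuler y / y) y := by
  have h := hasDerivAt_tsum_pow (c := fun n => 1 / (n.factorial : ℝ) ^ 2)
    (fun n => abs_div_factorial_sq_le zero_le_one (one_le_two_mul_factorial n)) y
  rw [tsum_mul_natCast_mul_pow _ hy] at h
  convert! h using 1
  · ext z; exact tsum_congr fun n => by ring
  · congr 1; exact tsum_congr fun n => by ring

lemma continuous_besselSeries : Continuous besselSeries := by
  have h := fun y => (hasDerivAt_tsum_pow (c := fun n => 1 / (n.factorial : ℝ) ^ 2)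
    (fun n => abs_div_factorial_sq_le zero_le_one (one_le_two_mul_factorial n)) y).continuousAt
  rw [← continuous_iff_continuousAt] at h
  convert! h using 1
  ext z; exact tsum_congr fun n => by ring

lemma besselSeries_zero : besselSeries 0 = 1 := by
  rw [besselSeries, tsum_eq_single 0 (fun n hn => by simp [hn])]; simp

lemma harmonicSeries_eq (y : ℝ) :
    harmonicSeries y = ∑' n : ℕ, harmonic n / (n.factorial : ℝ) ^ 2 * y ^ n :=
  tsum_congr fun n => by ring

lemma harmonicSeries_zero : harmonicSeries 0 = 0 := by
  rw [harmonicSeries, tsum_eq_single 0 (fun n hn => by simp [hn])]; simp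

lemma besselSeriesEuler_zero : besselSeriesEuler 0 = 0 := by
  rw [besselSeriesEuler, tsum_eq_single 0 (fun n hn => by simp [hn])]; simp

lemma harmonicSeriesEuler_zero : harmonicSeriesEuler 0 = 0 := by
  rw [harmonicSeriesEuler, tsum_eq_single 0 (fun n hn => by simp [hn])]; simp

lemma hasDerivAt_harmonicSeries {y : ℝ} (hy : y ≠ 0) :
    HasDerivAt harmonicSeries (harmonicSeriesEuler y / y) y := by
  have h := hasDerivAt_tsum_pow (c := fun n => harmonic n / (n.factorial : ℝ) ^ 2)
    (fun n => abs_div_factorial_sq_le (harmonic_nonneg n)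
      ((harmonic_le n).trans (nat_le_two_mul_factorial n))) y
  rw [tsum_mul_natCast_mul_pow _ hy] at h
  convert! h using 1
  · ext z; exact harmonicSeries_eq z
  · congr 1; exact tsum_congr fun n => by ring

lemma continuous_harmonicSeries : Continuous harmonicSeries := by
  have h := fun y => (hasDerivAt_tsum_pow (c := fun n => harmonic n / (n.factorial : ℝ) ^ 2)
    (fun n => abs_div_factorial_sq_le (harmonic_nonneg n)
      ((harmonic_le n).trans (nat_le_two_mul_factorial n))) y).continuousAt
  rw [← continuous_iff_continuousAt] at h
  convert! h using 1
  ext z; exact harmonicSeries_eq z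

lemma hasDerivAt_besselSeriesEuler (y : ℝ) :
    HasDerivAt besselSeriesEuler (besselSeries y) y := by
  have h := hasDerivAt_tsum_pow (c := fun n => n / (n.factorial : ℝ) ^ 2)
    (fun n => abs_div_factorial_sq_le n.cast_nonneg (nat_le_two_mul_factorial n)) y
  refine h.congr_deriv ?_
  have hs : Summable fun n : ℕ => (n : ℝ) / (n.factorial : ℝ) ^ 2 * (n * y ^ (n - 1)) := by
    rw [← summable_nat_add_iff 1]
    refine (summable_pow_div_factorial_sq y).congr fun n => ?_
    rw [Nat.factorial_succ]; push_cast; field_simp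
  rw [hs.tsum_eq_zero_add, besselSeries]
  simp only [Nat.cast_zero, zero_mul, mul_zero, zero_add]
  refine tsum_congr fun n => ?_
  rw [Nat.factorial_succ]; push_cast; field_simp

/-- The splitting H_{n+1} = Hₙ + 1/(n + 1) creates the inhomogeneous term, which later cancels
against the derivative of the logarithm multiplying the Bessel series. -/
lemma hasDerivAt_harmonicSeriesEuler {y : ℝ} (hy : y ≠ 0) :
    HasDerivAt harmonicSeriesEuler (harmonicSeries y + besselSeriesEuler y / y) y := by
  have hb : ∀ n : ℕ, |n * (harmonic n : ℝ) / (n.factorial : ℝ) ^ 2| ≤ 2 / n.factorial := fun n =>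
    abs_div_factorial_sq_le (mul_nonneg n.cast_nonneg (harmonic_nonneg n))
      ((mul_le_mul_of_nonneg_left (harmonic_le n) n.cast_nonneg).trans (sq_le_two_mul_factorial n))
  have h := hasDerivAt_tsum_pow hb y
  refine h.congr_deriv ?_
  have s2 : Summable fun n : ℕ => 1 / ((n : ℝ) + 1) * (y ^ n / (n.factorial : ℝ) ^ 2) := by
    refine Summable.of_norm_bounded (summable_pow_div_factorial_sq y).norm fun n => ?_
    rw [norm_mul]
    have : ‖1 / ((n : ℝ) + 1)‖ ≤ 1 := by
      rw [Real.norm_of_nonneg (by positivity), div_le_one (by positivity)]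
      linarith [(n.cast_nonneg : (0 : ℝ) ≤ n)]
    exact mul_le_of_le_one_left (norm_nonneg _) this
  have e : ∀ n : ℕ, ((n + 1 : ℕ) : ℝ) * (harmonic (n + 1) : ℝ) / ((n + 1).factorial : ℝ) ^ 2 *
      ((n + 1 : ℕ) * y ^ (n + 1 - 1)) = (harmonic n : ℝ) * (y ^ n / (n.factorial : ℝ) ^ 2) +
        1 / ((n : ℝ) + 1) * (y ^ n / (n.factorial : ℝ) ^ 2) := fun n => by
    rw [Nat.factorial_succ, harmonic_succ]; push_cast; field_simp
  have hs : Summable fun n : ℕ => n * (harmonic n : ℝ) / (n.factorial : ℝ) ^ 2 *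
      (n * y ^ (n - 1)) := by
    rw [← summable_nat_add_iff 1]
    exact ((summable_harmonic y).add s2).congr fun n => (e n).symm
  have s3 : Summable fun n : ℕ => (n : ℝ) / (n.factorial : ℝ) ^ 2 * y ^ n :=
    (summable_pow_div_factorial_sq_mul y).congr fun n => by ring
  rw [hs.tsum_eq_zero_add, tsum_congr e, (summable_harmonic y).tsum_add s2, harmonicSeries,
    besselSeriesEuler, s3.tsum_eq_zero_add]
  simp only [Nat.cast_zero, zero_mul, mul_zero, zero_add, zero_div]
  congr 1
  rw [← tsum_div_const]
  refine tsum_congr fun n => ?_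
  rw [Nat.factorial_succ]; push_cast; field_simp; ring

lemma continuous_harmonicSeriesEuler : Continuous harmonicSeriesEuler := by
  rw [continuous_iff_continuousAt]
  exact fun y => (hasDerivAt_tsum_pow (fun n =>
    abs_div_factorial_sq_le (mul_nonneg n.cast_nonneg (harmonic_nonneg n))
      ((mul_le_mul_of_nonneg_left (harmonic_le n) n.cast_nonneg).trans
        (sq_le_two_mul_factorial n))) y).continuousAt

lemma besselSeries_pos {y : ℝ} (hy : 0 ≤ y) : 0 < besselSeries y :=
  (summable_pow_div_factorial_sq y).tsum_pos (fun n => by positivity) 0 (by simp)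

/-- A solution of `y (y D')' = y D` with `D` and `y D'` vanishing at `0` is zero. -/
lemma eq_zero_of_bessel_ode {D E : ℝ → ℝ} (hD : ∀ y > 0, HasDerivAt D (E y / y) y)
    (hE : ∀ y > 0, HasDerivAt E (D y) y) (lD : Tendsto D (𝓝[>] 0) (𝓝 0))
    (lE : Tendsto E (𝓝[>] 0) (𝓝 0)) {y : ℝ} (hy : 0 < y) : D y = 0 := by
  have const : ∀ (f f' : ℝ → ℝ), (∀ y > 0, HasDerivAt f (f' y) y) → (∀ y > 0, f' y = 0) →
      Tendsto f (𝓝[>] 0) (𝓝 0) → ∀ y > 0, f y = 0 := by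
    intro f f' hf hf' hl y hy
    have hc : ∀ x ∈ Ioi (0 : ℝ), f x = f y := fun x hx =>
      (convex_Ioi (0 : ℝ)).is_const_of_fderivWithin_eq_zero (𝕜 := ℝ)
        (fun z hz => (hf z hz).differentiableAt.differentiableWithinAt)
        (fun z hz => by
          rw [fderivWithin_of_isOpen isOpen_Ioi hz]
          have := (hf z hz).hasFDerivAt.fderiv
          rw [this, hf' z hz]; ext; simp) hx hy
    have : Tendsto f (𝓝[>] 0) (𝓝 (f y)) := tendsto_const_nhds.congr' (by
      filter_upwards [self_mem_nhdsWithin] with x hx using (hc x hx).symm)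
    exact tendsto_nhds_unique this hl
  have lI : Tendsto besselSeries (𝓝[>] 0) (𝓝 1) :=
    (continuous_besselSeries.tendsto' 0 1 besselSeries_zero).mono_left nhdsWithin_le_nhds
  have lI1 : Tendsto besselSeriesEuler (𝓝[>] 0) (𝓝 0) := by
    have := (hasDerivAt_besselSeriesEuler 0).continuousAt.tendsto
    rw [besselSeriesEuler_zero] at this
    exact this.mono_left nhdsWithin_le_nhds
  -- The Wronskian of D with the regular solution is constant, and it tends to 0 at the origin.
  have W : ∀ y > 0, besselSeries y * E y - D y * besselSeriesEuler y = 0 := by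
    refine const _ (fun _ => 0) (fun y hy => ?_) (fun _ _ => rfl) ?_
    · refine (((hasDerivAt_besselSeries hy.ne').mul (hE y hy)).sub
        ((hD y hy).mul (hasDerivAt_besselSeriesEuler y))).congr_deriv ?_
      field_simp
      ring
    · simpa using (lI.mul lE).sub (lD.mul lI1)
  -- With the Wronskian zero, D is a constant multiple of the regular solution; its limit at 0 makes
  -- that constant 0.
  have Q : ∀ y > 0, D y / besselSeries y = 0 := by
    refine const _ (fun _ => 0) (fun y hy => ?_) (fun _ _ => rfl) ?_
    · refine ((hD y hy).div (hasDerivAt_besselSeries hy.ne')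
        (besselSeries_pos hy.le).ne').congr_deriv ?_
      have := W y hy
      have h2 := (besselSeries_pos hy.le).ne'
      field_simp
      linarith
    · have := lD.div lI one_ne_zero
      rw [zero_div] at this
      exact this
  have := Q y hy
  rw [div_eq_zero_iff] at this
  exact this.resolve_right (besselSeries_pos hy.le).ne'

/-- In the variable y = x² both sides solve y(yf')' = yf. Their difference and its Euler derivative
tend to 0 at the origin, the logarithmic singularities and the constants γ cancelling, so
`eq_zero_of_bessel_ode` applies. -/
lemma besselK0_eq_coshInt {x : ℝ} (hx : 0 < x) : besselK0 x = coshInt 0 (2 * x) := by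
  set g := Real.eulerMascheroniConstant
  have hsq : ∀ y > (0 : ℝ), HasDerivAt (fun y => 2 * √y) (1 / √y) y := fun y hy => by
    refine ((Real.hasDerivAt_sqrt hy.ne').const_mul 2).congr_deriv ?_
    field_simp
  have hlog : ∀ y > (0 : ℝ), HasDerivAt (fun y => -g - Real.log y / 2) (-(1 / (2 * y))) y :=
    fun y hy => by
      refine (((Real.hasDerivAt_log hy.ne').div_const 2).const_sub (-g)).congr_deriv ?_
      field_simp
  have hs0 : Tendsto (fun y : ℝ => 2 * √y) (𝓝[>] 0) (𝓝[>] 0) := by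
    refine tendsto_nhdsWithin_iff.2 ⟨((by fun_prop : Continuous fun y : ℝ => 2 * √y).tendsto' 0 0
      (by simp)).mono_left nhdsWithin_le_nhds, ?_⟩
    filter_upwards [self_mem_nhdsWithin] with z hz
    exact mul_pos two_pos (Real.sqrt_pos.2 hz)
  have lI : Tendsto besselSeries (𝓝[>] 0) (𝓝 1) :=
    (continuous_besselSeries.tendsto' 0 1 besselSeries_zero).mono_left nhdsWithin_le_nhds
  have lQ : Tendsto harmonicSeries (𝓝[>] 0) (𝓝 0) :=
    (continuous_harmonicSeries.tendsto' 0 0 harmonicSeries_zero).mono_left nhdsWithin_le_nhds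
  have lQ1 : Tendsto harmonicSeriesEuler (𝓝[>] 0) (𝓝 0) :=
    (continuous_harmonicSeriesEuler.tendsto' 0 0 harmonicSeriesEuler_zero).mono_left
      nhdsWithin_le_nhds
  have lI1 : Tendsto besselSeriesEuler (𝓝[>] 0) (𝓝 0) := by
    have := (hasDerivAt_besselSeriesEuler 0).continuousAt.tendsto
    rw [besselSeriesEuler_zero] at this
    exact this.mono_left nhdsWithin_le_nhds
  have lylog : Tendsto (fun y : ℝ => y * Real.log y) (𝓝[>] 0) (𝓝 0) :=
    (Real.continuous_mul_log.tendsto' 0 0 (by simp)).mono_left nhdsWithin_le_nhds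
  -- Written as (f(y)/y) · (y log y): a bounded slope times a quantity tending to 0.
  have slope : ∀ f : ℝ → ℝ, ∀ c : ℝ, f 0 = 0 → HasDerivAt f c 0 →
      Tendsto (fun y => f y * Real.log y) (𝓝[>] 0) (𝓝 0) := by
    intro f c h0 hf
    have h1 := (hf.tendsto_slope_zero_right).mul lylog
    rw [mul_zero] at h1
    refine h1.congr' ?_
    filter_upwards [self_mem_nhdsWithin] with y hy
    have hy : y ≠ 0 := (show (0 : ℝ) < y from hy).ne'
    simp [h0]; field_simp
  have lI1log := slope _ _ besselSeriesEuler_zero (hasDerivAt_besselSeriesEuler 0)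
  have lIlog : Tendsto (fun y => (besselSeries y - 1) * Real.log y) (𝓝[>] 0) (𝓝 0) := by
    have h := hasDerivAt_tsum_pow (c := fun n => 1 / (n.factorial : ℝ) ^ 2)
      (fun n => abs_div_factorial_sq_le zero_le_one (one_le_two_mul_factorial n)) 0
    refine slope _ (∑' n : ℕ, 1 / (n.factorial : ℝ) ^ 2 * (n * 0 ^ (n - 1)))
      (by rw [besselSeries_zero, sub_self]) (HasDerivAt.sub_const 1 ?_)
    · convert! h using 1
      ext z; exact tsum_congr fun n => by ring
  have main := eq_zero_of_bessel_ode
    (D := fun y => besselSeries y * (-g - Real.log y / 2) + harmonicSeries y - coshInt 0 (2 * √y))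
    (E := fun y => besselSeriesEuler y * (-g - Real.log y / 2) - besselSeries y / 2 +
      harmonicSeriesEuler y + √y * coshInt 1 (2 * √y)) ?_ ?_ ?_ ?_ (y := x ^ 2) (by positivity)
  · simp only [Real.sqrt_sq hx.le, Real.log_pow] at main
    rw [besselK0_eq hx]
    push_cast at main
    linear_combination main
  · intro y hy
    have hs := Real.sqrt_pos.2 hy
    refine ((((hasDerivAt_besselSeries hy.ne').mul (hlog y hy)).add
      (hasDerivAt_harmonicSeries hy.ne')).sub
      ((hasDerivAt_coshInt 0 (mul_pos two_pos hs)).comp y (hsq y hy))).congr_deriv ?_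
    have : √y / y = 1 / √y := by
      rw [div_eq_div_iff hy.ne' hs.ne', one_mul, Real.mul_self_sqrt hy.le]
    rw [add_div, add_div, sub_div, mul_comm √y, mul_div_assoc (coshInt 1 _), this]
    field_simp
    ring
  · intro y hy
    have hs := Real.sqrt_pos.2 hy
    have hr := coshInt_recurrence (mul_pos two_pos hs)
    refine (((((hasDerivAt_besselSeriesEuler y).mul (hlog y hy)).sub
      ((hasDerivAt_besselSeries hy.ne').div_const 2)).add
      (hasDerivAt_harmonicSeriesEuler hy.ne')).add
      ((Real.hasDerivAt_sqrt hy.ne').mul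
        ((hasDerivAt_coshInt 1 (mul_pos two_pos hs)).comp y (hsq y hy)))).congr_deriv ?_
    simp only [Function.comp, Nat.reduceAdd] at hr ⊢
    have e1 : √y * (-coshInt 2 (2 * √y) * (1 / √y)) = -coshInt 2 (2 * √y) := by field_simp
    have e2 : 1 / (2 * √y) * coshInt 1 (2 * √y) = coshInt 2 (2 * √y) - coshInt 0 (2 * √y) := by
      rw [hr]; field_simp
    rw [e1, e2]
    field_simp
    ring
  · have h1 := tendsto_coshInt_zero_add_log.comp hs0
    have h2 := ((lI.const_mul (-g)).sub (lIlog.div_const 2)).add (lQ.sub h1)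
    have e : -g * 1 - 0 / 2 + (0 - -g) = 0 := by ring
    rw [e] at h2
    refine h2.congr' ?_
    filter_upwards [self_mem_nhdsWithin] with y hy
    simp only [Function.comp]
    rw [mul_div_cancel_left₀ _ two_ne_zero, Real.log_sqrt (le_of_lt hy)]
    ring
  · have h3 : Tendsto (fun z => z * coshInt 1 z) (𝓝[>] 0) (𝓝 1) := by
      have he : Tendsto (fun z : ℝ => Real.exp (-z)) (𝓝[>] 0) (𝓝 1) :=
        ((by fun_prop : Continuous fun z : ℝ => Real.exp (-z)).tendsto' 0 1 (by simp)).mono_left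
          nhdsWithin_le_nhds
      have hz : Tendsto (fun z : ℝ => z * coshInt 1 z - Real.exp (-z)) (𝓝[>] 0) (𝓝 0) := by
        rw [tendsto_zero_iff_abs_tendsto_zero]
        refine tendsto_of_tendsto_of_tendsto_of_le_of_le' tendsto_const_nhds
          ((continuous_id.tendsto' (0 : ℝ) 0 rfl).mono_left nhdsWithin_le_nhds)
          (Filter.Eventually.of_forall fun z => abs_nonneg _) ?_
        filter_upwards [self_mem_nhdsWithin] with z hz using abs_mul_coshInt_one_sub_le hz
      simpa using hz.add he
    have h2 := (((lI1.const_mul (-g)).sub (lI1log.div_const 2)).sub (lI.div_const 2)).add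
      (lQ1.add ((h3.comp hs0).div_const 2))
    have e : -g * 0 - 0 / 2 - 1 / 2 + (0 + 1 / 2) = 0 := by ring
    rw [e] at h2
    refine h2.congr fun y => ?_
    simp only [Function.comp]
    ring

/-! ### The product I₀K₀ as an average of K₀ -/

lemma sum_choose_sq (N : ℕ) :
    ∑ p ∈ Finset.HasAntidiagonal.antidiagonal N, (N.choose p.1 : ℝ) ^ 2 = (N + N).choose N := by
  have h := Nat.add_choose_eq N N N
  rw [h]
  push_cast
  refine Finset.sum_congr rfl fun p hp => ?_
  rw [Finset.HasAntidiagonal.mem_antidiagonal] at hp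
  rw [sq, Nat.choose_symm_of_eq_add (show N = p.2 + p.1 by omega)]

lemma summable_harmonic_add (a y : ℝ) :
    Summable fun n : ℕ => ((harmonic n : ℝ) + a) * (y ^ n / (n.factorial : ℝ) ^ 2) :=
  ((summable_harmonic y).add ((summable_pow_div_factorial_sq y).mul_left a)).congr fun n => by ring

lemma tsum_harmonic_add (a y : ℝ) :
    ∑' n : ℕ, ((harmonic n : ℝ) + a) * (y ^ n / (n.factorial : ℝ) ^ 2) =
      besselSeries y * a + harmonicSeries y := by
  rw [besselSeries, harmonicSeries, mul_comm, ← tsum_mul_left, add_comm,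
    ← (summable_harmonic y).tsum_add ((summable_pow_div_factorial_sq y).mul_left a)]
  exact tsum_congr fun n => by ring

/-- The Cauchy product has coefficients ∑ C(N,i)²(H_i + a)/N!², evaluated by
`sum_choose_mul_harmonic` and `sum_choose_sq`. -/
lemma besselSeries_mul (a y : ℝ) :
    (besselSeries y * a + harmonicSeries y) * besselSeries y =
      ∑' N : ℕ, y ^ N / (N.factorial : ℝ) ^ 2 *
        ((N + N).choose N * (2 * harmonic N - harmonic (2 * N) + a)) := by
  rw [← tsum_harmonic_add, besselSeries, tsum_mul_tsum_eq_tsum_sum_antidiagonal_of_summable_norm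
    (summable_harmonic_add a y).norm (summable_pow_div_factorial_sq y).norm]
  refine tsum_congr fun N => ?_
  rw [mul_add, ← sum_choose_mul_harmonic, ← sum_choose_sq, Finset.sum_mul,
    ← Finset.sum_add_distrib, Finset.mul_sum]
  refine Finset.sum_congr rfl ?_
  rintro ⟨i, j⟩ hp
  have hp' : i + j = N := Finset.HasAntidiagonal.mem_antidiagonal.1 hp
  subst hp'
  simp only [Nat.cast_add_choose, pow_add]
  field_simp

/-- Expand K₀(2x sin θ) with `besselK0_eq` and integrate term by term. The moments give C(2N,N)/4^N,
which turns (4x²)^N into x^{2N}, and H_{2N} - H_N - log 2, which turns H_N - log 2x into 2H_N -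
H_{2N} - log x. These are the coefficients of `besselSeries_mul`. -/
lemma integral_coshInt_sin {x : ℝ} (hx : 0 < x) :
    ∫ θ in (0 : ℝ)..Real.pi / 2, coshInt 0 (4 * x * Real.sin θ) =
      Real.pi / 2 * (besselI 0 x * besselK0 x) := by
  set g := Real.eulerMascheroniConstant with hg
  set u : ℕ → ℝ := fun n => (4 * x ^ 2) ^ n / (n.factorial : ℝ) ^ 2 with hu
  have hu0 : ∀ n, 0 ≤ u n := fun n => by positivity
  set c : ℕ → ℝ := fun n => harmonic n + (-g - Real.log (2 * x)) with hc
  have su : Summable u := summable_pow_div_factorial_sq _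
  have sc : Summable fun n => c n * u n := summable_harmonic_add _ _
  have hF := intervalIntegral.hasSum_integral_of_dominated_convergence (μ := volume)
    (a := 0) (b := Real.pi / 2)
    (F := fun n θ => u n * (c n * Real.sin θ ^ (2 * n) -
      Real.sin θ ^ (2 * n) * Real.log (Real.sin θ)))
    (f := fun θ => coshInt 0 (4 * x * Real.sin θ))
    (fun n θ => |c n * u n| + u n * |Real.log (Real.sin θ)|) ?_ ?_ ?_ ?_ ?_
  · rw [← hF.tsum_eq, besselI_zero, besselK0_eq hx, mul_comm (besselSeries _), besselSeries_mul,
      ← tsum_mul_left]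
    refine tsum_congr fun N => ?_
    rw [intervalIntegral.integral_const_mul, intervalIntegral.integral_sub
      (by apply Continuous.intervalIntegrable; fun_prop)
      (intervalIntegrable_sin_pow_mul_log_sin _ _ _), intervalIntegral.integral_const_mul,
      ← sinMoment, ← logSinMoment, logSinMoment_eq, sinMoment_eq, hu, hc]
    simp only
    rw [Real.log_mul two_ne_zero hx.ne', mul_pow]
    field_simp
    ring
  · intro n
    refine Measurable.aestronglyMeasurable ?_
    fun_prop
  · intro n
    refine Filter.Eventually.of_forall fun θ _ => ?_
    have h1 : |Real.sin θ ^ (2 * n)| ≤ 1 := by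
      rw [abs_pow]; exact pow_le_one₀ (abs_nonneg _) (Real.abs_sin_le_one θ)
    rw [Real.norm_eq_abs, abs_mul, abs_of_nonneg (hu0 n), abs_mul, abs_of_nonneg (hu0 n),
      mul_comm |c n|, ← mul_add]
    refine mul_le_mul_of_nonneg_left ?_ (hu0 n)
    refine (abs_sub _ _).trans ?_
    rw [abs_mul, abs_mul]
    exact add_le_add (mul_le_of_le_one_right (abs_nonneg _) h1)
      (mul_le_of_le_one_left (abs_nonneg _) h1)
  · exact Filter.Eventually.of_forall fun θ _ => sc.abs.add (su.mul_right _)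
  · have : (fun θ => ∑' n, (|c n * u n| + u n * |Real.log (Real.sin θ)|)) =
        fun θ => ∑' n, |c n * u n| + (∑' n, u n) * |Real.log (Real.sin θ)| := by
      ext θ
      rw [sc.abs.tsum_add (su.mul_right _), tsum_mul_right]
    rw [this]
    exact intervalIntegrable_const.add ((intervalIntegrable_log_sin.abs).const_mul _)
  · refine Filter.Eventually.of_forall fun θ hθ => ?_
    rw [uIoc_of_le (by positivity)] at hθ
    have hs : 0 < Real.sin θ := Real.sin_pos_of_pos_of_lt_pi hθ.1 (by linarith [hθ.2, Real.pi_pos])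
    have e : 4 * x * Real.sin θ = 2 * (2 * x * Real.sin θ) := by ring
    rw [e, ← besselK0_eq_coshInt (by positivity), besselK0_eq (by positivity), ← tsum_harmonic_add]
    have h := (summable_harmonic_add
      (-g - Real.log (2 * x * Real.sin θ)) ((2 * x * Real.sin θ) ^ 2)).hasSum
    refine (congrArg (HasSum · _) (funext fun n => ?_)).mpr h
    rw [hu, hc, Real.log_mul (by positivity) hs.ne', mul_pow _ (Real.sin θ), mul_pow _ _ n]
    simp only
    rw [← pow_mul (Real.sin θ), mul_pow 2 x]
    ring

/-! ### The square of K₀ -/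

lemma measurable_coshInt (m : ℕ) : Measurable (coshInt m) := by
  have h : StronglyMeasurable (Function.uncurry fun z t : ℝ =>
      Real.cosh t ^ m * Real.exp (-z * Real.cosh t)) := by
    refine Continuous.stronglyMeasurable ?_
    unfold Function.uncurry
    fun_prop
  exact (h.integral_prod_right (ν := volume.restrict (Ioi 0))).measurable

lemma ofReal_coshInt_zero {z : ℝ} (hz : 0 < z) :
    ENNReal.ofReal (coshInt 0 z) = ∫⁻ t in Ioi (0 : ℝ), ENNReal.ofReal (Real.exp (-z * Real.cosh t)) := by
  rw [coshInt, ofReal_integral_eq_lintegral_ofReal (integrableOn_coshInt 0 hz)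
    (Filter.Eventually.of_forall fun t => by positivity)]
  simp

lemma coshInt_zero_pos {z : ℝ} (hz : 0 < z) : 0 < coshInt 0 z := by
  have h := integrableOn_coshInt 0 hz
  rw [coshInt, setIntegral_pos_iff_support_of_nonneg_ae
    (Filter.Eventually.of_forall fun t => by positivity) h]
  have : Function.support (fun t => Real.cosh t ^ 0 * Real.exp (-z * Real.cosh t)) = univ := by
    ext t; simp
  rw [this]; simp

lemma lintegral_even {f : ℝ → ENNReal} (hf : ∀ t, f (-t) = f t) :
    ∫⁻ t, f t = 2 * ∫⁻ t in Ioi 0, f t := by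
  have h1 : ∫⁻ t in Iic 0, f t = ∫⁻ t in Ioi 0, f t := by
    have hcv := lintegral_image_eq_lintegral_abs_deriv_mul (s := Ioi (0 : ℝ)) measurableSet_Ioi
      (f := fun t => -t) (f' := fun _ => -1) (fun t _ => (hasDerivAt_neg t).hasDerivWithinAt)
      neg_injective.injOn f
    rw [setLIntegral_congr Iio_ae_eq_Iic.symm]
    simpa [hf] using hcv
  rw [← lintegral_add_compl f (measurableSet_Ioi (a := (0 : ℝ))), compl_Ioi, h1, two_mul]

lemma lintegral_Ioi_comp_mul {c : ℝ} (hc : 0 < c) (f : ℝ → ENNReal) :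
    ∫⁻ t in Ioi 0, f t = ENNReal.ofReal c * ∫⁻ t in Ioi 0, f (c * t) := by
  have hcv := lintegral_image_eq_lintegral_abs_deriv_mul (s := Ioi (0 : ℝ)) measurableSet_Ioi
    (f := fun t => c * t) (f' := fun _ => c)
    (fun t _ => by simpa using ((hasDerivAt_id t).const_mul c).hasDerivWithinAt)
    (mul_right_injective₀ hc.ne').injOn f
  rw [image_mul_left_Ioi hc, mul_zero] at hcv
  rw [hcv, abs_of_pos hc, lintegral_const_mul' _ _ ENNReal.ofReal_ne_top]

lemma cosh_add_cosh (a b : ℝ) :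
    Real.cosh a + Real.cosh b = 2 * Real.cosh ((a + b) / 2) * Real.cosh ((a - b) / 2) := by
  have h1 := Real.cosh_add ((a + b) / 2) ((a - b) / 2)
  have h2 := Real.cosh_sub ((a + b) / 2) ((a - b) / 2)
  rw [show (a + b) / 2 + (a - b) / 2 = a by ring] at h1
  rw [show (a + b) / 2 - (a - b) / 2 = b by ring] at h2
  linarith

lemma cosh_sub_cosh (a b : ℝ) :
    Real.cosh a - Real.cosh b = 2 * Real.sinh ((a + b) / 2) * Real.sinh ((a - b) / 2) := by
  have h1 := Real.cosh_add ((a + b) / 2) ((a - b) / 2)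
  have h2 := Real.cosh_sub ((a + b) / 2) ((a - b) / 2)
  rw [show (a + b) / 2 + (a - b) / 2 = a by ring] at h1
  rw [show (a + b) / 2 - (a - b) / 2 = b by ring] at h2
  linarith

/-- Over the whole plane, exp(-z(cosh a + cosh b)) has integral 4k(z)². With c = a + b the exponent
becomes -2z cosh(c/2) cosh(a - c/2); integrating over a first is a translation and leaves 2k(2z
cosh(c/2)). -/
lemma ofReal_coshInt_zero_sq {z : ℝ} (hz : 0 < z) :
    ENNReal.ofReal (coshInt 0 z ^ 2) =
      2 * ∫⁻ q in Ioi (0 : ℝ), ENNReal.ofReal (coshInt 0 (2 * z * Real.cosh q)) := by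
  set e : ℝ → ℝ → ENNReal := fun z t => ENNReal.ofReal (Real.exp (-z * Real.cosh t)) with he
  have hem : ∀ z, Measurable (e z) := fun z => by fun_prop
  have hfull : ∀ z > 0, ∫⁻ t, e z t = 2 * ENNReal.ofReal (coshInt 0 z) := fun z hz => by
    rw [ofReal_coshInt_zero hz, lintegral_even fun t => by simp [he]]
  have h1 : (∫⁻ t, e z t) * ∫⁻ t, e z t =
      ∫⁻ a, ∫⁻ c, e (2 * z * Real.cosh (c / 2)) (a - c / 2) := by
    rw [← lintegral_mul_const _ (hem z)]
    refine lintegral_congr fun a => ?_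
    rw [← lintegral_const_mul _ (hem z), ← lintegral_sub_right_eq_self _ a]
    refine lintegral_congr fun c => ?_
    simp only [he]
    rw [← ENNReal.ofReal_mul (Real.exp_pos _).le, ← Real.exp_add]
    have := cosh_add_cosh a (c - a)
    rw [show (a + (c - a)) / 2 = c / 2 by ring, show (a - (c - a)) / 2 = a - c / 2 by ring] at this
    congr 2
    linear_combination (-z) * this
  have h2 : ∫⁻ a, ∫⁻ c, e (2 * z * Real.cosh (c / 2)) (a - c / 2) =
      ∫⁻ c, 2 * ENNReal.ofReal (coshInt 0 (2 * z * Real.cosh (c / 2))) := by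
    rw [lintegral_lintegral_swap (by
      refine Measurable.aemeasurable ?_
      unfold Function.uncurry
      simp only [he]
      fun_prop)]
    refine lintegral_congr fun c => ?_
    rw [lintegral_sub_right_eq_self, hfull _ (mul_pos (mul_pos two_pos hz) (Real.cosh_pos _))]
  rw [h2, hfull z hz, lintegral_even (fun t => by rw [neg_div, Real.cosh_neg]),
    lintegral_Ioi_comp_mul two_pos] at h1
  simp only [mul_div_cancel_left₀ _ (two_ne_zero' ℝ)] at h1
  rw [lintegral_const_mul' _ _ (by simp)] at h1
  have h4 : (4 : ENNReal) ≠ 0 := by simp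
  have h5 : (4 : ENNReal) ≠ ⊤ := by simp
  rw [← ENNReal.mul_right_inj h4 h5, sq, ENNReal.ofReal_mul (coshInt_zero_pos hz).le]
  have h6 : ENNReal.ofReal 2 = 2 := by simp
  rw [h6] at h1
  calc _ = 2 * ENNReal.ofReal (coshInt 0 z) * (2 * ENNReal.ofReal (coshInt 0 z)) := by ring
    _ = _ := h1
    _ = _ := by ring

/-! ### The logarithmic kernel and the principal value transform of K₀ -/

/-- The kernel `½ log ((s + τ) / |s - τ|)`. -/
noncomputable def logKernel (s τ : ℝ) : ℝ := 1 / 2 * Real.log ((s + τ) / |s - τ|)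

/-- With b² = 1 - r² the denominator is b² + sinh² t, and arctan(sinh t / b)/b is a primitive. -/
lemma lintegral_cosh_div {r : ℝ} (hr0 : 0 ≤ r) (hr : r < 1) :
    ∫⁻ t in Ioi (0 : ℝ), ENNReal.ofReal (Real.cosh t / (Real.cosh t ^ 2 - r ^ 2)) =
      ENNReal.ofReal (Real.pi / 2 / √(1 - r ^ 2)) := by
  have hb : 0 < 1 - r ^ 2 := by nlinarith
  set b := √(1 - r ^ 2) with hbd
  have hb0 : 0 < b := Real.sqrt_pos.2 hb
  have hbsq : b ^ 2 = 1 - r ^ 2 := Real.sq_sqrt hb.le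
  have hden : ∀ t, Real.cosh t ^ 2 - r ^ 2 = b ^ 2 + Real.sinh t ^ 2 := fun t => by
    rw [Real.cosh_sq, hbsq]; ring
  have hnn : ∀ t ∈ Ioi (0 : ℝ), 0 ≤ Real.cosh t / (Real.cosh t ^ 2 - r ^ 2) := fun t _ => by
    rw [hden]; have := Real.cosh_pos t; positivity
  have hd : ∀ t ∈ Ici (0 : ℝ), HasDerivAt (fun t => Real.arctan (Real.sinh t / b) / b)
      (Real.cosh t / (Real.cosh t ^ 2 - r ^ 2)) t := fun t _ => by
    refine ((((Real.hasDerivAt_sinh t).div_const b).arctan).div_const b).congr_deriv ?_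
    rw [hden]
    field_simp
  have hl : Tendsto (fun t => Real.arctan (Real.sinh t / b) / b) atTop (𝓝 (Real.pi / 2 / b)) := by
    refine Tendsto.div_const ?_ b
    refine ((Real.tendsto_arctan_atTop.mono_right nhdsWithin_le_nhds).comp ?_)
    refine Tendsto.atTop_div_const hb0 ?_
    refine tendsto_atTop_mono' _ ?_ tendsto_id
    filter_upwards [eventually_ge_atTop 0] with t ht using Real.self_le_sinh_iff.2 ht
  rw [← ofReal_integral_eq_lintegral_ofReal (integrableOn_Ioi_deriv_of_nonneg' hd hnn hl)
    ((ae_restrict_iff' measurableSet_Ioi).2 (Filter.Eventually.of_forall hnn)),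
    integral_Ioi_of_hasDerivAt_of_nonneg' hd hnn hl]
  simp

lemma ofReal_logKernel_of_lt {s τ : ℝ} (hs : 0 < s) (hτ : s < τ) :
    ENNReal.ofReal (logKernel s τ) = ∫⁻ r in Ioo 0 s, ENNReal.ofReal (τ / (τ ^ 2 - r ^ 2)) := by
  have hd : ∀ r ∈ uIcc 0 s, HasDerivAt (fun r => 1 / 2 * (Real.log (τ + r) - Real.log (τ - r)))
      (τ / (τ ^ 2 - r ^ 2)) r := fun r hr => by
    rw [uIcc_of_le hs.le] at hr
    have h1 : 0 < τ + r := by linarith [hr.1]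
    have h2 : 0 < τ - r := by linarith [hr.2]
    refine (((((hasDerivAt_id r).const_add τ).log h1.ne').sub
      (((hasDerivAt_id r).const_sub τ).log h2.ne')).const_mul (1 / 2)).congr_deriv ?_
    have h3 : τ ^ 2 - r ^ 2 = (τ + r) * (τ - r) := by ring
    rw [h3]
    simp only [id]
    field_simp
    ring
  have hc : ContinuousOn (fun r => τ / (τ ^ 2 - r ^ 2)) (uIcc 0 s) := by
    refine ContinuousOn.div continuousOn_const (by fun_prop) fun r hr => ?_
    rw [uIcc_of_le hs.le] at hr
    have h1 : 0 < τ + r := by linarith [hr.1]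
    have h2 : 0 < τ - r := by linarith [hr.2]
    have h3 : τ ^ 2 - r ^ 2 = (τ + r) * (τ - r) := by ring
    rw [h3]; positivity
  have h := intervalIntegral.integral_eq_sub_of_hasDerivAt hd hc.intervalIntegrable
  have e : logKernel s τ = 1 / 2 * (Real.log (τ + s) - Real.log (τ - s)) := by
    rw [logKernel, abs_sub_comm, abs_of_pos (by linarith : 0 < τ - s), add_comm,
      Real.log_div (by linarith) (by linarith)]
  simp only [add_zero, sub_zero, sub_self, mul_zero] at h
  rw [e, ← h, intervalIntegral.integral_of_le hs.le, setLIntegral_congr Ioo_ae_eq_Ioc,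
    ofReal_integral_eq_lintegral_ofReal]
  · have := hc.intervalIntegrable (μ := volume)
    exact ((intervalIntegrable_iff_integrableOn_Ioc_of_le hs.le).1 this)
  · refine (ae_restrict_iff' measurableSet_Ioc).2 (Filter.Eventually.of_forall fun r hr => ?_)
    have h1 : 0 < τ + r := by linarith [hr.1]
    have h2 : 0 < τ - r := by linarith [hr.2]
    have h3 : τ ^ 2 - r ^ 2 = (τ + r) * (τ - r) := by ring
    simp only [Pi.zero_apply]
    rw [h3]
    have : 0 < τ := by linarith
    positivity

lemma lintegral_logKernel_of_le_one {s : ℝ} (hs : 0 < s) (hs1 : s ≤ 1) :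
    ∫⁻ t in Ioi (0 : ℝ), ENNReal.ofReal (logKernel s (Real.cosh t)) =
      ∫⁻ r in Ioo 0 s, ENNReal.ofReal (Real.pi / 2 / √(1 - r ^ 2)) := by
  have h1 : ∫⁻ t in Ioi (0 : ℝ), ENNReal.ofReal (logKernel s (Real.cosh t)) =
      ∫⁻ t in Ioi (0 : ℝ), ∫⁻ r in Ioo 0 s,
        ENNReal.ofReal (Real.cosh t / (Real.cosh t ^ 2 - r ^ 2)) := by
    refine setLIntegral_congr_fun measurableSet_Ioi fun t ht => ?_
    exact ofReal_logKernel_of_lt hs (hs1.trans_lt (Real.one_lt_cosh.2 (ne_of_gt ht)))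
  rw [h1, lintegral_lintegral_swap (by
    refine Measurable.aemeasurable ?_
    unfold Function.uncurry
    fun_prop)]
  exact setLIntegral_congr_fun measurableSet_Ioo fun r hr =>
    lintegral_cosh_div hr.1.le (hr.2.trans_le hs1)

/-- Sum-to-product formulas split the kernel at (cosh b, cosh t) into l(t + b) + l(t - b) with l(v)
= ½ log coth |v/2|. Over the whole line each piece is translation invariant, so b disappears. -/
lemma lintegral_logKernel_cosh (b : ℝ) :
    ∫⁻ t in Ioi (0 : ℝ), ENNReal.ofReal (logKernel (Real.cosh b) (Real.cosh t)) =
      ∫⁻ t in Ioi (0 : ℝ), ENNReal.ofReal (logKernel 1 (Real.cosh t)) := by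
  set l : ℝ → ENNReal := fun v => ENNReal.ofReal
    (1 / 2 * Real.log (Real.cosh (v / 2) / |Real.sinh (v / 2)|)) with hl
  have key : ∀ b : ℝ, ∫⁻ t : ℝ, ENNReal.ofReal (logKernel (Real.cosh b) (Real.cosh t)) =
      (∫⁻ t, l t) + ∫⁻ t, l t := by
    intro b
    have e : ∀ᵐ t : ℝ, ENNReal.ofReal (logKernel (Real.cosh b) (Real.cosh t)) =
        l (t + b) + l (t - b) := by
      have h1 : ∀ᵐ t : ℝ, t ≠ b := by simp [ae_iff]
      have h2 : ∀ᵐ t : ℝ, t ≠ -b := by simp [ae_iff]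
      filter_upwards [h1, h2] with t ht1 ht2
      have n1 : Real.sinh ((t + b) / 2) ≠ 0 := by
        rw [Ne, Real.sinh_eq_zero]; intro h; apply ht2; linarith
      have n2 : Real.sinh ((t - b) / 2) ≠ 0 := by
        rw [Ne, Real.sinh_eq_zero]; intro h; apply ht1; linarith
      have nn : ∀ v : ℝ, Real.sinh v ≠ 0 →
          0 ≤ 1 / 2 * Real.log (Real.cosh v / |Real.sinh v|) := fun v hv => by
        refine mul_nonneg (by norm_num) (Real.log_nonneg ?_)
        rw [one_le_div (abs_pos.2 hv), Real.abs_sinh, ← Real.cosh_abs]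
        exact (Real.sinh_lt_cosh _).le
      have p1 := abs_pos.2 n1
      have p2 := abs_pos.2 n2
      have c1 := Real.cosh_pos ((t + b) / 2)
      have c2 := Real.cosh_pos ((t - b) / 2)
      rw [hl, ← ENNReal.ofReal_add (nn _ n1) (nn _ n2), ← mul_add,
        ← Real.log_mul (by positivity) (by positivity), logKernel]
      congr 3
      rw [add_comm, abs_sub_comm, cosh_add_cosh t b, cosh_sub_cosh t b, abs_mul, abs_mul, abs_two]
      field_simp
    have hm : Measurable l := by rw [hl]; fun_prop
    rw [lintegral_congr_ae e, lintegral_add_left (by fun_prop),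
      lintegral_add_right_eq_self l b, lintegral_sub_right_eq_self l b]
  have h2 : ∀ b : ℝ, 2 * ∫⁻ t in Ioi (0 : ℝ), ENNReal.ofReal (logKernel (Real.cosh b) (Real.cosh t)) =
      (∫⁻ t, l t) + ∫⁻ t, l t := fun b => by
    rw [← key b, lintegral_even fun t => by rw [Real.cosh_neg]]
  have h3 := (h2 b).trans (h2 0).symm
  rw [Real.cosh_zero] at h3
  exact (ENNReal.mul_right_inj two_ne_zero ENNReal.ofNat_ne_top).1 h3

lemma lintegral_logKernel {s : ℝ} (hs : 0 < s) :
    ∫⁻ t in Ioi (0 : ℝ), ENNReal.ofReal (logKernel s (Real.cosh t)) =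
      ∫⁻ r in Ioo 0 (min s 1), ENNReal.ofReal (Real.pi / 2 / √(1 - r ^ 2)) := by
  rcases le_total s 1 with h | h
  · rw [min_eq_left h, lintegral_logKernel_of_le_one hs h]
  · rw [min_eq_right h, ← lintegral_logKernel_of_le_one one_pos le_rfl,
      ← lintegral_logKernel_cosh (Real.arcosh s), Real.cosh_arcosh h]

/-- The primitive is ½ log tanh(y/2), written with 1 - 2/(e^y + 1) so that its limit at infinity is
immediate. -/
lemma lintegral_Ioi_inv_sinh {v : ℝ} (hv : 0 < v) :
    ∫⁻ y in Ioi v, ENNReal.ofReal (1 / (2 * Real.sinh y)) =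
      ENNReal.ofReal (1 / 2 * Real.log ((Real.exp v + 1) / (Real.exp v - 1))) := by
  have hpos : ∀ y : ℝ, 0 < y → 0 < Real.exp y - 1 := fun y hy => by
    linarith [Real.one_lt_exp_iff.2 hy]
  have hnn : ∀ y ∈ Ioi v, 0 ≤ 1 / (2 * Real.sinh y) := fun y hy => by
    have := Real.sinh_pos_iff.2 (hv.trans hy); positivity
  have he : ∀ y : ℝ, 1 - 2 / (Real.exp y + 1) = (Real.exp y - 1) / (Real.exp y + 1) := fun y => by
    have := Real.exp_pos y
    field_simp; ring
  have hd : ∀ y ∈ Ici v, HasDerivAt (fun y => 1 / 2 * Real.log (1 - 2 / (Real.exp y + 1)))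
      (1 / (2 * Real.sinh y)) y := fun y hy => by
    have hy0 : 0 < y := hv.trans_le hy
    have h1 := hpos y hy0
    have h2 := Real.exp_pos y
    have h3 : 1 - 2 / (Real.exp y + 1) ≠ 0 := by rw [he]; positivity
    have h4 := (((((hasDerivAt_const y (2 : ℝ)).div ((Real.hasDerivAt_exp y).add_const 1)
      (by positivity)).const_sub 1).log h3).const_mul (1 / 2))
    refine h4.congr_deriv ?_
    simp only [Pi.div_apply]
    rw [he, Real.sinh_eq, Real.exp_neg]
    have h5 : Real.exp y ^ 2 - 1 ≠ 0 := by nlinarith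
    have h6 : Real.exp y - (Real.exp y)⁻¹ ≠ 0 := by
      intro h; apply h5; field_simp at h; linarith
    field_simp
    ring
  have hl : Tendsto (fun y => 1 / 2 * Real.log (1 - 2 / (Real.exp y + 1))) atTop (𝓝 0) := by
    have h1 : Tendsto (fun y => 1 - 2 / (Real.exp y + 1)) atTop (𝓝 (1 - 0)) :=
      tendsto_const_nhds.sub (tendsto_const_nhds.div_atTop
        (tendsto_atTop_add_const_right _ _ Real.tendsto_exp_atTop))
    have h2 := (h1.log (by norm_num)).const_mul (1 / 2)
    simpa using h2
  rw [← ofReal_integral_eq_lintegral_ofReal (integrableOn_Ioi_deriv_of_nonneg' hd hnn hl)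
    ((ae_restrict_iff' measurableSet_Ioi).2 (Filter.Eventually.of_forall hnn)),
    integral_Ioi_of_hasDerivAt_of_nonneg' hd hnn hl, he,
    ← inv_div (Real.exp v + 1), Real.log_inv]
  congr 1; ring

lemma lintegral_Ioi_abs_log {s τ : ℝ} (hs : 0 < s) (hτ : 0 < τ) (h : s ≠ τ) :
    ∫⁻ y in Ioi |Real.log (s / τ)|, ENNReal.ofReal (1 / (2 * Real.sinh y)) =
      ENNReal.ofReal (logKernel s τ) := by
  have hn : Real.log (s / τ) ≠ 0 := by
    refine Real.log_ne_zero_of_pos_of_ne_one (div_pos hs hτ) ?_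
    rw [Ne, div_eq_one_iff_eq hτ.ne']; exact h
  rw [lintegral_Ioi_inv_sinh (abs_pos.2 hn), logKernel]
  congr 3
  rcases lt_or_gt_of_ne h with h1 | h1
  · rw [abs_of_neg (Real.log_neg (div_pos hs hτ) ((div_lt_one hτ).2 h1)), ← Real.log_inv, inv_div,
      Real.exp_log (div_pos hτ hs), abs_of_neg (by linarith : s - τ < 0)]
    have : τ - s ≠ 0 := by linarith
    have h2 : τ / s - 1 ≠ 0 := by
      rw [div_sub_one hs.ne']; positivity
    rw [neg_sub, div_eq_div_iff h2 this]
    field_simp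
    ring
  · rw [abs_of_pos (Real.log_pos ((one_lt_div hτ).2 h1)),
      Real.exp_log (div_pos hs hτ), abs_of_pos (by linarith : 0 < s - τ)]
    have : s - τ ≠ 0 := by linarith
    have h2 : s / τ - 1 ≠ 0 := by
      rw [div_sub_one hτ.ne']; positivity
    rw [div_eq_div_iff h2 this]
    field_simp

lemma lintegral_Ioo_exp {c A B : ℝ} (hc : 0 < c) (h : A ≤ B) :
    ∫⁻ s in Ioo A B, ENNReal.ofReal (c * Real.exp (-c * s)) =
      ENNReal.ofReal (Real.exp (-c * A) - Real.exp (-c * B)) := by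
  have hd : ∀ s ∈ uIcc A B, HasDerivAt (fun s => -Real.exp (-c * s)) (c * Real.exp (-c * s)) s :=
    fun s _ => by
      refine (((hasDerivAt_id s).const_mul (-c)).exp.neg).congr_deriv ?_
      simp; ring
  have hint : IntervalIntegrable (fun s => c * Real.exp (-c * s)) volume A B := by
    apply Continuous.intervalIntegrable; fun_prop
  have h1 := intervalIntegral.integral_eq_sub_of_hasDerivAt hd hint
  rw [setLIntegral_congr Ioo_ae_eq_Ioc, ← ofReal_integral_eq_lintegral_ofReal
    ((intervalIntegrable_iff_integrableOn_Ioc_of_le h).1 hint)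
    (Filter.Eventually.of_forall fun s => by positivity), ← intervalIntegral.integral_of_le h, h1]
  congr 1; ring

lemma lintegral_Ioi_exp {c : ℝ} (hc : 0 < c) (A : ℝ) :
    ∫⁻ s in Ioi A, ENNReal.ofReal (c * Real.exp (-c * s)) = ENNReal.ofReal (Real.exp (-c * A)) := by
  rw [← ofReal_integral_eq_lintegral_ofReal ((exp_neg_integrableOn_Ioi A hc).const_mul c)
    (Filter.Eventually.of_forall fun s => by positivity), integral_const_mul,
    integral_exp_mul_Ioi (by linarith)]
  congr 1; field_simp

lemma mem_Ioo_iff_abs_log_lt {s τ y : ℝ} (hs : 0 < s) (hτ : 0 < τ) :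
    s ∈ Ioo (τ * Real.exp (-y)) (τ * Real.exp y) ↔ |Real.log (s / τ)| < y := by
  rw [abs_lt, Real.lt_log_iff_exp_lt (div_pos hs hτ), Real.log_lt_iff_lt_exp (div_pos hs hτ),
    lt_div_iff₀ hτ, div_lt_iff₀ hτ, mem_Ioo, mul_comm τ, mul_comm τ]

lemma coshInt_zero_anti {a b : ℝ} (ha : 0 < a) (h : a ≤ b) : coshInt 0 b ≤ coshInt 0 a := by
  refine setIntegral_mono (integrableOn_coshInt 0 (ha.trans_le h)) (integrableOn_coshInt 0 ha)
    fun t => ?_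
  simp only [pow_zero, one_mul, Real.exp_le_exp]
  nlinarith [Real.cosh_pos t]

/-- The principal value transform of `K₀`. -/
lemma lintegral_coshInt_sub {c : ℝ} (hc : 0 < c) :
    ∫⁻ y in Ioi (0 : ℝ), ENNReal.ofReal
        ((coshInt 0 (c * Real.exp (-y)) - coshInt 0 (c * Real.exp y)) / (2 * Real.sinh y)) =
      ∫⁻ r in Ioo (0 : ℝ) 1,
        ENNReal.ofReal (Real.pi / 2 / √(1 - r ^ 2)) * ENNReal.ofReal (Real.exp (-c * r)) := by
  -- The difference of exponentials at cosh t · e^{∓y} is the integral of c e^{-cs} over the s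
  -- between these points. The triple integral of G is then taken with y first, where the condition
  -- reads y > |log(s / cosh t)|.
  set G : ℝ → ℝ → ℝ → ENNReal := fun y t s =>
    if Real.cosh t * Real.exp (-y) < s ∧ s < Real.cosh t * Real.exp y then
      ENNReal.ofReal (c * Real.exp (-c * s)) * ENNReal.ofReal (1 / (2 * Real.sinh y)) else 0 with hG
  have hGm : Measurable fun p : ℝ × ℝ × ℝ => G p.1 p.2.1 p.2.2 := by
    refine Measurable.ite ?_ (by fun_prop) measurable_const
    have m1 : MeasurableSet {p : ℝ × ℝ × ℝ | Real.cosh p.2.1 * Real.exp (-p.1) < p.2.2} :=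
      measurableSet_lt (by fun_prop) (by fun_prop)
    have m2 : MeasurableSet {p : ℝ × ℝ × ℝ | p.2.2 < Real.cosh p.2.1 * Real.exp p.1} :=
      measurableSet_lt (by fun_prop) (by fun_prop)
    exact m1.inter m2
  have h1 : ∫⁻ y in Ioi (0 : ℝ), ENNReal.ofReal
        ((coshInt 0 (c * Real.exp (-y)) - coshInt 0 (c * Real.exp y)) / (2 * Real.sinh y)) =
      ∫⁻ y in Ioi (0 : ℝ), ∫⁻ t in Ioi (0 : ℝ), ∫⁻ s in Ioi (0 : ℝ), G y t s := by
    refine setLIntegral_congr_fun measurableSet_Ioi fun y hy => ?_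
    have hy : 0 < y := hy
    have hsy : 0 < Real.sinh y := Real.sinh_pos_iff.2 hy
    have hle : Real.exp (-y) ≤ Real.exp y := Real.exp_le_exp.2 (by linarith)
    have i1 := integrableOn_coshInt 0 (mul_pos hc (Real.exp_pos (-y)))
    have i2 := integrableOn_coshInt 0 (mul_pos hc (Real.exp_pos y))
    have i3 : IntegrableOn (fun t => Real.cosh t ^ 0 * Real.exp (-(c * Real.exp (-y)) * Real.cosh t) -
        Real.cosh t ^ 0 * Real.exp (-(c * Real.exp y) * Real.cosh t)) (Ioi 0) := i1.sub i2
    have hmono : ∀ t, Real.exp (-(c * Real.exp y) * Real.cosh t) ≤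
        Real.exp (-(c * Real.exp (-y)) * Real.cosh t) := fun t => by
      rw [Real.exp_le_exp]
      have := mul_le_mul_of_nonneg_left hle (mul_pos hc (Real.cosh_pos t)).le
      linarith
    rw [coshInt, coshInt, ← integral_sub i1 i2, div_eq_inv_mul, ← one_div,
      ENNReal.ofReal_mul (by positivity), ofReal_integral_eq_lintegral_ofReal i3
        (Filter.Eventually.of_forall fun t => by
          simp only [Pi.zero_apply, pow_zero, one_mul, sub_nonneg]; exact hmono t),
      ← lintegral_const_mul' _ _ ENNReal.ofReal_ne_top]
    refine lintegral_congr fun t => ?_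
    have hct := Real.cosh_pos t
    have e1 : ∀ s, G y t s = (Ioo (Real.cosh t * Real.exp (-y)) (Real.cosh t * Real.exp y)).indicator
        (fun s => ENNReal.ofReal (c * Real.exp (-c * s)) * ENNReal.ofReal (1 / (2 * Real.sinh y))) s :=
      fun s => by simp only [hG, indicator, mem_Ioo]
    simp only [e1]
    rw [lintegral_indicator measurableSet_Ioo, Measure.restrict_restrict measurableSet_Ioo,
      inter_eq_left.2 (Ioo_subset_Ioi_self.trans (Ioi_subset_Ioi (by positivity))),
      lintegral_mul_const' _ _ ENNReal.ofReal_ne_top,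
      lintegral_Ioo_exp hc (mul_le_mul_of_nonneg_left hle hct.le), mul_comm]
    congr 2
    simp only [pow_zero, one_mul]
    ring_nf
  have h2 : ∀ s ∈ Ioi (0 : ℝ), ∫⁻ t in Ioi (0 : ℝ), ∫⁻ y in Ioi (0 : ℝ), G y t s =
      ∫⁻ r in Ioo (0 : ℝ) 1, ENNReal.ofReal (Real.pi / 2 / √(1 - r ^ 2)) *
        (Ioi r).indicator (fun s => ENNReal.ofReal (c * Real.exp (-c * s))) s := by
    intro s hs
    have hs : 0 < s := hs
    -- The y-integral diverges when s = cosh t, which happens for at most one positive t.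
    have hae : ∀ᵐ t ∂(volume.restrict (Ioi (0 : ℝ))), s ≠ Real.cosh t := by
      rw [ae_restrict_iff' measurableSet_Ioi]
      have : ∀ᵐ t : ℝ, t ≠ Real.arcosh s := by simp [ae_iff]
      filter_upwards [this] with t ht h0 h
      apply ht
      rw [h, Real.arcosh_cosh (le_of_lt h0)]
    have e1 : ∫⁻ t in Ioi (0 : ℝ), ∫⁻ y in Ioi (0 : ℝ), G y t s =
        ∫⁻ t in Ioi (0 : ℝ), ENNReal.ofReal (c * Real.exp (-c * s)) *
          ENNReal.ofReal (logKernel s (Real.cosh t)) := by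
      refine lintegral_congr_ae ?_
      filter_upwards [hae] with t ht
      have e2 : ∀ y, G y t s = (Ioi |Real.log (s / Real.cosh t)|).indicator (fun y =>
          ENNReal.ofReal (c * Real.exp (-c * s)) * ENNReal.ofReal (1 / (2 * Real.sinh y))) y := by
        intro y
        simp only [hG, indicator, mem_Ioi, ← mem_Ioo_iff_abs_log_lt hs (Real.cosh_pos t), mem_Ioo]
      simp only [e2]
      rw [lintegral_indicator measurableSet_Ioi, Measure.restrict_restrict measurableSet_Ioi,
        Ioi_inter_Ioi, sup_eq_left.2 (abs_nonneg _),
        lintegral_const_mul' _ _ ENNReal.ofReal_ne_top,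
        lintegral_Ioi_abs_log hs (Real.cosh_pos t) ht]
    rw [e1, lintegral_const_mul' _ _ ENNReal.ofReal_ne_top, lintegral_logKernel hs]
    -- The same condition r < s is moved from s to r. This expresses the bound min(s, 1) and allows
    -- s to be integrated last, producing e^{-cr}.
    have e3 : ∀ r, ENNReal.ofReal (Real.pi / 2 / √(1 - r ^ 2)) *
        (Ioi r).indicator (fun s => ENNReal.ofReal (c * Real.exp (-c * s))) s =
        (Iio s).indicator (fun r => ENNReal.ofReal (c * Real.exp (-c * s)) *
          ENNReal.ofReal (Real.pi / 2 / √(1 - r ^ 2))) r := fun r => by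
      by_cases hrs : r < s <;> simp [indicator, hrs, mul_comm]
    simp only [e3]
    rw [lintegral_indicator measurableSet_Iio, Measure.restrict_restrict measurableSet_Iio,
      lintegral_const_mul' _ _ ENNReal.ofReal_ne_top]
    congr 3
    ext r
    simp only [mem_Ioo, mem_inter_iff, mem_Iio, lt_min_iff]
    tauto
  have h3 : ∫⁻ y in Ioi (0 : ℝ), ∫⁻ t in Ioi (0 : ℝ), ∫⁻ s in Ioi (0 : ℝ), G y t s =
      ∫⁻ s in Ioi (0 : ℝ), ∫⁻ t in Ioi (0 : ℝ), ∫⁻ y in Ioi (0 : ℝ), G y t s := by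
    have e1 : ∀ y, ∫⁻ t in Ioi (0 : ℝ), ∫⁻ s in Ioi (0 : ℝ), G y t s =
        ∫⁻ s in Ioi (0 : ℝ), ∫⁻ t in Ioi (0 : ℝ), G y t s := fun y =>
      lintegral_lintegral_swap (hGm.comp
        (by fun_prop : Measurable fun p : ℝ × ℝ => (y, p.1, p.2))).aemeasurable
    have e2 : ∀ s, ∫⁻ t in Ioi (0 : ℝ), ∫⁻ y in Ioi (0 : ℝ), G y t s =
        ∫⁻ y in Ioi (0 : ℝ), ∫⁻ t in Ioi (0 : ℝ), G y t s := fun s =>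
      lintegral_lintegral_swap (hGm.comp
        (by fun_prop : Measurable fun p : ℝ × ℝ => (p.2, p.1, s))).aemeasurable
    simp only [e1, e2]
    refine lintegral_lintegral_swap (Measurable.aemeasurable ?_)
    exact Measurable.lintegral_prod_right' (ν := volume.restrict (Ioi (0 : ℝ)))
      (f := fun p : (ℝ × ℝ) × ℝ => G p.1.1 p.2 p.1.2)
      (hGm.comp (by fun_prop : Measurable fun p : (ℝ × ℝ) × ℝ => (p.1.1, p.2, p.1.2)))
  rw [h1, h3, setLIntegral_congr_fun measurableSet_Ioi h2, lintegral_lintegral_swap]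
  · refine setLIntegral_congr_fun measurableSet_Ioo fun r hr => ?_
    rw [lintegral_const_mul' _ _ ENNReal.ofReal_ne_top, lintegral_indicator measurableSet_Ioi,
      Measure.restrict_restrict measurableSet_Ioi,
      Ioi_inter_Ioi, sup_eq_left.2 hr.1.le, lintegral_Ioi_exp hc]
  · refine Measurable.aemeasurable ?_
    refine Measurable.mul (by fun_prop) ?_
    have : (fun p : ℝ × ℝ => (Ioi p.2).indicator
        (fun s => ENNReal.ofReal (c * Real.exp (-c * s))) p.1) =
        fun p : ℝ × ℝ => if p.2 < p.1 then ENNReal.ofReal (c * Real.exp (-c * p.1)) else 0 := by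
      ext p; simp [indicator]
    rw [this]
    exact Measurable.ite (measurableSet_lt measurable_snd measurable_fst) (by fun_prop)
      measurable_const

/-! ### The principal value transform of K₀² -/

/-- Write each square as 2∫ k(2z cosh q · e^{∓y}) dq, apply `lintegral_coshInt_sub` with c = 2z cosh
q, and integrate e^{-2zr cosh q} over q to recover k(2zr). -/
lemma lintegral_coshInt_sq_sub {z : ℝ} (hz : 0 < z) :
    ∫⁻ y in Ioi (0 : ℝ), ENNReal.ofReal
        ((coshInt 0 (z * Real.exp (-y)) ^ 2 - coshInt 0 (z * Real.exp y) ^ 2) /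
          (2 * Real.sinh y)) =
      2 * ∫⁻ r in Ioo (0 : ℝ) 1,
        ENNReal.ofReal (Real.pi / 2 / √(1 - r ^ 2)) * ENNReal.ofReal (coshInt 0 (2 * z * r)) := by
  have hK := measurable_coshInt 0
  have h1 : ∫⁻ y in Ioi (0 : ℝ), ENNReal.ofReal
        ((coshInt 0 (z * Real.exp (-y)) ^ 2 - coshInt 0 (z * Real.exp y) ^ 2) /
          (2 * Real.sinh y)) =
      ∫⁻ y in Ioi (0 : ℝ), 2 * ∫⁻ q in Ioi (0 : ℝ), ENNReal.ofReal
        ((coshInt 0 (2 * z * Real.cosh q * Real.exp (-y)) -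
          coshInt 0 (2 * z * Real.cosh q * Real.exp y)) / (2 * Real.sinh y)) := by
    refine setLIntegral_congr_fun measurableSet_Ioi fun y hy => ?_
    have hy : 0 < y := hy
    have hsy : 0 < Real.sinh y := Real.sinh_pos_iff.2 hy
    have hle : Real.exp (-y) ≤ Real.exp y := Real.exp_le_exp.2 (by linarith)
    have p1 := mul_pos hz (Real.exp_pos (-y))
    have p2 := mul_pos hz (Real.exp_pos y)
    have hsq := ofReal_coshInt_zero_sq p2
    -- Finiteness is what lets the truncated subtraction of `ENNReal` pass through the integral.
    have hfin : ∫⁻ q in Ioi (0 : ℝ), ENNReal.ofReal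
        (coshInt 0 (2 * (z * Real.exp y) * Real.cosh q)) ≠ ⊤ := by
      intro h
      rw [h] at hsq
      exact ENNReal.ofReal_ne_top (hsq.trans (by simp))
    have hdiff : ∀ q, coshInt 0 (2 * (z * Real.exp y) * Real.cosh q) ≤
        coshInt 0 (2 * (z * Real.exp (-y)) * Real.cosh q) := fun q => by
      have := Real.cosh_pos q
      refine coshInt_zero_anti (by positivity) ?_
      gcongr
    rw [div_eq_inv_mul, ENNReal.ofReal_mul (by positivity), ENNReal.ofReal_sub _ (sq_nonneg _),
      ofReal_coshInt_zero_sq p1, hsq, ← ENNReal.mul_sub (by simp),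
      ← lintegral_sub (by fun_prop) hfin (Filter.Eventually.of_forall fun q =>
        ENNReal.ofReal_le_ofReal (hdiff q)), mul_left_comm,
      ← lintegral_const_mul' _ _ ENNReal.ofReal_ne_top]
    congr 1
    refine lintegral_congr fun q => ?_
    have := Real.cosh_pos q
    rw [← ENNReal.ofReal_sub _ (coshInt_zero_pos (by positivity)).le,
      ← ENNReal.ofReal_mul (by positivity), div_eq_inv_mul]
    congr 4 <;> ring_nf
  rw [h1, lintegral_const_mul' _ _ (by simp), lintegral_lintegral_swap (by
    refine Measurable.aemeasurable ?_
    unfold Function.uncurry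
    fun_prop)]
  congr 1
  have h2 : ∀ q : ℝ, _ := fun q => lintegral_coshInt_sub
    (c := 2 * z * Real.cosh q) (mul_pos (mul_pos two_pos hz) (Real.cosh_pos q))
  simp only [h2]
  rw [lintegral_lintegral_swap (by
    refine Measurable.aemeasurable ?_
    unfold Function.uncurry
    fun_prop)]
  refine setLIntegral_congr_fun measurableSet_Ioo fun r hr => ?_
  rw [lintegral_const_mul' _ _ ENNReal.ofReal_ne_top,
    ofReal_coshInt_zero (mul_pos (mul_pos two_pos hz) hr.1)]
  congr 1
  refine lintegral_congr fun q => ?_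
  congr 2; ring

lemma lintegral_Ioo_sin (F : ℝ → ENNReal) :
    ∫⁻ r in Ioo (0 : ℝ) 1, ENNReal.ofReal (Real.pi / 2 / √(1 - r ^ 2)) * F r =
      ENNReal.ofReal (Real.pi / 2) * ∫⁻ θ in Ioo 0 (Real.pi / 2), F (Real.sin θ) := by
  have hpi := Real.pi_pos
  have him : Real.sin '' Ioo 0 (Real.pi / 2) = Ioo 0 1 := by
    ext r
    constructor
    · rintro ⟨θ, hθ, rfl⟩
      refine ⟨Real.sin_pos_of_pos_of_lt_pi hθ.1 (by linarith [hθ.2]), ?_⟩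
      rw [← Real.sin_pi_div_two]
      exact Real.sin_lt_sin_of_lt_of_le_pi_div_two (by linarith [hθ.1]) le_rfl hθ.2
    · intro hr
      refine ⟨Real.arcsin r, ⟨Real.arcsin_pos.2 hr.1, Real.arcsin_lt_pi_div_two.2 hr.2⟩, ?_⟩
      exact Real.sin_arcsin (by linarith [hr.1]) hr.2.le
  have hinj : InjOn Real.sin (Ioo 0 (Real.pi / 2)) := Real.injOn_sin.mono
    (Ioo_subset_Icc_self.trans (Icc_subset_Icc_left (by linarith)))
  have h := lintegral_image_eq_lintegral_abs_deriv_mul measurableSet_Ioo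
    (fun θ _ => (Real.hasDerivAt_sin θ).hasDerivWithinAt) hinj
    (fun r => ENNReal.ofReal (Real.pi / 2 / √(1 - r ^ 2)) * F r)
  rw [him] at h
  rw [h, ← lintegral_const_mul' _ _ ENNReal.ofReal_ne_top]
  refine setLIntegral_congr_fun measurableSet_Ioo fun θ hθ => ?_
  have hc : 0 < Real.cos θ := Real.cos_pos_of_mem_Ioo ⟨by linarith [hθ.1], hθ.2⟩
  rw [← mul_assoc, ← ENNReal.ofReal_mul (abs_nonneg _), ← Real.cos_sq', Real.sqrt_sq hc.le,
    abs_of_pos hc]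
  congr 2
  field_simp

lemma besselI_zero_pos (x : ℝ) : 0 < besselI 0 x := by
  rw [besselI_zero]; exact besselSeries_pos (sq_nonneg x)

lemma besselK0_pos {x : ℝ} (hx : 0 < x) : 0 < besselK0 x := by
  rw [besselK0_eq_coshInt hx]; exact coshInt_zero_pos (by positivity)

lemma lintegral_coshInt_sin {x : ℝ} (hx : 0 < x) :
    ∫⁻ θ in Ioo 0 (Real.pi / 2), ENNReal.ofReal (coshInt 0 (4 * x * Real.sin θ)) =
      ENNReal.ofReal (Real.pi / 2 * (besselI 0 x * besselK0 x)) := by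
  have hpi := Real.pi_pos
  have h := integral_coshInt_sin hx
  have hpos : 0 < Real.pi / 2 * (besselI 0 x * besselK0 x) :=
    mul_pos (by positivity) (mul_pos (besselI_zero_pos x) (besselK0_pos hx))
  have hint : IntervalIntegrable (fun θ => coshInt 0 (4 * x * Real.sin θ)) volume 0 (Real.pi / 2) := by
    -- Otherwise the integral would take the default value 0, against its positive value.
    by_contra hn
    rw [intervalIntegral.integral_undef hn] at h
    linarith
  rw [intervalIntegrable_iff_integrableOn_Ioo_of_le (by positivity)] at hint
  rw [intervalIntegral.integral_of_le (by positivity), integral_Ioc_eq_integral_Ioo] at h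
  rw [← h, ofReal_integral_eq_lintegral_ofReal hint]
  refine (ae_restrict_iff' measurableSet_Ioo).2 (Filter.Eventually.of_forall fun θ hθ => ?_)
  have hs : 0 < Real.sin θ := Real.sin_pos_of_pos_of_lt_pi hθ.1 (by linarith [hθ.2])
  exact (coshInt_zero_pos (by positivity)).le

/-- `I₀ K₀` as the principal value transform of `K₀²`. -/
lemma lintegral_coshInt_sq_sub_eq {x : ℝ} (hx : 0 < x) :
    ∫⁻ y in Ioi (0 : ℝ), ENNReal.ofReal
        ((coshInt 0 (2 * x * Real.exp (-y)) ^ 2 - coshInt 0 (2 * x * Real.exp y) ^ 2) /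
          (2 * Real.sinh y)) =
      ENNReal.ofReal (Real.pi ^ 2 / 2 * (besselI 0 x * besselK0 x)) := by
  have hpi := Real.pi_pos
  rw [lintegral_coshInt_sq_sub (by positivity),
    lintegral_Ioo_sin (fun r => ENNReal.ofReal (coshInt 0 (2 * (2 * x) * r))),
    show 2 * (2 * x) = 4 * x by ring, lintegral_coshInt_sin hx, ← ENNReal.ofReal_mul (by positivity),
    ← ENNReal.ofReal_ofNat 2, ← ENNReal.ofReal_mul (by positivity)]
  congr 1
  ring

/-! ### The even moments of K₀² -/

lemma integrable_and_integral_eq_of_lintegral {α : Type*} [MeasurableSpace α] {μ : Measure α}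
    {f : α → ℝ} (hm : AEStronglyMeasurable f μ) (h0 : 0 ≤ᵐ[μ] f) {a : ℝ} (ha : 0 ≤ a)
    (h : ∫⁻ x, ENNReal.ofReal (f x) ∂μ = ENNReal.ofReal a) :
    Integrable f μ ∧ ∫ x, f x ∂μ = a := by
  refine ⟨⟨hm, ?_⟩, ?_⟩
  · rw [hasFiniteIntegral_iff_ofReal h0, h]; exact ENNReal.ofReal_lt_top
  · rw [integral_eq_lintegral_of_nonneg_ae h0 hm, h, ENNReal.toReal_ofReal ha]

/-- The derivative of sinh q / cosh^{2k+2} q gives the recurrence of `sinMoment_succ`, and both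
sequences start at π/2. -/
lemma lintegral_inv_cosh_pow (k : ℕ) :
    ∫⁻ q in Ioi (0 : ℝ), ENNReal.ofReal ((Real.cosh q)⁻¹ ^ (2 * k + 1)) =
      ENNReal.ofReal (sinMoment k) := by
  have hnn : ∀ k : ℕ, 0 ≤ᵐ[volume.restrict (Ioi (0 : ℝ))]
      fun q => (Real.cosh q)⁻¹ ^ (2 * k + 1) := fun k =>
    Filter.Eventually.of_forall fun q => by
      have := Real.cosh_pos q
      simp only [Pi.zero_apply]; positivity
  have hmeas : ∀ k : ℕ, AEStronglyMeasurable (fun q => (Real.cosh q)⁻¹ ^ (2 * k + 1))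
      (volume.restrict (Ioi (0 : ℝ))) := fun k => Measurable.aestronglyMeasurable (by fun_prop)
  suffices h : IntegrableOn (fun q => (Real.cosh q)⁻¹ ^ (2 * k + 1)) (Ioi 0) ∧
      ∫ q in Ioi (0 : ℝ), (Real.cosh q)⁻¹ ^ (2 * k + 1) = sinMoment k by
    rw [← h.2, ofReal_integral_eq_lintegral_ofReal h.1 (hnn k)]
  induction k with
  | zero =>
    refine integrable_and_integral_eq_of_lintegral (hmeas 0) (hnn 0)
      (by rw [sinMoment_eq]; positivity) ?_
    have h := lintegral_cosh_div le_rfl one_pos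
    have e : ∀ q : ℝ, Real.cosh q / (Real.cosh q ^ 2 - 0 ^ 2) = (Real.cosh q)⁻¹ ^ (2 * 0 + 1) :=
      fun q => by
        have := Real.cosh_pos q
        rw [zero_pow two_ne_zero, sub_zero, mul_zero, zero_add, pow_one]; field_simp
    simp only [e] at h
    rw [h, sinMoment_eq]
    simp
  | succ k ih =>
    obtain ⟨i0, e0⟩ := ih
    have i1 : IntegrableOn (fun q => (Real.cosh q)⁻¹ ^ (2 * (k + 1) + 1)) (Ioi 0) := by
      refine Integrable.mono' i0 (hmeas (k + 1)) (Filter.Eventually.of_forall fun q => ?_)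
      have h1 := Real.one_le_cosh q
      have h2 := Real.cosh_pos q
      rw [Real.norm_of_nonneg (by positivity)]
      exact pow_le_pow_of_le_one (by positivity) (inv_le_one_of_one_le₀ h1) (by omega)
    refine ⟨i1, ?_⟩
    have hd : ∀ q ∈ Ici (0 : ℝ), HasDerivAt (fun q => Real.sinh q * (Real.cosh q)⁻¹ ^ (2 * k + 2))
        ((2 * k + 2) * (Real.cosh q)⁻¹ ^ (2 * (k + 1) + 1) -
          (2 * k + 1) * (Real.cosh q)⁻¹ ^ (2 * k + 1)) q := by
      intro q _
      have hc := Real.cosh_pos q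
      refine ((Real.hasDerivAt_sinh q).mul
        (((Real.hasDerivAt_cosh q).fun_inv hc.ne').fun_pow (2 * k + 2))).congr_deriv ?_
      have hs : Real.sinh q * Real.sinh q = Real.cosh q ^ 2 - 1 := by
        rw [← sq, Real.sinh_sq]
      simp only [Nat.cast_add, Nat.cast_mul, Nat.cast_ofNat, Nat.add_one_sub_one]
      have e : Real.sinh q * ((2 * (k : ℝ) + 2) * (Real.cosh q)⁻¹ ^ (2 * k + 1) *
          (-Real.sinh q / Real.cosh q ^ 2)) = -(2 * (k : ℝ) + 2) * (Real.cosh q)⁻¹ ^ (2 * k + 1) *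
          ((Real.sinh q * Real.sinh q) / Real.cosh q ^ 2) := by ring
      have e2 : (Real.cosh q ^ 2 - 1) / Real.cosh q ^ 2 = 1 - (Real.cosh q)⁻¹ ^ 2 := by field_simp
      have e3 : Real.cosh q * (Real.cosh q)⁻¹ = 1 := mul_inv_cancel₀ hc.ne'
      rw [e, hs, e2]
      linear_combination (Real.cosh q)⁻¹ ^ (2 * k + 1) * e3
    have hl : Tendsto (fun q => Real.sinh q * (Real.cosh q)⁻¹ ^ (2 * k + 2)) atTop (𝓝 0) := by
      have hct : Tendsto Real.cosh atTop atTop := tendsto_atTop_mono le_cosh tendsto_id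
      refine tendsto_of_tendsto_of_tendsto_of_le_of_le' tendsto_const_nhds
        (tendsto_inv_atTop_zero.comp hct) ?_ ?_
      · filter_upwards [eventually_ge_atTop 0] with q hq
        have := Real.sinh_nonneg_iff.2 hq
        have := Real.cosh_pos q
        positivity
      · filter_upwards [eventually_ge_atTop 0] with q hq
        have h1 := Real.one_le_cosh q
        have h2 := Real.cosh_pos q
        have h3 : (Real.cosh q)⁻¹ ^ (2 * k + 2) ≤ (Real.cosh q)⁻¹ ^ 2 :=
          pow_le_pow_of_le_one (by positivity) (inv_le_one_of_one_le₀ h1) (by omega)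
        calc Real.sinh q * (Real.cosh q)⁻¹ ^ (2 * k + 2)
            ≤ Real.cosh q * (Real.cosh q)⁻¹ ^ 2 :=
              mul_le_mul (Real.sinh_lt_cosh q).le h3 (by positivity) h2.le
          _ = _ := by simp only [Function.comp]; field_simp
    have h := integral_Ioi_of_hasDerivAt_of_tendsto' hd
      ((i1.const_mul (2 * (k : ℝ) + 2)).sub (i0.const_mul (2 * (k : ℝ) + 1))) hl
    rw [integral_sub (i1.const_mul _) (i0.const_mul _), integral_const_mul, integral_const_mul,
      e0] at h
    rw [sinMoment_succ]
    simp only [Real.sinh_zero, zero_mul, sub_self] at h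
    rw [div_mul_eq_mul_div, eq_div_iff (by positivity)]
    linarith

lemma lintegral_pow_mul_exp {a : ℝ} (ha : 0 < a) (n : ℕ) :
    ∫⁻ t in Ioi (0 : ℝ), ENNReal.ofReal (t ^ n * Real.exp (-a * t)) =
      ENNReal.ofReal (n.factorial / a ^ (n + 1)) := by
  have h := integral_rpow_mul_exp_neg_mul_rpow (p := 1) (q := n) (b := a) one_pos
    (by have : (0 : ℝ) ≤ n := n.cast_nonneg
        linarith) ha
  simp only [Real.rpow_one, Real.rpow_natCast, div_one, mul_one] at h
  rw [Real.Gamma_nat_eq_factorial, Real.rpow_neg ha.le] at h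
  have h2 : a ^ ((n : ℝ) + 1) = a ^ (n + 1) := by exact_mod_cast Real.rpow_natCast a (n + 1)
  rw [h2] at h
  have hpos : 0 < (a ^ (n + 1))⁻¹ * (n.factorial : ℝ) := by positivity
  have hint : IntegrableOn (fun t => t ^ n * Real.exp (-a * t)) (Ioi 0) := by
    by_contra hn
    rw [integral_undef hn] at h
    linarith
  rw [← ofReal_integral_eq_lintegral_ofReal hint
    ((ae_restrict_iff' measurableSet_Ioi).2 (Filter.Eventually.of_forall fun t ht => by
      have : (0 : ℝ) < t := ht
      simp only [Pi.zero_apply]; positivity)), h]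
  congr 1; field_simp

/-- By the formula for the square, k(zt)² = 2∫∫ exp(-2zt cosh q cosh p) dp dq. Integrating over t
first gives (2k)!/(2z cosh q cosh p)^{2k+1}, which separates into two equal integrals. -/
lemma lintegral_pow_mul_coshInt_sq {z : ℝ} (hz : 0 < z) (k : ℕ) :
    ∫⁻ t in Ioi (0 : ℝ), ENNReal.ofReal (t ^ (2 * k) * coshInt 0 (z * t) ^ 2) =
      ENNReal.ofReal (2 * ((2 * k).factorial / (2 * z) ^ (2 * k + 1) * sinMoment k ^ 2)) := by
  set G : ℝ → ℝ → ℝ → ENNReal := fun t q p =>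
    ENNReal.ofReal (t ^ (2 * k) * Real.exp (-(2 * z * Real.cosh q * Real.cosh p) * t)) with hG
  have hGm : Measurable fun p : ℝ × ℝ × ℝ => G p.1 p.2.1 p.2.2 := by
    simp only [hG]; fun_prop
  have hsm : 0 ≤ sinMoment k := by rw [sinMoment_eq]; positivity
  have h1 : ∀ t ∈ Ioi (0 : ℝ), ENNReal.ofReal (t ^ (2 * k) * coshInt 0 (z * t) ^ 2) =
      2 * ∫⁻ q in Ioi (0 : ℝ), ∫⁻ p in Ioi (0 : ℝ), G t q p := by
    intro t ht
    have ht : 0 < t := ht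
    rw [ENNReal.ofReal_mul (by positivity), ofReal_coshInt_zero_sq (mul_pos hz ht), mul_left_comm,
      ← lintegral_const_mul' _ _ ENNReal.ofReal_ne_top]
    congr 1
    refine lintegral_congr fun q => ?_
    rw [ofReal_coshInt_zero (mul_pos (by positivity) (Real.cosh_pos q)),
      ← lintegral_const_mul' _ _ ENNReal.ofReal_ne_top]
    refine lintegral_congr fun p => ?_
    rw [← ENNReal.ofReal_mul (by positivity), hG]
    ring_nf
  have h2 : ∀ q p : ℝ, ∫⁻ t in Ioi (0 : ℝ), G t q p =
      ENNReal.ofReal ((2 * k).factorial / (2 * z) ^ (2 * k + 1)) *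
        ENNReal.ofReal ((Real.cosh q)⁻¹ ^ (2 * k + 1)) *
        ENNReal.ofReal ((Real.cosh p)⁻¹ ^ (2 * k + 1)) := by
    intro q p
    have hq := Real.cosh_pos q
    have hp := Real.cosh_pos p
    rw [hG, lintegral_pow_mul_exp (by positivity), ← ENNReal.ofReal_mul (by positivity),
      ← ENNReal.ofReal_mul (by positivity)]
    congr 1
    rw [mul_pow (2 * z * _), mul_pow (2 * z), inv_pow, inv_pow]
    field_simp
  rw [setLIntegral_congr_fun measurableSet_Ioi h1, lintegral_const_mul' _ _ (by simp),
    lintegral_lintegral_swap (by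
      refine Measurable.aemeasurable ?_
      exact Measurable.lintegral_prod_right' (ν := volume.restrict (Ioi (0 : ℝ)))
        (f := fun p : (ℝ × ℝ) × ℝ => G p.1.1 p.1.2 p.2)
        (hGm.comp (by fun_prop : Measurable fun p : (ℝ × ℝ) × ℝ => (p.1.1, p.1.2, p.2))))]
  have h3 : ∀ q, ∫⁻ t in Ioi (0 : ℝ), ∫⁻ p in Ioi (0 : ℝ), G t q p =
      ENNReal.ofReal ((2 * k).factorial / (2 * z) ^ (2 * k + 1)) *
        ENNReal.ofReal ((Real.cosh q)⁻¹ ^ (2 * k + 1)) * ENNReal.ofReal (sinMoment k) := by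
    intro q
    rw [lintegral_lintegral_swap (f := fun t p => G t q p) (hGm.comp
        (by fun_prop : Measurable fun p : ℝ × ℝ => (p.1, q, p.2))).aemeasurable]
    simp only [h2]
    rw [lintegral_const_mul' _ _ (ENNReal.mul_ne_top ENNReal.ofReal_ne_top ENNReal.ofReal_ne_top),
      lintegral_inv_cosh_pow]
  simp only [h3]
  rw [lintegral_mul_const' _ _ ENNReal.ofReal_ne_top, lintegral_const_mul' _ _ ENNReal.ofReal_ne_top,
    lintegral_inv_cosh_pow, ← ENNReal.ofReal_mul (by positivity), ← ENNReal.ofReal_mul (by positivity),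
    ← ENNReal.ofReal_ofNat 2, ← ENNReal.ofReal_mul (by positivity)]
  congr 1; ring

/-! ### The exact formula for the truncation error -/

lemma lintegral_Ioi_eq_lintegral_exp {F : ℝ → ENNReal} (hF : Measurable F) :
    ∫⁻ t in Ioi (0 : ℝ), F t = ∫⁻ y in Ioi (0 : ℝ),
      (ENNReal.ofReal (Real.exp (-y)) * F (Real.exp (-y)) +
        ENNReal.ofReal (Real.exp y) * F (Real.exp y)) := by
  have h := lintegral_image_eq_lintegral_abs_deriv_mul (s := univ) MeasurableSet.univ
    (fun y _ => (Real.hasDerivAt_exp y).hasDerivWithinAt) Real.exp_injective.injOn F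
  rw [image_univ, Real.range_exp, setLIntegral_univ] at h
  simp only [Real.abs_exp] at h
  set H : ℝ → ENNReal := fun y => ENNReal.ofReal (Real.exp y) * F (Real.exp y) with hH
  have h1 : ∫⁻ t in Iic 0, H t = ∫⁻ t in Ioi 0, H (-t) := by
    have hcv := lintegral_image_eq_lintegral_abs_deriv_mul (s := Ioi (0 : ℝ)) measurableSet_Ioi
      (f := fun t => -t) (f' := fun _ => -1) (fun t _ => (hasDerivAt_neg t).hasDerivWithinAt)
      neg_injective.injOn H
    rw [setLIntegral_congr Iio_ae_eq_Iic.symm]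
    simpa using hcv
  rw [h, ← lintegral_add_compl H (measurableSet_Ioi (a := (0 : ℝ))), compl_Ioi, h1, add_comm,
    ← lintegral_add_left (by simp only [hH]; fun_prop)]

/-- The integrand of the exact formula for the truncation error. -/
noncomputable def errorIntegrand (z : ℝ) (n : ℕ) (y : ℝ) : ℝ :=
  (Real.exp (-((2 * n + 2) * y)) * coshInt 0 (z * Real.exp (-y)) ^ 2 -
    Real.exp ((2 * n + 2) * y) * coshInt 0 (z * Real.exp y) ^ 2) / (2 * Real.sinh y)

/-- The identity 1/(1 - t²) - ∑_{k≤n} t^{2k} = t^{2n+2}/(1 - t²), folded at t = e^{-y} and t = e^y,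
where dt/(1 - t²) becomes dy/(2 sinh y) up to sign. -/
lemma errorIntegrand_eq (z : ℝ) (n : ℕ) {y : ℝ} (hy : 0 < y) :
    errorIntegrand z n y =
      (coshInt 0 (z * Real.exp (-y)) ^ 2 - coshInt 0 (z * Real.exp y) ^ 2) / (2 * Real.sinh y) -
      ∑ k ∈ Finset.range (n + 1),
        (Real.exp (-y) * (Real.exp (-y) ^ (2 * k) * coshInt 0 (z * Real.exp (-y)) ^ 2) +
          Real.exp y * (Real.exp y ^ (2 * k) * coshInt 0 (z * Real.exp y) ^ 2)) := by
  have hs : 0 < Real.sinh y := Real.sinh_pos_iff.2 hy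
  have h2 : 2 * Real.sinh y = Real.exp y - Real.exp (-y) := by rw [Real.sinh_eq]; ring
  have hE : Real.exp y * Real.exp (-y) = 1 := by rw [← Real.exp_add]; simp
  induction n with
  | zero =>
    rw [errorIntegrand, Finset.sum_range_one, eq_sub_iff_add_eq, div_add' _ _ _ (by positivity)]
    congr 1
    have e1 : Real.exp (-((2 * (0 : ℕ) + 2) * y)) = Real.exp (-y) * Real.exp (-y) := by
      rw [← Real.exp_add]; congr 1; push_cast; ring
    have e2 : Real.exp ((2 * (0 : ℕ) + 2) * y) = Real.exp y * Real.exp y := by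
      rw [← Real.exp_add]; congr 1; push_cast; ring
    rw [e1, e2, h2]
    simp only [mul_zero, pow_zero]
    linear_combination (coshInt 0 (z * Real.exp (-y)) ^ 2 - coshInt 0 (z * Real.exp y) ^ 2) * hE
  | succ n ih =>
    rw [Finset.sum_range_succ, ← sub_sub, ← ih, errorIntegrand, errorIntegrand, eq_sub_iff_add_eq,
      div_add' _ _ _ (by positivity)]
    congr 1
    have e1 : Real.exp (-((2 * (n + 1 : ℕ) + 2) * y)) =
        Real.exp (-y) * Real.exp (-y) * Real.exp (-y) ^ (2 * (n + 1)) := by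
      rw [← Real.exp_nat_mul, ← Real.exp_add, ← Real.exp_add]; congr 1; push_cast; ring
    have e2 : Real.exp ((2 * (n + 1 : ℕ) + 2) * y) =
        Real.exp y * Real.exp y * Real.exp y ^ (2 * (n + 1)) := by
      rw [← Real.exp_nat_mul, ← Real.exp_add, ← Real.exp_add]; congr 1; push_cast; ring
    have e3 : Real.exp (-((2 * n + 2) * y)) = Real.exp (-y) ^ (2 * (n + 1)) := by
      rw [← Real.exp_nat_mul]; congr 1; push_cast; ring
    have e4 : Real.exp ((2 * n + 2) * y) = Real.exp y ^ (2 * (n + 1)) := by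
      rw [← Real.exp_nat_mul]; congr 1; push_cast; ring
    rw [e1, e2, e3, e4, h2]
    linear_combination (Real.exp (-y) ^ (2 * (n + 1)) * coshInt 0 (z * Real.exp (-y)) ^ 2 -
      Real.exp y ^ (2 * (n + 1)) * coshInt 0 (z * Real.exp y) ^ 2) * hE

/-- The exact formula for the truncation error. -/
lemma integral_errorIntegrand {x : ℕ} (hx : 1 ≤ x) :
    IntegrableOn (errorIntegrand (2 * x) (2 * x)) (Ioi 0) ∧
    ∫ y in Ioi (0 : ℝ), errorIntegrand (2 * x) (2 * x) y =
      Real.pi ^ 2 / 2 * truncationError x := by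
  have hx0 : (0 : ℝ) < x := by exact_mod_cast hx
  have hpi := Real.pi_pos
  have hK := measurable_coshInt 0
  obtain ⟨iR, eR⟩ := integrable_and_integral_eq_of_lintegral
    (μ := volume.restrict (Ioi (0 : ℝ)))
    (f := fun y => (coshInt 0 (2 * x * Real.exp (-y)) ^ 2 - coshInt 0 (2 * x * Real.exp y) ^ 2) /
      (2 * Real.sinh y)) (Measurable.aestronglyMeasurable (by fun_prop))
    ((ae_restrict_iff' measurableSet_Ioi).2 (Filter.Eventually.of_forall fun y hy => by
      have hy : 0 < y := hy
      have hs : 0 < Real.sinh y := Real.sinh_pos_iff.2 hy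
      have h1 : coshInt 0 (2 * x * Real.exp y) ≤ coshInt 0 (2 * x * Real.exp (-y)) :=
        coshInt_zero_anti (by positivity) (mul_le_mul_of_nonneg_left
          (Real.exp_le_exp.2 (by linarith)) (by positivity))
      have h2 : 0 < coshInt 0 (2 * x * Real.exp y) := coshInt_zero_pos (by positivity)
      simp only [Pi.zero_apply]
      refine div_nonneg (sub_nonneg.2 ?_) (by positivity)
      gcongr))
    (mul_nonneg (by positivity) (mul_pos (besselI_zero_pos x) (besselK0_pos hx0)).le)
    (lintegral_coshInt_sq_sub_eq hx0)
  -- The moment of order 2k, folded onto y > 0; its value a is π²/2 times the k-th term of the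
  -- truncated sum, prefactor 1/(4x) included.
  have hP : ∀ k : ℕ, _ := fun k => integrable_and_integral_eq_of_lintegral
    (μ := volume.restrict (Ioi (0 : ℝ)))
    (f := fun y => Real.exp (-y) * (Real.exp (-y) ^ (2 * k) *
        coshInt 0 (2 * x * Real.exp (-y)) ^ 2) +
      Real.exp y * (Real.exp y ^ (2 * k) * coshInt 0 (2 * x * Real.exp y) ^ 2))
    (a := 2 * ((2 * k).factorial / (2 * (2 * x)) ^ (2 * k + 1) * sinMoment k ^ 2))
    (Measurable.aestronglyMeasurable (by fun_prop))
    (Filter.Eventually.of_forall fun y => by simp only [Pi.zero_apply]; positivity)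
    (by positivity) (by
      rw [← lintegral_pow_mul_coshInt_sq (by positivity)]
      refine Eq.symm ((lintegral_Ioi_eq_lintegral_exp (by fun_prop)).trans ?_)
      refine lintegral_congr fun y => Eq.symm ?_
      rw [ENNReal.ofReal_add (by positivity) (by positivity), ENNReal.ofReal_mul (by positivity),
        ENNReal.ofReal_mul (Real.exp_pos y).le])
  have hsum := integrable_finsetSum (Finset.range (2 * x + 1)) fun k _ => (hP k).1
  have hcongr : EqOn (errorIntegrand (2 * x) (2 * x)) (fun y =>
      (coshInt 0 (2 * x * Real.exp (-y)) ^ 2 - coshInt 0 (2 * x * Real.exp y) ^ 2) /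
        (2 * Real.sinh y) - ∑ k ∈ Finset.range (2 * x + 1),
        (Real.exp (-y) * (Real.exp (-y) ^ (2 * k) * coshInt 0 (2 * x * Real.exp (-y)) ^ 2) +
          Real.exp y * (Real.exp y ^ (2 * k) * coshInt 0 (2 * x * Real.exp y) ^ 2))) (Ioi 0) :=
    fun y hy => errorIntegrand_eq _ _ hy
  refine ⟨(integrableOn_congr_fun hcongr measurableSet_Ioi).2 (iR.sub hsum), ?_⟩
  rw [setIntegral_congr_fun measurableSet_Ioi hcongr, integral_sub iR hsum, eR,
    integral_finsetSum _ fun k _ => (hP k).1, truncationError, truncatedSum, mul_sub]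
  congr 1
  rw [Finset.mul_sum, Finset.mul_sum]
  refine Finset.sum_congr rfl fun k _ => ?_
  rw [(hP k).2, sinMoment_eq, Nat.cast_add_choose, ← two_mul k]
  have e1 : (16 * (x : ℝ)) ^ (2 * k) = 16 ^ k * 16 ^ k * x ^ (2 * k) := by
    rw [mul_pow, two_mul k, pow_add 16]
  have e2 : (2 * (2 * (x : ℝ))) ^ (2 * k + 1) = 4 * x * (16 ^ k * x ^ (2 * k)) := by
    rw [show 2 * (2 * (x : ℝ)) = 4 * x by ring, pow_succ, mul_pow, pow_mul 4]; norm_num; ring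
  have e3 : ((4 : ℝ) ^ k) ^ 2 = 16 ^ k := by rw [← pow_mul, mul_comm, pow_mul]; norm_num
  rw [e1, e2]
  simp only [div_pow, mul_pow]
  rw [e3]
  field_simp

/-! ### Bounds for √z e^z K₀(z) and its square -/

/-- `√z e^z K₀(z)`, as the Gaussian integral `∫₀^∞ e^{-w²/2} (1 + w²/(4z))^{-1/2} dw`. -/
noncomputable def scaledK (z : ℝ) : ℝ :=
  ∫ w in Ioi (0 : ℝ), Real.exp (-w ^ 2 / 2) * (√(1 + w ^ 2 / (4 * z)))⁻¹

/-- Substitute w = 2√z sinh(t/2): then w²/2 = z(cosh t - 1), 1 + w²/(4z) = cosh²(t/2) and dw = √z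
cosh(t/2) dt. -/
lemma scaledK_eq {z : ℝ} (hz : 0 < z) : scaledK z = √z * Real.exp z * coshInt 0 z := by
  have hsz := Real.sqrt_pos.2 hz
  have hsq := Real.sq_sqrt hz.le
  have hd : ∀ t ∈ Ioi (0 : ℝ), HasDerivWithinAt (fun t => 2 * √z * Real.sinh (t / 2))
      (√z * Real.cosh (t / 2)) (Ioi 0) t := fun t _ => by
    have h := ((Real.hasDerivAt_sinh (t / 2)).comp t ((hasDerivAt_id t).div_const 2)).const_mul
      (2 * √z)
    refine (h.congr_deriv ?_).hasDerivWithinAt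
    ring
  have hinj : InjOn (fun t => 2 * √z * Real.sinh (t / 2)) (Ioi 0) := fun a _ b _ h => by
    have := Real.sinh_injective (mul_left_cancel₀ (by positivity) h)
    linarith
  have him : (fun t => 2 * √z * Real.sinh (t / 2)) '' Ioi 0 = Ioi 0 := by
    ext w
    constructor
    · rintro ⟨t, ht, rfl⟩
      have : 0 < Real.sinh (t / 2) := Real.sinh_pos_iff.2 (half_pos ht)
      exact mul_pos (by positivity) this
    · intro hw
      have hw : 0 < w := hw
      refine ⟨2 * Real.arsinh (w / (2 * √z)), ?_, ?_⟩
      · exact mul_pos two_pos (Real.arsinh_pos_iff.2 (by positivity))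
      · simp only
        rw [mul_div_cancel_left₀ _ two_ne_zero, Real.sinh_arsinh]
        field_simp
  have h := integral_image_eq_integral_abs_deriv_smul measurableSet_Ioi hd hinj
    (fun w => Real.exp (-w ^ 2 / 2) * (√(1 + w ^ 2 / (4 * z)))⁻¹)
  rw [him] at h
  rw [scaledK, h, coshInt, ← integral_const_mul]
  refine setIntegral_congr_fun measurableSet_Ioi fun t _ => ?_
  have hc := Real.cosh_pos (t / 2)
  have e1 : 1 + (2 * √z * Real.sinh (t / 2)) ^ 2 / (4 * z) = Real.cosh (t / 2) ^ 2 := by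
    rw [mul_pow, mul_pow, hsq, Real.cosh_sq]; field_simp; ring
  have e2 : -(2 * √z * Real.sinh (t / 2)) ^ 2 / 2 = z + -z * Real.cosh t := by
    have : Real.cosh t = 1 + 2 * Real.sinh (t / 2) ^ 2 := by
      conv_lhs => rw [show t = 2 * (t / 2) by ring, Real.cosh_two_mul, Real.cosh_sq]
      ring
    rw [this, mul_pow, mul_pow, hsq]; ring
  rw [e1, e2, Real.sqrt_sq hc.le, Real.exp_add, abs_of_pos (by positivity), smul_eq_mul]
  field_simp

lemma coshInt_zero_sq_eq {z : ℝ} (hz : 0 < z) :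
    coshInt 0 z ^ 2 = scaledK z ^ 2 / z * Real.exp (-(2 * z)) := by
  have hs := Real.sqrt_pos.2 hz
  rw [scaledK_eq hz, mul_pow, mul_pow, Real.sq_sqrt hz.le, ← Real.exp_nat_mul,
    show -(2 * z) = -((2 : ℕ) * z) by push_cast; ring, Real.exp_neg]
  field_simp

lemma integral_gaussian_half : ∫ w in Ioi (0 : ℝ), Real.exp (-w ^ 2 / 2) = √(Real.pi / 2) := by
  have h := integral_gaussian_Ioi (1 / 2)
  have e : ∀ w : ℝ, -w ^ 2 / 2 = -(1 / 2) * w ^ 2 := fun w => by ring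
  simp only [e, h]
  rw [show Real.pi / (1 / 2) = 2 ^ 2 * (Real.pi / 2) by ring, Real.sqrt_mul (by norm_num),
    Real.sqrt_sq (by norm_num)]
  ring

lemma integrableOn_gaussian_half : IntegrableOn (fun w : ℝ => Real.exp (-w ^ 2 / 2)) (Ioi 0) := by
  have h := (integrable_exp_neg_mul_sq (b := 1 / 2) (by norm_num)).integrableOn (s := Ioi 0)
  refine h.congr_fun (fun w _ => ?_) measurableSet_Ioi
  simp only; congr 1; ring

lemma integral_sq_mul_gaussian_half :
    IntegrableOn (fun w : ℝ => w ^ 2 * Real.exp (-w ^ 2 / 2)) (Ioi 0) ∧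
    ∫ w in Ioi (0 : ℝ), w ^ 2 * Real.exp (-w ^ 2 / 2) = √(Real.pi / 2) := by
  have i2 : IntegrableOn (fun w : ℝ => w ^ 2 * Real.exp (-w ^ 2 / 2)) (Ioi 0) := by
    have h := (integrable_rpow_mul_exp_neg_mul_sq (b := 1 / 2) (by norm_num) (s := 2)
      (by norm_num)).integrableOn (s := Ioi 0)
    refine h.congr_fun (fun w _ => ?_) measurableSet_Ioi
    simp only [Real.rpow_ofNat]; congr 2; ring
  refine ⟨i2, ?_⟩
  have h := integral_Ioi_of_hasDerivAt_of_tendsto' (a := 0) (m := 0)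
    (f := fun w => w * Real.exp (-w ^ 2 / 2))
    (f' := fun w => Real.exp (-w ^ 2 / 2) - w ^ 2 * Real.exp (-w ^ 2 / 2)) (fun w _ => ?_)
    (integrableOn_gaussian_half.sub i2) ?_
  · rw [integral_sub integrableOn_gaussian_half i2, integral_gaussian_half] at h
    simp only [zero_mul, sub_self] at h
    linarith
  · refine ((hasDerivAt_id w).mul ((((hasDerivAt_id w).pow 2).neg.div_const 2).exp)).congr_deriv ?_
    simp; ring
  · have h1 : Tendsto (fun u : ℝ => u * Real.exp (-u)) atTop (𝓝 0) := by
      simpa using Real.tendsto_pow_mul_exp_neg_atTop_nhds_zero 1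
    have h2 : Tendsto (fun w : ℝ => w ^ 2 / 2) atTop atTop :=
      (tendsto_pow_atTop two_ne_zero).atTop_div_const two_pos
    have h3 := (h1.comp h2).mul_const 2
    rw [zero_mul] at h3
    refine tendsto_of_tendsto_of_tendsto_of_le_of_le' tendsto_const_nhds h3 ?_ ?_
    · filter_upwards [eventually_ge_atTop 0] with w hw
      positivity
    · filter_upwards [eventually_ge_atTop 1] with w hw
      simp only [Function.comp]
      rw [show -w ^ 2 / 2 = -(w ^ 2 / 2) by ring]
      have h4 := Real.exp_pos (-(w ^ 2 / 2))
      have h5 : w ≤ w ^ 2 := by nlinarith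
      linarith [mul_le_mul_of_nonneg_right h5 h4.le]

/-- With s = √(1+q) and r = √(1+p), the difference is (p - q)/(sr(r + s)), and s, r ≥ 1. -/
lemma inv_sqrt_sub_le {p q : ℝ} (hq : 0 ≤ q) (hqp : q ≤ p) :
    (√(1 + q))⁻¹ - (√(1 + p))⁻¹ ≤ (p - q) / 2 := by
  have h1 : 1 ≤ √(1 + q) := Real.one_le_sqrt.2 (by linarith)
  have h2 : √(1 + q) ≤ √(1 + p) := Real.sqrt_le_sqrt (by linarith)
  have e1 := Real.sq_sqrt (show 0 ≤ 1 + q by linarith)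
  have e2 := Real.sq_sqrt (show 0 ≤ 1 + p by linarith)
  set s := √(1 + q)
  set r := √(1 + p)
  have hs : 0 < s := by linarith
  have hr : 0 < r := by linarith
  have hp : p - q = (r - s) * (r + s) := by nlinarith
  rw [hp, inv_sub_inv hs.ne' hr.ne', div_le_iff₀ (by positivity)]
  have h3 : 0 ≤ r - s := by linarith
  have h4 : 2 ≤ (r + s) * (s * r) := by nlinarith [mul_pos hs hr]
  nlinarith [mul_le_mul_of_nonneg_left h4 h3]

lemma integrableOn_scaledK {z : ℝ} (hz : 0 < z) :
    IntegrableOn (fun w => Real.exp (-w ^ 2 / 2) * (√(1 + w ^ 2 / (4 * z)))⁻¹) (Ioi 0) := by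
  refine Integrable.mono' integrableOn_gaussian_half
    (Measurable.aestronglyMeasurable (by fun_prop)) (Filter.Eventually.of_forall fun w => ?_)
  rw [Real.norm_of_nonneg (by positivity)]
  have h1 : 1 ≤ √(1 + w ^ 2 / (4 * z)) := Real.one_le_sqrt.2 (by
    have : 0 ≤ w ^ 2 / (4 * z) := by positivity
    linarith)
  exact mul_le_of_le_one_right (Real.exp_pos _).le (inv_le_one_of_one_le₀ h1)

lemma scaledK_nonneg (z : ℝ) : 0 ≤ scaledK z :=
  integral_nonneg fun w => by simp only [Pi.zero_apply]; positivity

lemma scaledK_le {z : ℝ} (hz : 0 < z) : scaledK z ≤ √(Real.pi / 2) := by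
  rw [← integral_gaussian_half]
  refine setIntegral_mono (integrableOn_scaledK hz) integrableOn_gaussian_half fun w => ?_
  have h1 : 1 ≤ √(1 + w ^ 2 / (4 * z)) := Real.one_le_sqrt.2 (by
    have : 0 ≤ w ^ 2 / (4 * z) := by positivity
    linarith)
  exact mul_le_of_le_one_right (Real.exp_pos _).le (inv_le_one_of_one_le₀ h1)

lemma le_scaledK {z : ℝ} (hz : 0 < z) : √(Real.pi / 2) * (1 - 1 / (8 * z)) ≤ scaledK z := by
  obtain ⟨i2, e2⟩ := integral_sq_mul_gaussian_half
  have h : √(Real.pi / 2) - scaledK z ≤ 1 / (8 * z) * √(Real.pi / 2) := by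
    conv_lhs => rw [← integral_gaussian_half, scaledK]
    conv_rhs => rw [← e2]
    rw [← integral_sub integrableOn_gaussian_half (integrableOn_scaledK hz), ← integral_const_mul]
    refine setIntegral_mono (integrableOn_gaussian_half.sub (integrableOn_scaledK hz))
      (i2.const_mul _) fun w => ?_
    have h1 := inv_sqrt_sub_le (p := w ^ 2 / (4 * z)) le_rfl (by positivity)
    simp only [add_zero, Real.sqrt_one, inv_one, sub_zero] at h1
    have h2 := mul_le_mul_of_nonneg_left h1 (Real.exp_pos (-w ^ 2 / 2)).le
    simp only
    calc _ = Real.exp (-w ^ 2 / 2) * (1 - (√(1 + w ^ 2 / (4 * z)))⁻¹) := by ring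
      _ ≤ _ := h2
      _ = _ := by field_simp; ring
  linarith

/-- Pointwise (w²/8)(1/a - 1/b) by `inv_sqrt_sub_le`, and the second Gaussian moment equals the
zeroth. A bound on the difference, not only on each value, is needed to compensate the pole 1/sinh
y. -/
lemma scaledK_sub_le {a b : ℝ} (ha : 0 < a) (hab : a ≤ b) :
    scaledK b - scaledK a ≤ √(Real.pi / 2) / 8 * (1 / a - 1 / b) := by
  have hb := ha.trans_le hab
  obtain ⟨i2, e2⟩ := integral_sq_mul_gaussian_half
  have e : √(Real.pi / 2) / 8 * (1 / a - 1 / b) = (1 / a - 1 / b) / 8 * √(Real.pi / 2) := by ring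
  rw [e, ← e2, scaledK, scaledK, ← integral_sub (integrableOn_scaledK hb) (integrableOn_scaledK ha),
    ← integral_const_mul]
  refine setIntegral_mono ((integrableOn_scaledK hb).sub (integrableOn_scaledK ha))
    (i2.const_mul _) fun w => ?_
  have h0 : w ^ 2 / (4 * b) ≤ w ^ 2 / (4 * a) := by gcongr
  have h1 := inv_sqrt_sub_le (q := w ^ 2 / (4 * b)) (p := w ^ 2 / (4 * a)) (by positivity) h0
  have h2 := mul_le_mul_of_nonneg_left h1 (Real.exp_pos (-w ^ 2 / 2)).le
  simp only
  calc _ = Real.exp (-w ^ 2 / 2) *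
        ((√(1 + w ^ 2 / (4 * b)))⁻¹ - (√(1 + w ^ 2 / (4 * a)))⁻¹) := by ring
    _ ≤ _ := h2
    _ = _ := by field_simp; ring

lemma scaledK_mono {a b : ℝ} (ha : 0 < a) (hab : a ≤ b) : scaledK a ≤ scaledK b := by
  have hb := ha.trans_le hab
  refine setIntegral_mono (integrableOn_scaledK ha) (integrableOn_scaledK hb) fun w => ?_
  have h0 : w ^ 2 / (4 * b) ≤ w ^ 2 / (4 * a) := by gcongr
  have h1 : 0 < √(1 + w ^ 2 / (4 * b)) := Real.sqrt_pos.2 (by positivity)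
  have h2 : √(1 + w ^ 2 / (4 * b)) ≤ √(1 + w ^ 2 / (4 * a)) := Real.sqrt_le_sqrt (by linarith)
  simp only
  gcongr

/-- The normalised square `(2z/π) e^{2z} K₀(z)²`. -/
noncomputable def normSqK (z : ℝ) : ℝ := 2 / Real.pi * scaledK z ^ 2

lemma coshInt_zero_sq_eq_normSqK {z : ℝ} (hz : 0 < z) :
    coshInt 0 z ^ 2 = Real.pi / (2 * z) * Real.exp (-(2 * z)) * normSqK z := by
  have := Real.pi_pos
  rw [coshInt_zero_sq_eq hz, normSqK]
  field_simp

lemma sq_sqrt_pi_div_two : √(Real.pi / 2) ^ 2 = Real.pi / 2 :=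
  Real.sq_sqrt (by positivity)

lemma normSqK_nonneg (z : ℝ) : 0 ≤ normSqK z := by
  have := Real.pi_pos
  unfold normSqK; positivity

lemma normSqK_le_one {z : ℝ} (hz : 0 < z) : normSqK z ≤ 1 := by
  have hpi := Real.pi_pos
  have h := pow_le_pow_left₀ (scaledK_nonneg z) (scaledK_le hz) 2
  rw [sq_sqrt_pi_div_two] at h
  rw [normSqK]
  calc 2 / Real.pi * scaledK z ^ 2 ≤ 2 / Real.pi * (Real.pi / 2) := by gcongr
    _ = 1 := by field_simp

lemma normSqK_sub_le {a b : ℝ} (ha : 0 < a) (hab : a ≤ b) :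
    normSqK b - normSqK a ≤ 1 / 4 * (1 / a - 1 / b) := by
  have hpi := Real.pi_pos
  have hb := ha.trans_le hab
  have h1 := scaledK_sub_le ha hab
  have h2 := scaledK_le ha
  have h3 := scaledK_le hb
  have h4 := scaledK_mono ha hab
  have h5 := scaledK_nonneg a
  set c := √(Real.pi / 2)
  have hc : c ^ 2 = Real.pi / 2 := sq_sqrt_pi_div_two
  have h6 : 0 ≤ 1 / a - 1 / b := sub_nonneg.2 (one_div_le_one_div_of_le ha hab)
  have h7 : (scaledK b - scaledK a) * (scaledK b + scaledK a) ≤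
      c / 8 * (1 / a - 1 / b) * (2 * c) :=
    mul_le_mul h1 (by linarith) (by linarith) (by
      have : 0 ≤ c := Real.sqrt_nonneg _
      positivity)
  rw [normSqK, normSqK]
  calc 2 / Real.pi * scaledK b ^ 2 - 2 / Real.pi * scaledK a ^ 2
      = 2 / Real.pi * ((scaledK b - scaledK a) * (scaledK b + scaledK a)) := by ring
    _ ≤ 2 / Real.pi * (c / 8 * (1 / a - 1 / b) * (2 * c)) := by gcongr
    _ = 2 / Real.pi * (c ^ 2 / 4 * (1 / a - 1 / b)) := by ring
    _ = 1 / 4 * (1 / a - 1 / b) := by rw [hc]; field_simp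

lemma normSqK_mono {a b : ℝ} (ha : 0 < a) (hab : a ≤ b) : normSqK a ≤ normSqK b := by
  have hpi := Real.pi_pos
  have h4 := scaledK_mono ha hab
  have h5 := scaledK_nonneg a
  rw [normSqK, normSqK]
  gcongr

lemma le_normSqK {z : ℝ} (hz : 0 < z) : 1 - 1 / (4 * z) ≤ normSqK z := by
  have hpi := Real.pi_pos
  have h1 := le_scaledK hz
  have h2 := scaledK_nonneg z
  have hc := sq_sqrt_pi_div_two
  have hc0 : 0 ≤ √(Real.pi / 2) := Real.sqrt_nonneg _
  set c := √(Real.pi / 2)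
  have h3 : c ^ 2 * (1 - 1 / (4 * z)) ≤ scaledK z ^ 2 := by
    have e : 1 / (4 * z) = 2 * (1 / (8 * z)) := by field_simp; norm_num
    rw [e]
    set u := 1 / (8 * z)
    -- The lower bound c(1 - u) may be squared only when it is nonnegative; for u ≥ 1 the claimed
    -- bound is itself nonpositive.
    rcases le_total u 1 with hu | hu
    · have h4 : 0 ≤ c * (1 - u) := mul_nonneg hc0 (by linarith)
      have h5 := pow_le_pow_left₀ h4 h1 2
      nlinarith [sq_nonneg (c * u)]
    · nlinarith [sq_nonneg c, sq_nonneg (scaledK z)]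
  rw [normSqK]
  calc 1 - 1 / (4 * z) = 2 / Real.pi * (c ^ 2 * (1 - 1 / (4 * z))) := by rw [hc]; field_simp
    _ ≤ _ := by gcongr

/-! ### Elementary inequalities for sinh and cosh -/

lemma sinh_le_mul_cosh {u : ℝ} (hu : 0 ≤ u) : Real.sinh u ≤ u * Real.cosh u := by
  have hd : ∀ v : ℝ, HasDerivAt (fun v => v * Real.cosh v - Real.sinh v) (v * Real.sinh v) v :=
    fun v => (((hasDerivAt_id v).mul (Real.hasDerivAt_cosh v)).sub
      (Real.hasDerivAt_sinh v)).congr_deriv (by simp)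
  have hm : MonotoneOn (fun v => v * Real.cosh v - Real.sinh v) (Ici 0) := by
    refine monotoneOn_of_hasDerivWithinAt_nonneg (convex_Ici 0)
      (fun v _ => (hd v).continuousAt.continuousWithinAt)
      (fun v _ => (hd v).hasDerivWithinAt) fun v hv => ?_
    rw [interior_Ici] at hv
    exact mul_nonneg (le_of_lt hv) (Real.sinh_nonneg_iff.2 (le_of_lt hv))
  have := hm (mem_Ici.2 le_rfl) (mem_Ici.2 hu) hu
  simp only [zero_mul, Real.sinh_zero, sub_zero] at this
  linarith

lemma cosh_sub_one (u : ℝ) : Real.cosh u - 1 = 2 * Real.sinh (u / 2) ^ 2 := by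
  conv_lhs => rw [show u = 2 * (u / 2) by ring, Real.cosh_two_mul, Real.cosh_sq]
  ring

lemma sinh_sub_self_le {u : ℝ} (hu : 0 ≤ u) :
    Real.sinh u - u ≤ u ^ 3 / 6 * Real.cosh u := by
  have hd : ∀ v : ℝ, HasDerivAt (fun v => v ^ 3 / 6 * Real.cosh v - (Real.sinh v - v))
      (v ^ 2 / 2 * Real.cosh v + v ^ 3 / 6 * Real.sinh v - (Real.cosh v - 1)) v := fun v => by
    refine ((((hasDerivAt_pow 3 v).div_const 6).mul (Real.hasDerivAt_cosh v)).sub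
      ((Real.hasDerivAt_sinh v).sub (hasDerivAt_id v))).congr_deriv ?_
    push_cast; ring
  have hm : MonotoneOn (fun v => v ^ 3 / 6 * Real.cosh v - (Real.sinh v - v)) (Ici 0) := by
    refine monotoneOn_of_hasDerivWithinAt_nonneg (convex_Ici 0)
      (fun v _ => (hd v).continuousAt.continuousWithinAt)
      (fun v _ => (hd v).hasDerivWithinAt) fun v hv => ?_
    rw [interior_Ici] at hv
    have hv : 0 < v := hv
    have h1 := sinh_le_mul_cosh (half_pos hv).le
    have h0 := Real.sinh_nonneg_iff.2 (half_pos hv).le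
    have h2 := pow_le_pow_left₀ h0 h1 2
    have h3 := cosh_sub_one v
    have h4 : Real.cosh (v / 2) ^ 2 ≤ Real.cosh v := by
      have := Real.one_le_cosh v
      rw [Real.cosh_sq]; linarith
    have h5 : 0 ≤ v ^ 3 / 6 * Real.sinh v :=
      mul_nonneg (by positivity) (Real.sinh_nonneg_iff.2 hv.le)
    have h6 := mul_le_mul_of_nonneg_left h4 (show 0 ≤ v ^ 2 / 2 by positivity)
    rw [mul_pow] at h2
    linarith
  have := hm (mem_Ici.2 le_rfl) (mem_Ici.2 hu) hu
  simp only [Real.sinh_zero, sub_zero] at this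
  norm_num at this
  linarith

lemma abs_sinh_sub_self_le (a : ℝ) :
    |Real.sinh a - a| ≤ |a| ^ 3 / 6 * Real.cosh a := by
  have key : |Real.sinh a - a| = Real.sinh |a| - |a| := by
    rcases le_total 0 a with h | h
    · rw [abs_of_nonneg h, abs_of_nonneg (sub_nonneg.2 (Real.self_le_sinh_iff.2 h))]
    · rw [abs_of_nonpos h, Real.sinh_neg,
        abs_of_nonpos (sub_nonpos.2 (Real.sinh_le_self_iff.2 h))]
      ring
  rw [key, ← Real.cosh_abs a]
  exact sinh_sub_self_le (abs_nonneg a)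

lemma half_sq_le_cosh_sub_one (y : ℝ) : y ^ 2 / 2 ≤ Real.cosh y - 1 := by
  rw [cosh_sub_one]
  have h : |y / 2| ≤ |Real.sinh (y / 2)| := by
    rw [Real.abs_sinh]; exact Real.self_le_sinh_iff.2 (abs_nonneg _)
  have := sq_le_sq.2 h
  nlinarith

lemma cosh_le_of_le_one {y : ℝ} (h0 : 0 ≤ y) (h1 : y ≤ 1) :
    Real.cosh y - 1 - y ^ 2 / 2 ≤ y ^ 4 / 16 := by
  have e1 := Real.exp_bound (x := y) (n := 4) (by rwa [abs_of_nonneg h0]) (by norm_num)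
  have e2 := Real.exp_bound (x := -y) (n := 4) (by rwa [abs_neg, abs_of_nonneg h0]) (by norm_num)
  rw [abs_neg] at e2
  rw [abs_of_nonneg h0] at e1 e2
  have f1 := (abs_le.1 e1).2
  have f2 := (abs_le.1 e2).2
  simp only [Finset.sum_range_succ, Finset.sum_range_zero, Nat.factorial] at f1 f2
  norm_num at f1 f2
  rw [Real.cosh_eq]
  have : 0 ≤ y ^ 4 := by positivity
  nlinarith

/-- The constant 1/100 is the remainder factor 6/(5! · 5) of `Real.exp_bound` with five terms,
averaged over y and -y. -/
lemma abs_sinh_sub_cubic_le {y : ℝ} (h0 : 0 ≤ y) (h1 : y ≤ 1) :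
    |Real.sinh y - y - y ^ 3 / 6| ≤ y ^ 5 / 100 := by
  have e1 := Real.exp_bound (x := y) (n := 5) (by rwa [abs_of_nonneg h0]) (by norm_num)
  have e2 := Real.exp_bound (x := -y) (n := 5) (by rwa [abs_neg, abs_of_nonneg h0]) (by norm_num)
  rw [abs_neg] at e2
  rw [abs_of_nonneg h0] at e1 e2
  obtain ⟨f1, f1'⟩ := abs_le.1 e1
  obtain ⟨f2, f2'⟩ := abs_le.1 e2
  simp only [Finset.sum_range_succ, Finset.sum_range_zero, Nat.factorial] at f1 f2 f1' f2'
  norm_num at f1 f2 f1' f2'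
  rw [Real.sinh_eq, abs_le]
  constructor <;> nlinarith

/-! ### The integrand near and away from the saddle point -/

/-- The factor `exp (y - N (e^y - 1 - y))` of the error integrand. -/
noncomputable def saddleWeight (N y : ℝ) : ℝ := Real.exp (y - N * (Real.exp y - 1 - y))

/-- The leading part of the error integrand near the saddle point. -/
noncomputable def gaussianModel (N y : ℝ) : ℝ :=
  Real.exp (-(N * y ^ 2 / 2)) * (2 - N * y ^ 2 / 3)

lemma saddleWeight_pos (N y : ℝ) : 0 < saddleWeight N y := Real.exp_pos _

lemma saddleWeight_sub (N y : ℝ) : saddleWeight N y - saddleWeight N (-y) =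
    2 * Real.exp (-(N * (Real.cosh y - 1))) * Real.sinh (y - N * (Real.sinh y - y)) := by
  rw [Real.sinh_eq (y - _), saddleWeight, saddleWeight,
    show y - N * (Real.exp y - 1 - y) =
      -(N * (Real.cosh y - 1)) + (y - N * (Real.sinh y - y)) by
        rw [← Real.cosh_add_sinh]; ring,
    show -y - N * (Real.exp (-y) - 1 - -y) =
      -(N * (Real.cosh y - 1)) + -(y - N * (Real.sinh y - y)) by
        rw [← Real.cosh_sub_sinh]; ring,
    Real.exp_add, Real.exp_add]
  ring

lemma saddleWeight_neg_le {N y : ℝ} (hN : 0 ≤ N) : saddleWeight N (-y) ≤ Real.exp (-y) := by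
  refine Real.exp_le_exp.2 ?_
  have := mul_nonneg hN (show 0 ≤ Real.exp (-y) - 1 - -y by linarith [Real.add_one_le_exp (-y)])
  linarith

lemma abs_gaussianModel_le {N y : ℝ} (hN : 0 ≤ N) :
    |gaussianModel N y| ≤ 2 * Real.exp (-(N * y ^ 2 / 3)) := by
  have hr : 0 ≤ N * y ^ 2 := by positivity
  rw [gaussianModel, abs_mul, abs_of_pos (Real.exp_pos _),
    show -(N * y ^ 2 / 3) = -(N * y ^ 2 / 2) + N * y ^ 2 / 6 by ring, Real.exp_add]
  have h1 : |2 - N * y ^ 2 / 3| ≤ 2 * Real.exp (N * y ^ 2 / 6) := by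
    have := Real.add_one_le_exp (N * y ^ 2 / 6)
    rw [abs_le]; constructor <;> linarith
  calc _ ≤ Real.exp (-(N * y ^ 2 / 2)) * (2 * Real.exp (N * y ^ 2 / 6)) :=
        mul_le_mul_of_nonneg_left h1 (Real.exp_pos _).le
    _ = _ := by ring

/-- Away from the saddle, e^y - 1 - y ≥ y²/2 + y³/6 ≥ 2y/3 and e^{-y} - 1 + y ≥ y/3, so both weights
are at most e^{-Ny/3}, while sinh y ≥ 1. -/
lemma abs_saddleWeight_sub_le_of_one_le {N y : ℝ} (hN : 4 ≤ N) (hy : 1 ≤ y) :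
    |(saddleWeight N y - saddleWeight N (-y)) / Real.sinh y| ≤ Real.exp (-(N * y / 3)) := by
  have hs : 1 ≤ Real.sinh y := hy.trans (Real.self_le_sinh_iff.2 (by linarith))
  have h1 : saddleWeight N y ≤ Real.exp (-(N * y / 3)) := by
    refine Real.exp_le_exp.2 ?_
    have he := Real.sum_le_exp_of_nonneg (x := y) (by linarith) 4
    simp only [Finset.sum_range_succ, Finset.sum_range_zero, Nat.factorial] at he
    norm_num at he
    have h2 : 2 / 3 * y ≤ Real.exp y - 1 - y := by
      nlinarith [mul_nonneg (sub_nonneg.2 hy) (sub_nonneg.2 hy)]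
    have h3 := mul_le_mul_of_nonneg_left h2 (show 0 ≤ N by linarith)
    nlinarith
  have h2 : saddleWeight N (-y) ≤ Real.exp (-(N * y / 3)) := by
    refine Real.exp_le_exp.2 ?_
    have he : y / 3 ≤ Real.exp (-y) - 1 - -y := by
      rcases le_total y 2 with h | h
      · have e1 := Real.add_one_le_exp (1 - y)
        have e2 : Real.exp (-y) = Real.exp (1 - y) / Real.exp 1 := by
          rw [← Real.exp_sub]; congr 1; ring
        -- Since e^{1-y} ≥ 2 - y and e < 3.
        have e3 : (2 - y) / 3 ≤ Real.exp (-y) := by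
          rw [e2]
          exact div_le_div₀ (Real.exp_pos _).le (by linarith) (Real.exp_pos _)
            (by linarith [Real.exp_one_lt_d9])
        linarith
      · linarith [Real.exp_pos (-y)]
    have h3 := mul_le_mul_of_nonneg_left he (show 0 ≤ N by linarith)
    linarith
  have h3 := saddleWeight_pos N y
  have h4 := saddleWeight_pos N (-y)
  rw [abs_div, abs_of_pos (a := Real.sinh y) (by linarith)]
  refine (div_le_self (abs_nonneg _) hs).trans ?_
  rw [abs_le]; constructor <;> linarith

/-- The cube of the tangent line inequality for the exponential, with equality at s = 2. -/
lemma one_add_cube_le (s : ℝ) (hs : 0 ≤ s) : (1 + s) ^ 3 ≤ 27 * Real.exp (s - 2) := by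
  have h := Real.add_one_le_exp ((s - 2) / 3)
  have h2 : (1 + s) / 3 ≤ Real.exp ((s - 2) / 3) := by linarith
  have h3 := pow_le_pow_left₀ (by positivity) h2 3
  rw [← Real.exp_nat_mul] at h3
  rw [show ((3 : ℕ) : ℝ) * ((s - 2) / 3) = s - 2 by push_cast; ring] at h3
  have : ((1 + s) / 3) ^ 3 = (1 + s) ^ 3 / 27 := by ring
  linarith

/-- By `saddleWeight_sub` the quotient is 2G sinh(a)/sinh y, with G = exp(-N(cosh y - 1)) and a = y
- N(sinh y - y). Three replacements lead to the model: sinh a by a, a/sinh y by 1 - p/3, and G by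
e^{-p}, where p = Ny²/2. Each costs a factor y², times powers of p and exponentials, all absorbed by
weakening e^{-p} to e^{-p/5}. -/
lemma abs_saddleWeight_sub_sub_gaussianModel_le_of_le_one {N y : ℝ} (hN : 0 ≤ N) (hy : 0 < y)
    (hy1 : y ≤ 1) :
    |(saddleWeight N y - saddleWeight N (-y)) / Real.sinh y - gaussianModel N y| ≤
      5 * y * Real.exp (-(N * y ^ 2 / 10)) := by
  obtain ⟨p, hp⟩ : ∃ p, p = N * y ^ 2 / 2 := ⟨_, rfl⟩
  have hp0 : 0 ≤ p := by rw [hp]; positivity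
  obtain ⟨D, hD⟩ : ∃ D, D = Real.sinh y - y := ⟨_, rfl⟩
  obtain ⟨a, ha⟩ : ∃ a, a = y - N * D := ⟨_, rfl⟩
  obtain ⟨G, hG⟩ : ∃ G, G = Real.exp (-(N * (Real.cosh y - 1))) := ⟨_, rfl⟩
  have hG0 : 0 < G := hG ▸ Real.exp_pos _
  have hR := abs_sinh_sub_cubic_le hy.le hy1
  rw [← hD] at hR
  have hD0 : 0 ≤ D := by rw [hD]; linarith [Real.self_le_sinh_iff.2 hy.le]
  have hy3 : 0 < y ^ 3 := by positivity
  have hD1 : D ≤ y ^ 3 / 5 := by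
    have h5 : y ^ 5 ≤ y ^ 3 := pow_le_pow_of_le_one hy.le hy1 (by norm_num)
    linarith [(abs_le.1 hR).2]
  have hsy : y ≤ Real.sinh y := Real.self_le_sinh_iff.2 hy.le
  have hs0 : 0 < Real.sinh y := hy.trans_le hsy
  have hGp : G ≤ Real.exp (-p) := by
    rw [hG, hp]
    refine Real.exp_le_exp.2 ?_
    linarith [mul_le_mul_of_nonneg_left (half_sq_le_cosh_sub_one y) hN]
  have hGp' : Real.exp (-p) - G ≤ Real.exp (-p) * (p * y ^ 2 / 8) := by
    have h1 := mul_le_mul_of_nonneg_left (cosh_le_of_le_one hy.le hy1) hN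
    have h2 := Real.add_one_le_exp (-(N * (Real.cosh y - 1 - y ^ 2 / 2)))
    have h3 : G = Real.exp (-p) * Real.exp (-(N * (Real.cosh y - 1 - y ^ 2 / 2))) := by
      rw [hG, hp, ← Real.exp_add]; congr 1; ring
    rw [h3, ← mul_one_sub]
    refine mul_le_mul_of_nonneg_left ?_ (Real.exp_pos _).le
    have h4 : p * y ^ 2 / 8 = N * (y ^ 4 / 16) := by rw [hp]; ring
    linarith
  have hNy : N * y ^ 3 = 2 * p * y := by rw [hp]; ring
  have ha1 : |a| ≤ y * (1 + 2 * p / 5) := by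
    have h1 := mul_le_mul_of_nonneg_left hD1 hN
    have h2 := mul_nonneg hN hD0
    have h3 := mul_nonneg hp0 hy.le
    rw [ha, abs_le]; constructor <;> linarith
  have hcosh : Real.cosh a ≤ Real.exp (1 + 2 * p / 5) := by
    rw [← Real.cosh_abs a, Real.cosh_eq]
    have h1 : |a| ≤ 1 + 2 * p / 5 :=
      ha1.trans (mul_le_of_le_one_left (by positivity) hy1)
    have h2 := Real.exp_le_exp.2 h1
    have h3 : Real.exp (-|a|) ≤ Real.exp |a| := Real.exp_le_exp.2 (by linarith [abs_nonneg a])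
    linarith
  have hyy : y ^ 2 ≤ y := by nlinarith
  have hE5 := Real.exp_pos (-(p / 5))
  -- The cube (1 + 2p/5)³ and the bound e^{1+2p/5} for cosh a each use up e^{2p/5}, leaving
  -- e^{-p/5}. The constant is 27/3 · e^{-1} < 4.
  have T1 : |2 * G * (Real.sinh a - a) / Real.sinh y| ≤ 4 * y * Real.exp (-(p / 5)) := by
    rw [abs_div, abs_mul, abs_of_pos hs0, abs_of_pos (by positivity : 0 < 2 * G)]
    have h1 : |Real.sinh a - a| ≤
        (y * (1 + 2 * p / 5)) ^ 3 / 6 * Real.exp (1 + 2 * p / 5) := by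
      refine (abs_sinh_sub_self_le a).trans ?_
      have := Real.cosh_pos a
      gcongr
    have h2 := one_add_cube_le (2 * p / 5) (by positivity)
    calc 2 * G * |Real.sinh a - a| / Real.sinh y
        ≤ 2 * Real.exp (-p) *
          ((y * (1 + 2 * p / 5)) ^ 3 / 6 * Real.exp (1 + 2 * p / 5)) / y := by gcongr
      _ = y ^ 2 / 3 * Real.exp (-p) * Real.exp (1 + 2 * p / 5) * (1 + 2 * p / 5) ^ 3 := by
          field_simp; ring
      _ ≤ y ^ 2 / 3 * Real.exp (-p) * Real.exp (1 + 2 * p / 5) *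
          (27 * Real.exp (2 * p / 5 - 2)) := by gcongr
      _ = 9 * Real.exp (-1) * y ^ 2 * Real.exp (-(p / 5)) := by
          have : Real.exp (-p) * Real.exp (1 + 2 * p / 5) * Real.exp (2 * p / 5 - 2) =
              Real.exp (-1) * Real.exp (-(p / 5)) := by
            rw [← Real.exp_add, ← Real.exp_add, ← Real.exp_add]; congr 1; ring
          linear_combination (9 * y ^ 2) * this
      _ ≤ 4 * y * Real.exp (-(p / 5)) := by
          have : 9 * Real.exp (-1) ≤ 4 := by
            rw [Real.exp_neg, ← div_eq_mul_inv, div_le_iff₀ (Real.exp_pos _)]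
            linarith [Real.exp_one_gt_d9]
          gcongr
  -- Here Ny³/6 = py/3, so the terms of order y cancel in the numerator and only order y³ is left.
  have T2 : |2 * G * (a / Real.sinh y - (1 - p / 3))| ≤
      y ^ 2 * Real.exp (-p) * (2 / 5 + p / 5) := by
    have e : a / Real.sinh y - (1 - p / 3) =
        (-D - N * (D - y ^ 3 / 6) + p / 3 * D) / Real.sinh y := by
      field_simp
      rw [ha]
      have : Real.sinh y = D + y := by rw [hD]; ring
      rw [this]
      linear_combination (-3) * hNy
    rw [abs_mul, abs_of_pos (by positivity : 0 < 2 * G), e, abs_div, abs_of_pos hs0]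
    have h1 : |-D - N * (D - y ^ 3 / 6) + p / 3 * D| ≤ y ^ 3 * (1 / 5 + p / 10) := by
      have b1 : |N * (D - y ^ 3 / 6)| ≤ p * y ^ 3 / 50 := by
        rw [abs_mul, abs_of_nonneg hN]
        calc N * |D - y ^ 3 / 6| ≤ N * (y ^ 5 / 100) := mul_le_mul_of_nonneg_left hR hN
          _ = p * y ^ 3 / 50 := by rw [hp]; ring
      obtain ⟨b2, b3⟩ := abs_le.1 b1
      have b4 := mul_le_mul_of_nonneg_left hD1 hp0
      have b5 := mul_nonneg hp0 hD0
      have b6 := mul_nonneg hp0 hy3.le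
      rw [abs_le]; constructor <;> linarith
    calc 2 * G * (|-D - N * (D - y ^ 3 / 6) + p / 3 * D| / Real.sinh y)
        ≤ 2 * Real.exp (-p) * (y ^ 3 * (1 / 5 + p / 10) / y) := by gcongr
      _ = _ := by field_simp; ring
  have T3 : |2 * (G - Real.exp (-p)) * (1 - p / 3)| ≤
      y ^ 2 * Real.exp (-p) * (p / 4 + p ^ 2 / 12) := by
    have h1 : |1 - p / 3| ≤ 1 + p / 3 := by rw [abs_le]; constructor <;> linarith
    rw [abs_mul, abs_mul, abs_two, abs_sub_comm, abs_of_nonneg (sub_nonneg.2 hGp)]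
    calc 2 * (Real.exp (-p) - G) * |1 - p / 3|
        ≤ 2 * (Real.exp (-p) * (p * y ^ 2 / 8)) * (1 + p / 3) := by gcongr
      _ = _ := by ring
  have T23 : y ^ 2 * Real.exp (-p) * (2 / 5 + p / 5) +
      y ^ 2 * Real.exp (-p) * (p / 4 + p ^ 2 / 12) ≤ y * Real.exp (-(p / 5)) := by
    have h1 := Real.quadratic_le_exp_of_nonneg (show 0 ≤ 4 * p / 5 by positivity)
    have h2 : 2 / 5 + p / 5 + (p / 4 + p ^ 2 / 12) ≤ Real.exp (4 * p / 5) := by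
      nlinarith [sq_nonneg p]
    rw [← mul_add]
    calc _ ≤ y * Real.exp (-p) * Real.exp (4 * p / 5) := by gcongr
      _ = _ := by rw [mul_assoc, ← Real.exp_add]; congr 2; ring
  have hsplit : (saddleWeight N y - saddleWeight N (-y)) / Real.sinh y - gaussianModel N y =
      2 * G * (Real.sinh a - a) / Real.sinh y + 2 * G * (a / Real.sinh y - (1 - p / 3)) +
        2 * (G - Real.exp (-p)) * (1 - p / 3) := by
    rw [saddleWeight_sub, gaussianModel, ← hD, ← ha, ← hG, ← hp,
      show N * y ^ 2 / 3 = 2 * p / 3 by rw [hp]; ring]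
    ring
  rw [hsplit, show N * y ^ 2 / 10 = p / 5 by rw [hp]; ring]
  have := abs_add_three (2 * G * (Real.sinh a - a) / Real.sinh y)
    (2 * G * (a / Real.sinh y - (1 - p / 3))) (2 * (G - Real.exp (-p)) * (1 - p / 3))
  linarith

lemma abs_saddleWeight_sub_sub_gaussianModel_le {N y : ℝ} (hN : 4 ≤ N) (hy : 0 < y) :
    |(saddleWeight N y - saddleWeight N (-y)) / Real.sinh y - gaussianModel N y| ≤
      Real.exp (-(N * y / 3)) + 5 * y * Real.exp (-(N * y ^ 2 / 10)) := by
  have hN0 : 0 ≤ N := by linarith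
  rcases le_total y 1 with h | h
  · have := abs_saddleWeight_sub_sub_gaussianModel_le_of_le_one hN0 hy h
    linarith [Real.exp_pos (-(N * y / 3))]
  · refine (abs_sub _ _).trans (add_le_add (abs_saddleWeight_sub_le_of_one_le hN h) ?_)
    refine (abs_gaussianModel_le hN0).trans ?_
    have : 0 ≤ N * y ^ 2 := by positivity
    gcongr
    · linarith
    · linarith

/-- The error integrand, up to a constant factor. -/
noncomputable def scaledIntegrand (N y : ℝ) : ℝ :=
  (saddleWeight N y * normSqK (N / 2 * Real.exp y) -
    saddleWeight N (-y) * normSqK (N / 2 * Real.exp (-y))) / Real.sinh y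

/-- The factor 1/(2z) in k(z)² lowers the exponent 4x + 2 to 4x + 1, and (4x + 1)u - 4x e^u = -4x +
u - 4x(e^u - 1 - u). The saddle thus sits at u = 0 precisely because the truncation index is 2x. -/
lemma errorIntegrand_eq_scaledIntegrand {x : ℕ} (hx : 1 ≤ x) {y : ℝ} (hy : 0 < y) :
    errorIntegrand (2 * x) (2 * x) y =
      -(Real.pi / (2 * (4 * x)) * Real.exp (-(4 * x : ℝ))) * scaledIntegrand (4 * x) y := by
  have hx0 : (0 : ℝ) < x := by exact_mod_cast hx
  have hs := Real.sinh_pos_iff.2 hy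
  have key : ∀ u : ℝ, Real.exp ((2 * (2 * x) + 2) * u) * coshInt 0 (2 * x * Real.exp u) ^ 2 =
      Real.pi / (4 * x) * Real.exp (-(4 * x : ℝ)) *
        (saddleWeight (4 * x) u * normSqK (2 * x * Real.exp u)) := by
    intro u
    rw [coshInt_zero_sq_eq_normSqK (by positivity), saddleWeight]
    have e : Real.exp ((2 * (2 * x) + 2) * u) * Real.exp (-(2 * (2 * x * Real.exp u))) =
        Real.exp (-(4 * x : ℝ)) * Real.exp (u - 4 * x * (Real.exp u - 1 - u)) * Real.exp u := by
      rw [← Real.exp_add, ← Real.exp_add, ← Real.exp_add]; congr 1; ring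
    have hu := Real.exp_pos u
    rw [show Real.exp ((2 * (2 * x) + 2) * u) * (Real.pi / (2 * (2 * x * Real.exp u)) *
        Real.exp (-(2 * (2 * x * Real.exp u))) * normSqK (2 * x * Real.exp u)) =
      Real.exp ((2 * (2 * x) + 2) * u) * Real.exp (-(2 * (2 * x * Real.exp u))) *
        (Real.pi / (2 * (2 * x * Real.exp u)) * normSqK (2 * x * Real.exp u)) by ring, e]
    field_simp
    norm_num
  have k1 := key y
  have k2 := key (-y)
  rw [show (2 * (2 * (x : ℝ)) + 2) * -y = -((2 * (2 * x) + 2) * y) by ring] at k2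
  rw [errorIntegrand, scaledIntegrand]
  push_cast
  rw [k1, k2, show (4 * x / 2 : ℝ) = 2 * x by ring]
  field_simp
  ring

lemma abs_scaledIntegrand_sub_gaussianModel_le {N y : ℝ} (hN : 4 ≤ N) (hy : 0 < y) :
    |scaledIntegrand N y - gaussianModel N y| ≤
      2 / N * Real.exp (-y) +
        (Real.exp (-(N * y / 3)) + 5 * (y * Real.exp (-(N * y ^ 2 / 10)))) := by
  have hN0 : 0 < N := by linarith
  have hs := Real.sinh_pos_iff.2 hy
  have hp := Real.exp_pos y
  have hm := Real.exp_pos (-y)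
  have ha : 0 < N / 2 * Real.exp (-y) := by positivity
  have hb : 0 < N / 2 * Real.exp y := by positivity
  have hab : N / 2 * Real.exp (-y) ≤ N / 2 * Real.exp y := by
    gcongr; linarith
  have h1 := normSqK_sub_le ha hab
  have h1' := normSqK_mono ha hab
  have h2 := normSqK_le_one hb
  have h3 := le_normSqK hb
  have h4 := normSqK_nonneg (N / 2 * Real.exp y)
  set P := normSqK (N / 2 * Real.exp y)
  set M := normSqK (N / 2 * Real.exp (-y))
  -- Each piece stays bounded at y = 0: P - M ≤ sinh y / N cancels the pole, the middle bracket is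
  -- the previous estimate, and 1 - P ≤ e^{-y}/(2N).
  have e : scaledIntegrand N y - gaussianModel N y =
      saddleWeight N (-y) * ((P - M) / Real.sinh y) +
      ((saddleWeight N y - saddleWeight N (-y)) / Real.sinh y - gaussianModel N y) * P +
      -(gaussianModel N y * (1 - P)) := by
    change (saddleWeight N y * P - saddleWeight N (-y) * M) / Real.sinh y - _ = _
    field_simp; ring
  have i1 : 1 / (4 * (N / 2 * Real.exp y)) = Real.exp (-y) / (2 * N) := by
    rw [Real.exp_neg]; field_simp; ring
  have i2 : 1 / 4 * (1 / (N / 2 * Real.exp (-y)) - 1 / (N / 2 * Real.exp y)) =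
      Real.sinh y / N := by
    rw [Real.sinh_eq, Real.exp_neg]; field_simp; ring
  rw [i1] at h3
  rw [i2] at h1
  have t1 : |saddleWeight N (-y) * ((P - M) / Real.sinh y)| ≤ Real.exp (-y) * (1 / N) := by
    rw [abs_mul, abs_of_pos (saddleWeight_pos _ _),
      abs_of_nonneg (div_nonneg (sub_nonneg.2 h1') hs.le)]
    refine mul_le_mul (saddleWeight_neg_le hN0.le) ?_
      (div_nonneg (sub_nonneg.2 h1') hs.le) hm.le
    rw [div_le_iff₀ hs]
    linarith [show 1 / N * Real.sinh y = Real.sinh y / N by ring]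
  have t2 : |((saddleWeight N y - saddleWeight N (-y)) / Real.sinh y - gaussianModel N y) * P| ≤
      Real.exp (-(N * y / 3)) + 5 * y * Real.exp (-(N * y ^ 2 / 10)) := by
    rw [abs_mul, abs_of_nonneg h4]
    exact (mul_le_of_le_one_right (abs_nonneg _) h2).trans
      (abs_saddleWeight_sub_sub_gaussianModel_le hN hy)
  have t3 : |-(gaussianModel N y * (1 - P))| ≤ 2 * (Real.exp (-y) / (2 * N)) := by
    rw [abs_neg, abs_mul, abs_of_nonneg (sub_nonneg.2 h2)]
    refine mul_le_mul ?_ (by linarith) (sub_nonneg.2 h2) two_pos.le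
    refine (abs_gaussianModel_le hN0.le).trans ?_
    have : Real.exp (-(N * y ^ 2 / 3)) ≤ 1 := Real.exp_le_one_iff.2 (by
      have : 0 ≤ N * y ^ 2 := by positivity
      linarith)
    linarith
  rw [e]
  refine (abs_add_three _ _ _).trans ?_
  have : Real.exp (-y) * (1 / N) + 2 * (Real.exp (-y) / (2 * N)) = 2 / N * Real.exp (-y) := by
    field_simp; norm_num
  linarith

/-! ### Integration of the estimates -/

/-- Rescaling by √N reduces to 2e^{-w²/2} - w²e^{-w²/2}/3. Both Gaussian moments equal √(π/2),
whence the factor 2 - 1/3 = 5/3. -/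
lemma integral_gaussianModel {N : ℝ} (hN : 0 < N) :
    IntegrableOn (gaussianModel N) (Ioi 0) ∧
    ∫ y in Ioi (0 : ℝ), gaussianModel N y = 5 / 6 * √(2 * Real.pi / N) := by
  have hc : 0 < √N := Real.sqrt_pos.2 hN
  have hc2 : √N ^ 2 = N := Real.sq_sqrt hN.le
  obtain ⟨j2, v2⟩ := integral_sq_mul_gaussian_half
  have j0 := integrableOn_gaussian_half
  have ji : IntegrableOn (fun w : ℝ =>
      2 * Real.exp (-w ^ 2 / 2) - 1 / 3 * (w ^ 2 * Real.exp (-w ^ 2 / 2))) (Ioi 0) :=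
    (j0.const_mul 2).sub (j2.const_mul (1 / 3))
  have hv : ∫ w in Ioi (0 : ℝ), (2 * Real.exp (-w ^ 2 / 2) -
      1 / 3 * (w ^ 2 * Real.exp (-w ^ 2 / 2))) = 5 / 3 * √(Real.pi / 2) := by
    rw [integral_sub (j0.const_mul 2) (j2.const_mul (1 / 3)), integral_const_mul,
      integral_const_mul, v2, integral_gaussian_half]
    ring
  have hfun : gaussianModel N = fun y => (fun w : ℝ => 2 * Real.exp (-w ^ 2 / 2) -
      1 / 3 * (w ^ 2 * Real.exp (-w ^ 2 / 2))) (√N * y) := by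
    funext y
    simp only [gaussianModel, mul_pow, hc2]
    rw [show -(N * y ^ 2 / 2) = -(N * y ^ 2) / 2 by ring]
    ring
  constructor
  · rw [hfun]
    have := (integrableOn_Ioi_comp_mul_left_iff _ 0 hc).2 (by rwa [mul_zero])
    exact this
  · have h2 : √(2 * Real.pi / N) = 2 * √(Real.pi / 2) / √N := by
      rw [show 2 * Real.pi / N = 2 ^ 2 * (Real.pi / 2) / N by ring,
        Real.sqrt_div (x := 2 ^ 2 * (Real.pi / 2)) (by positivity) N,
        Real.sqrt_mul (x := 2 ^ 2) (by norm_num), Real.sqrt_sq (x := 2) (by norm_num)]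
    rw [hfun, integral_comp_mul_left_Ioi _ 0 hc, mul_zero, hv, smul_eq_mul, h2]
    ring

lemma integral_id_mul_gaussian {b : ℝ} (hb : 0 < b) :
    IntegrableOn (fun y : ℝ => y * Real.exp (-(b * y ^ 2))) (Ioi 0) ∧
    ∫ y in Ioi (0 : ℝ), y * Real.exp (-(b * y ^ 2)) = 1 / (2 * b) := by
  have hd : ∀ y ∈ Ici (0 : ℝ), HasDerivAt (fun y => -(1 / (2 * b)) * Real.exp (-(b * y ^ 2)))
      (y * Real.exp (-(b * y ^ 2))) y := fun y _ => by
    refine ((((hasDerivAt_pow 2 y).const_mul b).fun_neg.exp).const_mul _).congr_deriv ?_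
    push_cast
    field_simp
  have ht : Tendsto (fun y => -(1 / (2 * b)) * Real.exp (-(b * y ^ 2))) atTop (𝓝 0) := by
    have h := (Real.tendsto_exp_neg_atTop_nhds_zero.comp
      ((tendsto_pow_atTop (α := ℝ) two_ne_zero).const_mul_atTop hb)).const_mul (-(1 / (2 * b)))
    rw [mul_zero] at h
    exact h
  have hp : ∀ y ∈ Ioi (0 : ℝ), 0 ≤ y * Real.exp (-(b * y ^ 2)) :=
    fun y hy => mul_nonneg (le_of_lt hy) (Real.exp_pos _).le
  refine ⟨integrableOn_Ioi_deriv_of_nonneg' hd hp ht, ?_⟩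
  rw [integral_Ioi_of_hasDerivAt_of_nonneg' hd hp ht]
  simp

lemma integral_exp_neg_mul {b : ℝ} (hb : 0 < b) :
    IntegrableOn (fun y : ℝ => Real.exp (-(b * y))) (Ioi 0) ∧
    ∫ y in Ioi (0 : ℝ), Real.exp (-(b * y)) = 1 / b := by
  have h1 := integrableOn_exp_mul_Ioi (a := -b) (by linarith) 0
  have h2 := integral_exp_mul_Ioi (a := -b) (by linarith) 0
  simp only [neg_mul] at h1 h2
  refine ⟨h1, h2.trans ?_⟩
  simp

theorem abs_truncationError_sub_le {x : ℕ} (hx : 1 ≤ x) :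
    |-(Real.exp (4 * x) * (Real.pi * (4 * x)) * truncationError x) -
      5 / 6 * √(2 * Real.pi / (4 * x))| ≤ 30 / (4 * x) := by
  have hx1 : (1 : ℝ) ≤ x := by exact_mod_cast hx
  obtain ⟨N, hN⟩ : ∃ N : ℝ, N = 4 * x := ⟨_, rfl⟩
  have hN4 : 4 ≤ N := by linarith
  have hN0 : 0 < N := by linarith
  obtain ⟨he, hv⟩ := integral_errorIntegrand hx
  obtain ⟨hm, hmv⟩ := integral_gaussianModel hN0
  have hpi := Real.pi_pos
  have hc : Real.pi / (2 * N) * Real.exp (-N) ≠ 0 := by positivity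
  have hfun : ∀ y ∈ Ioi (0 : ℝ), errorIntegrand (2 * x) (2 * x) y =
      -(Real.pi / (2 * N) * Real.exp (-N)) * scaledIntegrand N y := fun y hy => by
    rw [hN]; exact errorIntegrand_eq_scaledIntegrand hx hy
  have hJ : IntegrableOn (scaledIntegrand N) (Ioi 0) := by
    have h := (he.congr_fun hfun measurableSet_Ioi).const_mul
      (-(Real.pi / (2 * N) * Real.exp (-N)))⁻¹
    simp only [inv_mul_cancel_left₀ (neg_ne_zero.2 hc)] at h
    exact h
  rw [setIntegral_congr_fun measurableSet_Ioi hfun, integral_const_mul] at hv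
  have hJv : -(Real.exp N * (Real.pi * N) * truncationError x) =
      ∫ y in Ioi (0 : ℝ), scaledIntegrand N y := by
    have hE : Real.exp N * Real.exp (-N) = 1 := by rw [← Real.exp_add]; simp
    have h3 : Real.pi ^ 2 * truncationError x * N =
        -(Real.pi * Real.exp (-N)) * ∫ y in Ioi (0 : ℝ), scaledIntegrand N y := by
      field_simp at hv
      linear_combination (-Real.pi) * hv
    have h4 : Real.pi * (-(Real.exp N * (Real.pi * N) * truncationError x)) =
        Real.pi * ∫ y in Ioi (0 : ℝ), scaledIntegrand N y := by
      linear_combination (-Real.exp N) * h3 +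
        (Real.pi * ∫ y in Ioi (0 : ℝ), scaledIntegrand N y) * hE
    exact mul_left_cancel₀ hpi.ne' h4
  obtain ⟨i1, v1⟩ := integral_exp_neg_mul one_pos
  obtain ⟨i2, v2⟩ := integral_exp_neg_mul (b := N / 3) (by positivity)
  obtain ⟨i3, v3⟩ := integral_id_mul_gaussian (b := N / 10) (by positivity)
  have k1 := i1.const_mul (2 / N)
  have k3 := i3.const_mul 5
  have k23 := i2.add k3
  rw [← hN, hJv, ← hmv, ← integral_sub hJ hm]
  have hb := norm_integral_le_of_norm_le (f := fun y => scaledIntegrand N y - gaussianModel N y)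
    (μ := volume.restrict (Ioi 0)) (k1.add k23) (by
      filter_upwards [ae_restrict_mem measurableSet_Ioi] with y hy
      have := abs_scaledIntegrand_sub_gaussianModel_le hN4 hy
      rw [Real.norm_eq_abs]
      refine this.trans (le_of_eq ?_)
      simp only [Pi.add_apply]
      rw [one_mul, show N * y / 3 = N / 3 * y by ring, show N * y ^ 2 / 10 = N / 10 * y ^ 2 by ring])
  rw [Real.norm_eq_abs] at hb
  refine hb.trans (le_of_eq ?_)
  -- The three bounds integrate to 2/N, 3/N and 5 · 5/N = 25/N, hence 30/N in all.
  rw [integral_add' k1 k23, integral_add' i2 k3, integral_const_mul, integral_const_mul, v1, v2, v3]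
  field_simp
  norm_num

/-! ### The estimate of the remainder and the first equivalent -/

lemma rpow_three_halves {x : ℝ} (hx : 0 < x) : x ^ (3 / 2 : ℝ) = x * √x := by
  rw [show (3 / 2 : ℝ) = 1 + 1 / 2 by norm_num, Real.rpow_add hx, Real.rpow_one,
    ← Real.sqrt_eq_rpow]

/-- The relative remainder of the truncation error. -/
noncomputable def remainder (x : ℕ) : ℝ :=
  -(Real.exp (4 * x) * truncationError x) -
    5 / (24 * √(2 * Real.pi) * (x : ℝ) ^ (3 / 2 : ℝ))

lemma truncationError_eq (x : ℕ) : truncationError x = -Real.exp (-4 * (x : ℝ)) *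
    (5 / (24 * √(2 * Real.pi) * (x : ℝ) ^ (3 / 2 : ℝ)) + remainder x) := by
  have hE : Real.exp (-4 * (x : ℝ)) * Real.exp (4 * x) = 1 := by rw [← Real.exp_add]; simp
  rw [remainder]
  linear_combination (-truncationError x) * hE

lemma abs_remainder_lt {x : ℕ} (hx : 1 ≤ x) : |remainder x| < 0.863 / (x : ℝ) ^ 2 := by
  have hx0 : (0 : ℝ) < x := by exact_mod_cast hx
  have hpi := Real.pi_pos
  have hs := Real.sqrt_pos.2 hx0
  have hs2 := Real.sqrt_pos.2 (show 0 < 2 * Real.pi by positivity)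
  have h := abs_truncationError_sub_le hx
  have e1 : √(2 * Real.pi / (4 * x)) = √(2 * Real.pi) / (2 * √x) := by
    rw [Real.sqrt_div (by positivity), show (4 : ℝ) * x = 2 ^ 2 * x by ring,
      Real.sqrt_mul (x := 2 ^ 2) (by norm_num), Real.sqrt_sq (x := 2) (by norm_num)]
  have e2 : -(Real.exp (4 * x) * (Real.pi * (4 * x)) * truncationError x) -
      5 / 6 * √(2 * Real.pi / (4 * x)) = Real.pi * (4 * x) * remainder x := by
    have e3 : 5 / 6 * (√(2 * Real.pi) / (2 * √x)) =
        Real.pi * (4 * x) * (5 / (24 * √(2 * Real.pi) * (x * √x))) := by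
      have := Real.sq_sqrt (show 0 ≤ 2 * Real.pi by positivity)
      field_simp
      linarith
    rw [remainder, e1, rpow_three_halves hx0, e3]
    ring
  rw [e2, abs_mul, abs_of_pos (by positivity : 0 < Real.pi * (4 * x))] at h
  rw [lt_div_iff₀ (by positivity)]
  rw [le_div_iff₀ (by positivity)] at h
  -- The remainder is at most 30/(16π x²), and π > 3 already gives 0.625 < 0.863.
  have h3 := Real.pi_gt_three
  have h4 : 0 ≤ |remainder x| * (x : ℝ) ^ 2 := by positivity
  have h5 : 16 * 3 * (|remainder x| * (x : ℝ) ^ 2) ≤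
      16 * Real.pi * (|remainder x| * (x : ℝ) ^ 2) := by gcongr
  nlinarith

lemma tendsto_mul_remainder :
    Tendsto (fun x : ℕ => (x : ℝ) ^ (3 / 2 : ℝ) * remainder x) atTop (𝓝 0) := by
  have h1 : Tendsto (fun x : ℕ => 1 / √(x : ℝ)) atTop (𝓝 0) :=
    tendsto_const_nhds.div_atTop (Real.tendsto_sqrt_atTop.comp tendsto_natCast_atTop_atTop)
  refine squeeze_zero_norm' ?_ h1
  filter_upwards [eventually_ge_atTop 1] with x hx
  have hx0 : (0 : ℝ) < x := by exact_mod_cast hx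
  have hs := Real.sqrt_pos.2 hx0
  have hs2 := Real.sq_sqrt hx0.le
  have h := (abs_remainder_lt hx).le
  rw [norm_mul, Real.norm_eq_abs, Real.norm_eq_abs, rpow_three_halves hx0,
    abs_of_pos (by positivity)]
  calc x * √x * |remainder x| ≤ x * √x * (0.863 / (x : ℝ) ^ 2) := by gcongr
    _ = 0.863 * (1 / √x) := by
      field_simp
      rw [hs2]
    _ ≤ 1 / √x := by
      have : 0 < 1 / √(x : ℝ) := by positivity
      linarith

theorem truncationError_isEquivalent :
    truncationError ~[atTop] fun x : ℕ =>
      -(5 * Real.exp (-4 * (x : ℝ)) / (24 * √(2 * Real.pi) * (x : ℝ) ^ (3 / 2 : ℝ))) := by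
  have hs2 := Real.sqrt_pos.2 (show 0 < 2 * Real.pi by positivity)
  refine isEquivalent_of_tendsto_one ?_
  have h := (tendsto_mul_remainder.const_mul (24 * √(2 * Real.pi) / 5)).const_add 1
  rw [mul_zero, add_zero] at h
  refine h.congr' ?_
  filter_upwards [eventually_ge_atTop 1] with x hx
  have hx0 : (0 : ℝ) < x := by exact_mod_cast hx
  have hr : 0 < (x : ℝ) ^ (3 / 2 : ℝ) := Real.rpow_pos_of_pos hx0 _
  have hE := Real.exp_pos (-4 * (x : ℝ))
  rw [Pi.div_apply, truncationError_eq]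
  field_simp

/-! ### The asymptotics of I₀ and the second equivalent -/

/-- The terms decrease up to index 2x: the ratio of consecutive terms is at most ((k + 2)/(2x))².
The bound is therefore the term of index 1, and the 2x terms after the leading 1 contribute at most
1/(16x). -/
lemma truncatedSum_term_le {x k : ℕ} (hx : 1 ≤ x) (hk : k < 2 * x) :
    ((2 * (k + 1)).factorial : ℝ) ^ 3 /
      (((k + 1).factorial : ℝ) ^ 4 * (16 * (x : ℝ)) ^ (2 * (k + 1))) ≤ 1 / (32 * (x : ℝ) ^ 2) := by
  have hx0 : (0 : ℝ) < x := by exact_mod_cast hx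
  induction k with
  | zero =>
    apply le_of_eq
    simp [Nat.factorial]
    field_simp
    norm_num
  | succ k ih =>
    refine le_trans ?_ (ih (by omega))
    have hk2 : (k : ℝ) + 2 ≤ 2 * x := by exact_mod_cast hk
    have f1 : ((2 * (k + 1 + 1)).factorial : ℝ) =
        (2 * k + 4) * (2 * k + 3) * (2 * (k + 1)).factorial := by
      rw [show 2 * (k + 1 + 1) = 2 * (k + 1) + 1 + 1 by ring, Nat.factorial_succ,
        Nat.factorial_succ]
      push_cast; ring
    have f2 : ((k + 1 + 1).factorial : ℝ) = (k + 2) * (k + 1).factorial := by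
      rw [Nat.factorial_succ]; push_cast; ring
    have f3 : (16 * (x : ℝ)) ^ (2 * (k + 1 + 1)) =
        (16 * (x : ℝ)) ^ (2 * (k + 1)) * (256 * (x : ℝ) ^ 2) := by
      rw [show 2 * (k + 1 + 1) = 2 * (k + 1) + 2 by ring, pow_add]; ring
    rw [f1, f2, f3]
    have hA : (0 : ℝ) < (2 * (k + 1)).factorial := by positivity
    have hB : (0 : ℝ) < (k + 1).factorial := by positivity
    have hC : 0 < (16 * (x : ℝ)) ^ (2 * (k + 1)) := by positivity
    generalize ((2 * (k + 1)).factorial : ℝ) = A at *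
    generalize ((k + 1).factorial : ℝ) = B at *
    generalize (16 * (x : ℝ)) ^ (2 * (k + 1)) = C at *
    have hk0 : (0 : ℝ) ≤ k := Nat.cast_nonneg k
    generalize (k : ℝ) = c at *
    have key : ((2 * c + 4) * (2 * c + 3)) ^ 3 / ((c + 2) ^ 4 * (256 * (x : ℝ) ^ 2)) ≤ 1 := by
      rw [div_le_one (by positivity)]
      have h1 : (2 * c + 4) * (2 * c + 3) ≤ 4 * (c + 2) ^ 2 := by nlinarith
      calc ((2 * c + 4) * (2 * c + 3)) ^ 3 ≤ (4 * (c + 2) ^ 2) ^ 3 := by gcongr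
        _ = (c + 2) ^ 4 * (64 * (c + 2) ^ 2) := by ring
        _ ≤ (c + 2) ^ 4 * (64 * (2 * x) ^ 2) := by gcongr
        _ = _ := by ring
    calc ((2 * c + 4) * (2 * c + 3) * A) ^ 3 / (((c + 2) * B) ^ 4 * (C * (256 * (x : ℝ) ^ 2)))
        = ((2 * c + 4) * (2 * c + 3)) ^ 3 / ((c + 2) ^ 4 * (256 * (x : ℝ) ^ 2)) *
          (A ^ 3 / (B ^ 4 * C)) := by field_simp
      _ ≤ A ^ 3 / (B ^ 4 * C) := mul_le_of_le_one_left (by positivity) key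

lemma tendsto_mul_truncatedSum :
    Tendsto (fun x : ℕ => 4 * (x : ℝ) * truncatedSum x) atTop (𝓝 1) := by
  have hinv : Tendsto (fun x : ℕ => 1 + 1 / 16 * (x : ℝ)⁻¹) atTop (𝓝 1) := by
    simpa only [mul_zero, add_zero] using
      ((tendsto_inv_atTop_nhds_zero_nat (𝕜 := ℝ)).const_mul (1 / 16)).const_add 1
  have hsum : ∀ x : ℕ, 1 ≤ x → 4 * (x : ℝ) * truncatedSum x =
      1 + ∑ k ∈ Finset.range (2 * x), ((2 * (k + 1)).factorial : ℝ) ^ 3 /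
        (((k + 1).factorial : ℝ) ^ 4 * (16 * (x : ℝ)) ^ (2 * (k + 1))) := fun x hx => by
    have hx0 : (0 : ℝ) < x := by exact_mod_cast hx
    rw [truncatedSum, Finset.sum_range_succ', ← mul_assoc, mul_one_div_cancel (by positivity)]
    simp [add_comm]
  refine tendsto_of_tendsto_of_tendsto_of_le_of_le' tendsto_const_nhds hinv ?_ ?_
  · filter_upwards [eventually_ge_atTop 1] with x hx
    rw [hsum x hx]
    have : 0 ≤ ∑ k ∈ Finset.range (2 * x), ((2 * (k + 1)).factorial : ℝ) ^ 3 /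
        (((k + 1).factorial : ℝ) ^ 4 * (16 * (x : ℝ)) ^ (2 * (k + 1))) :=
      Finset.sum_nonneg fun k _ => by positivity
    linarith
  · filter_upwards [eventually_ge_atTop 1] with x hx
    have hx0 : (0 : ℝ) < x := by exact_mod_cast hx
    rw [hsum x hx]
    have := Finset.sum_le_card_nsmul (Finset.range (2 * x)) _ _
      fun k hk => truncatedSum_term_le hx (Finset.mem_range.1 hk)
    rw [Finset.card_range, nsmul_eq_mul] at this
    have e : ((2 * x : ℕ) : ℝ) * (1 / (32 * (x : ℝ) ^ 2)) = 1 / 16 * (x : ℝ)⁻¹ := by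
      push_cast; field_simp; norm_num
    linarith

lemma tendsto_mul_truncationError :
    Tendsto (fun x : ℕ => 4 * (x : ℝ) * truncationError x) atTop (𝓝 0) := by
  have h1 : Tendsto (fun x : ℕ => 1 / √(x : ℝ)) atTop (𝓝 0) :=
    tendsto_const_nhds.div_atTop (Real.tendsto_sqrt_atTop.comp tendsto_natCast_atTop_atTop)
  have h2 : Tendsto (fun x : ℕ => 30 * (1 / √(x : ℝ))) atTop (𝓝 0) := by
    simpa using h1.const_mul 30
  refine squeeze_zero_norm' ?_ h2
  filter_upwards [eventually_ge_atTop 1] with x hx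
  have hx1 : (1 : ℝ) ≤ x := by exact_mod_cast hx
  have hx0 : (0 : ℝ) < x := by linarith
  have hs := Real.sqrt_pos.2 hx0
  have hs2 := Real.sq_sqrt hx0.le
  have hs1 : 1 ≤ √(x : ℝ) := Real.one_le_sqrt.2 hx1
  have hp : 1 ≤ √(2 * Real.pi) := Real.one_le_sqrt.2 (by linarith [Real.pi_gt_three])
  have hr := (abs_remainder_lt hx).le
  have hm : |5 / (24 * √(2 * Real.pi) * (x : ℝ) ^ (3 / 2 : ℝ)) + remainder x| ≤
      2 * (1 / (x * √x)) := by
    refine (abs_add_le _ _).trans ?_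
    rw [rpow_three_halves hx0, abs_of_pos (by positivity)]
    have a1 : 5 / (24 * √(2 * Real.pi) * (x * √x)) ≤ 1 / (x * √x) := by
      rw [div_le_div_iff₀ (by positivity) (by positivity)]
      have : 0 < x * √x := by positivity
      nlinarith
    have a2 : 0.863 / (x : ℝ) ^ 2 ≤ 1 / (x * √x) := by
      refine div_le_div₀ zero_le_one (by norm_num) (by positivity) ?_
      nlinarith
    linarith
  have hE : Real.exp (-4 * (x : ℝ)) ≤ 1 := Real.exp_le_one_iff.2 (by linarith)
  rw [truncationError_eq, Real.norm_eq_abs, abs_mul, abs_of_pos (by positivity : 0 < 4 * (x : ℝ)),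
    abs_mul, abs_neg, abs_of_pos (Real.exp_pos _)]
  calc 4 * (x : ℝ) * (Real.exp (-4 * (x : ℝ)) *
      |5 / (24 * √(2 * Real.pi) * (x : ℝ) ^ (3 / 2 : ℝ)) + remainder x|)
      ≤ 4 * (x : ℝ) * (1 * (2 * (1 / (x * √x)))) := by gcongr
    _ = 8 * (1 / √x) := by field_simp; norm_num
    _ ≤ 30 * (1 / √x) := by gcongr; norm_num

lemma tendsto_scaledK : Tendsto (fun x : ℕ => scaledK (2 * x)) atTop (𝓝 √(Real.pi / 2)) := by
  have h : Tendsto (fun x : ℕ => √(Real.pi / 2) * (1 - 1 / 16 * (x : ℝ)⁻¹)) atTop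
      (𝓝 √(Real.pi / 2)) := by
    simpa only [mul_zero, sub_zero, mul_one] using
      (((tendsto_inv_atTop_nhds_zero_nat (𝕜 := ℝ)).const_mul (1 / 16)).const_sub 1).const_mul
        √(Real.pi / 2)
  refine tendsto_of_tendsto_of_tendsto_of_le_of_le' h tendsto_const_nhds ?_ ?_
  · filter_upwards [eventually_ge_atTop 1] with x hx
    have hx0 : (0 : ℝ) < x := by exact_mod_cast hx
    refine le_trans (le_of_eq ?_) (le_scaledK (show (0 : ℝ) < 2 * x by positivity))
    congr 2
    field_simp
    norm_num
  · filter_upwards [eventually_ge_atTop 1] with x hx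
    have hx0 : (0 : ℝ) < x := by exact_mod_cast hx
    exact scaledK_le (show (0 : ℝ) < 2 * x by positivity)

/-- Divide 4x I₀K₀ = 4x(S + Δ) → 1 by √(2x) e^{2x} K₀ → √(π/2); no separate asymptotic analysis of
the series of I₀ is needed. -/
theorem besselI_zero_isEquivalent :
    (fun x : ℕ => besselI 0 x) ~[atTop]
      fun x : ℕ => Real.exp (2 * x) / (2 * √(Real.pi * x)) := by
  refine isEquivalent_of_tendsto_one ?_
  have hc : √(Real.pi / 2) ≠ 0 := (Real.sqrt_pos.2 (by positivity)).ne'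
  have h := ((tendsto_mul_truncatedSum.add tendsto_mul_truncationError).div tendsto_scaledK
    hc).mul_const √(Real.pi / 2)
  rw [add_zero, one_div, inv_mul_cancel₀ hc] at h
  refine h.congr' ?_
  filter_upwards [eventually_ge_atTop 1] with x hx
  have hx0 : (0 : ℝ) < x := by exact_mod_cast hx
  have hK := besselK0_pos hx0
  have hs := Real.sqrt_pos.2 hx0
  have hs2 := Real.sq_sqrt hx0.le
  have hp := Real.sqrt_pos.2 Real.pi_pos
  have h2 := Real.sqrt_pos.2 (two_pos (α := ℝ))
  have hE := Real.exp_pos (2 * (x : ℝ))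
  have e1 : 4 * (x : ℝ) * truncatedSum x + 4 * (x : ℝ) * truncationError x =
      4 * x * (besselI 0 x * besselK0 x) := by rw [truncationError]; ring
  simp only [Pi.div_apply]
  rw [e1, scaledK_eq (by positivity), ← besselK0_eq_coshInt hx0, Real.sqrt_div Real.pi_pos.le,
    Real.sqrt_mul two_pos.le, Real.sqrt_mul Real.pi_pos.le]
  have hs4 := Real.sq_sqrt (two_pos (α := ℝ)).le
  field_simp
  rw [hs2, hs4]
  ring

theorem truncationError_div_isEquivalent :
    (fun x : ℕ => truncationError x / besselI 0 x ^ 2) ~[atTop] fun x : ℕ =>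
      -(5 * √(2 * Real.pi) / (12 * (x : ℝ) ^ (1 / 2 : ℝ)) * Real.exp (-8 * (x : ℝ))) := by
  have h := truncationError_isEquivalent.div (besselI_zero_isEquivalent.pow 2)
  refine h.congr_right ?_
  filter_upwards [eventually_ge_atTop 1] with x hx
  have hx0 : (0 : ℝ) < x := by exact_mod_cast hx
  have hs := Real.sqrt_pos.2 hx0
  have hs2 := Real.sq_sqrt (show 0 ≤ Real.pi * x by positivity)
  have hp := Real.sqrt_pos.2 (show 0 < 2 * Real.pi by positivity)
  have hp2 := Real.sq_sqrt (show 0 ≤ 2 * Real.pi by positivity)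
  -- Division by I₀² ~ e^{4x}/(4πx) turns e^{-4x} into e^{-8x} and x^{-3/2} into x^{-1/2}.
  have hE : Real.exp (-4 * (x : ℝ)) = Real.exp (-8 * (x : ℝ)) * Real.exp (2 * x) ^ 2 := by
    rw [← Real.exp_nat_mul, ← Real.exp_add]; congr 1; push_cast; ring
  have hE2 := Real.exp_pos (2 * (x : ℝ))
  simp only [Pi.div_apply, Pi.pow_apply]
  rw [rpow_three_halves hx0, ← Real.sqrt_eq_rpow, hE, div_pow, mul_pow, hs2]
  field_simp
  rw [hp2]
  ring

end BrentMcMillan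

theorem mainTheorem1 :
    -- the precise estimate, for every positive integer `x`
    (∃ ε : ℕ → ℝ, ∀ x : ℕ, 1 ≤ x →
      BrentMcMillan.truncationError x =
          -Real.exp (-4 * (x : ℝ)) *
            (5 / (24 * Real.sqrt (2 * Real.pi) * (x : ℝ) ^ (3 / 2 : ℝ)) + ε x) ∧
        |ε x| < 0.863 / (x : ℝ) ^ 2) ∧
    -- the equivalent of the truncation error
    (BrentMcMillan.truncationError ~[atTop] fun x : ℕ =>
      -(5 * Real.exp (-4 * (x : ℝ)) /
        (24 * Real.sqrt (2 * Real.pi) * (x : ℝ) ^ (3 / 2 : ℝ)))) ∧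
    -- the error of the approximation of `K₀(x) / I₀(x)` is `Δ(x) / I₀(x)²`
    (∀ x : ℕ, 1 ≤ x →
      BrentMcMillan.besselK0 x / BrentMcMillan.besselI 0 x -
          BrentMcMillan.truncatedSum x / BrentMcMillan.besselI 0 x ^ 2 =
        BrentMcMillan.truncationError x / BrentMcMillan.besselI 0 x ^ 2) ∧
    -- the equivalent of that error
    ((fun x : ℕ => BrentMcMillan.truncationError x / BrentMcMillan.besselI 0 x ^ 2) ~[atTop]
      fun x : ℕ =>
        -(5 * Real.sqrt (2 * Real.pi) / (12 * (x : ℝ) ^ (1 / 2 : ℝ)) *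
          Real.exp (-8 * (x : ℝ)))) := by
  refine ⟨⟨BrentMcMillan.remainder, fun x hx =>
    ⟨BrentMcMillan.truncationError_eq x, BrentMcMillan.abs_remainder_lt hx⟩⟩,
    BrentMcMillan.truncationError_isEquivalent, fun x _ => ?_,
    BrentMcMillan.truncationError_div_isEquivalent⟩
  have hI := (BrentMcMillan.besselI_zero_pos x).ne'
  rw [BrentMcMillan.truncationError]
  field_simp
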